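/- For differentiable functions $f,g$ put $W[f,g](x)=f(x)g'(x)-g(x)f'(x)$. Consider the following three diffusions on $\mathcal I=(l,r)$ and, for each real $\rho>0$, their increasing and decreasing fundamental solutions $\varphi^+_\rho$ and $\varphi^-_\rho$, which are differentiable on $\mathcal I$. (SQB) The squared Bessel diffusion $dX_t=\lambda_0\,dt+\nu_0\sqrt{X_t}\,dW_t$ on $(0,\infty)$, with $\nu_0>0$ and $\mu=\frac{2\lambda_0}{\nu_0^2}-1>0$: $$\varphi^+_\rho(x)=x^{-\mu/2}I_\mu\big(2\sqrt{2\rho x}/\nu_0\big),\qquad \varphi^-_\rho(x)=x^{-\mu/2}K_\mu\big(2\sqrt{2\rho x}/\nu_0\big),$$ where $I_\mu,K_\mu$ are the modified Bessel functions. (CIR) The Cox-Ingersoll-Ross diffusion $dX_t=(\lambda_0-\lambda_1X_t)\,dt+\nu_0\sqrt{X_t}\,dW_t$ on $(0,\infty)$, with $\nu_0,\lambda_1>0$, $\mu=\frac{2\lambda_0}{\nu_0^2}-1>0$, and $\kappa=\frac{2\lambda_1}{\nu_0^2}$: $$\varphi^+_\rho(x)=\mathcal M\big(\tfrac{\rho}{\lambda_1},\mu+1,\kappa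 x\big),\qquad \varphi^-_\rho(x)=\mathcal U\big(\tfrac{\rho}{\lambda_1},\mu+1,\kappa x\big),$$ where $\mathcal M,\mathcal U$ are the Kummer and Tricomi confluent hypergeometric functions. (OU) The Ornstein-Uhlenbeck diffusion $dX_t=(\lambda_0-\lambda_1X_t)\,dt+\nu_0\,dW_t$ on $(-\infty,\infty)$, with $\nu_0,\lambda_1>0$, $\lambda_0\in\mathbb R$, and $\kappa=\frac{2\lambda_1}{\nu_0^2}$: with $y=x-\lambda_0/\lambda_1$, $$\varphi^-_\rho(x)=e^{\kappa y^2/4}D_{-\rho/\lambda_1}(\sqrt\kappa\,y),\qquad \varphi^+_\rho(x)=e^{\kappa y^2/4}D_{-\rho/\lambda_1}(-\sqrt\kappa\,y),$$ where $D$ is Whittaker's parabolic cylinder function. Let $\rho_1,\rho_2>0$ be real, let $\mathrm{sign}(x)=\pm1$ for $\pm x>0$ and $\mathrm{sign}(0)=0$, and let $0\cdot\infty=0$. Then $$W[\varphi^+_{\rho_1},\varphi^+_{\rho_2}](x)\to\begin{cases}\mathrm{sign}(\rho_2-\rho_1)\,C,& x\to l+,\\ \mathrm{sign}(\rho_2-\rho_1)\,\infty,&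 x\to r-,\end{cases}$$ with a constant $C>0$ (independent of $x$) for SQB and CIR, and $C=0$ for OU; $$W[\varphi^-_{\rho_1},\varphi^-_{\rho_2}](x)\to\begin{cases}\mathrm{sign}(\rho_1-\rho_2)\,\infty,& x\to l+,\\ \mathrm{sign}(\rho_1-\rho_2)\,0,& x\to r-;\end{cases}$$ $$W[\varphi^+_{\rho_1},\varphi^-_{\rho_2}](x)\to-\infty\quad\text{as }x\to l+;$$ $$W[\varphi^+_{\rho_1},\varphi^-_{\rho_2}](x)\to-\infty\quad\text{as }x\to r-,\text{ for CIR and OU};$$ $$W[\varphi^+_{\rho_1},\varphi^-_{\rho_2}](x)\to\begin{cases}-0,&\rho_1\le\rho_2,\\-\infty,&\rho_1>\rho_2,\end{cases}\quad\text{as }x\to r-,\text{ for SQB}.$$ All these convergences are monotonic: near the endpoint in question, $W$ is a monotonic function of $x$ and has constant sign, namely the sign $\mathrm{sign}(\rho_2-\rho_1)$ for $W[\varphi^+_{\rho_1},\varphi^+_{\rho_2}]$, $\mathrm{sign}(\rho_1-\rho_2)$ for $W[\varphi^-_{\rho_1},\varphi^-_{\rho_2}]$, and $-1$ for $W[\varphi^+_{\rho_1},\varphi^-_{\rho_2}]$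 (so $W\to+0$ means $W\to0$ with $W>0$ near the endpoint, and $W\to-0$ means $W\to 0$ with $W<0$ near the endpoint). -/

import Mathlib

open Set Filter Topology

noncomputable section

/-- The Wronskian `W[f, g](x) = f(x) g'(x) - g(x) f'(x)`. -/
def wronskianFn (f g : ℝ → ℝ) (x : ℝ) : ℝ :=
  f x * deriv g x - g x * deriv f x

/-- `W` tends to the extended real number `L` along the filter `l` (one-sided neighbourhoods of an
endpoint of the state space), the convergence being monotonic: near the endpoint, `W` is a monotonic
function and its sign is constantly `σ` (`1`, `-1` or `0`). Thus `W → +0` is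
`MonotonicLimit W l 0 1`, `W → -0` is `MonotonicLimit W l 0 (-1)`, `W → -∞` is
`MonotonicLimit W l ⊥ (-1)`. -/
def MonotonicLimit (W : ℝ → ℝ) (l : Filter ℝ) (L : EReal) (σ : ℝ) : Prop :=
  Tendsto (fun x => (W x : EReal)) l (𝓝 L) ∧
  (∀ᶠ x in l, Real.sign (W x) = σ) ∧
  ∃ S ∈ l, MonotoneOn W S ∨ AntitoneOn W S

/-! ### Special functions (real parameters) -/

/-- Modified Bessel function of the first kind `I_μ(z)`, for `μ > 0` and `z > 0`. -/
def besselI (μ z : ℝ) : ℝ :=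
  (z / 2) ^ μ * ∑' k : ℕ, (z ^ 2 / 4) ^ k / ((k.factorial : ℝ) * Real.Gamma (μ + k + 1))

/-- Modified Bessel function of the second kind (Macdonald function) `K_μ(z)`, for `z > 0`. -/
def besselK (μ z : ℝ) : ℝ :=
  ∫ t in Ioi (0 : ℝ), Real.exp (-z * Real.cosh t) * Real.cosh (μ * t)

/-- Kummer's confluent hypergeometric function `M(a, b, z)`, for `b > 0`. -/
def kummerM (a b z : ℝ) : ℝ :=
  ∑' n : ℕ, (ascPochhammer ℝ n).eval a / (ascPochhammer ℝ n).eval b * z ^ n / (n.factorial : ℝ)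

/-- Tricomi's confluent hypergeometric function `U(a, b, z)`, for `a > 0` and `z > 0`. -/
def kummerU (a b z : ℝ) : ℝ :=
  (1 / Real.Gamma a) *
    ∫ t in Ioi (0 : ℝ), Real.exp (-z * t) * t ^ (a - 1) * (1 + t) ^ (b - a - 1)

/-- Whittaker's parabolic cylinder function of negative order, `D_{-υ}(z)`, for `υ > 0` and
real `z`. -/
def parabolicDNeg (υ z : ℝ) : ℝ :=
  Real.exp (-z ^ 2 / 4) / Real.Gamma υ *
    ∫ t in Ioi (0 : ℝ), Real.exp (-z * t - t ^ 2 / 2) * t ^ (υ - 1)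

/-! ### Squared Bessel diffusion `dX = lam0 dt + nu0 √X dW` on `(0, ∞)` -/

/-- `μ = 2 lam0 / nu0² - 1`, for the squared Bessel and the CIR diffusion. -/
def indexMu (lam0 nu0 : ℝ) : ℝ := 2 * lam0 / nu0 ^ 2 - 1

/-- Increasing fundamental solution `φ⁺_ρ` of the squared Bessel diffusion. -/
def sqbPlus (lam0 nu0 ρ x : ℝ) : ℝ :=
  x ^ (-indexMu lam0 nu0 / 2) * besselI (indexMu lam0 nu0) (2 * √(2 * ρ * x) / nu0)

/-- Decreasing fundamental solution `φ⁻_ρ` of the squared Bessel diffusion. -/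
def sqbMinus (lam0 nu0 ρ x : ℝ) : ℝ :=
  x ^ (-indexMu lam0 nu0 / 2) * besselK (indexMu lam0 nu0) (2 * √(2 * ρ * x) / nu0)

/-! ### CIR diffusion `dX = (lam0 - lam1 X) dt + nu0 √X dW` on `(0, ∞)` -/

/-- `κ = 2 lam1 / nu0²`, for the CIR and the Ornstein-Uhlenbeck diffusion. -/
def kappaParam (lam1 nu0 : ℝ) : ℝ := 2 * lam1 / nu0 ^ 2

/-- Increasing fundamental solution `φ⁺_ρ` of the CIR diffusion. -/
def cirPlus (lam0 lam1 nu0 ρ x : ℝ) : ℝ :=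
  kummerM (ρ / lam1) (indexMu lam0 nu0 + 1) (kappaParam lam1 nu0 * x)

/-- Decreasing fundamental solution `φ⁻_ρ` of the CIR diffusion. -/
def cirMinus (lam0 lam1 nu0 ρ x : ℝ) : ℝ :=
  kummerU (ρ / lam1) (indexMu lam0 nu0 + 1) (kappaParam lam1 nu0 * x)

/-! ### Ornstein-Uhlenbeck diffusion `dX = (lam0 - lam1 X) dt + nu0 dW` on `(-∞, ∞)`

The solutions for `lam0 = 0` are shifted by `lam0 / lam1`. -/

/-- `e^{κ y² / 4} D_{-υ}(√κ y)` with `υ = ρ / lam1`. -/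
def ouBase (lam1 nu0 ρ y : ℝ) : ℝ :=
  Real.exp (kappaParam lam1 nu0 * y ^ 2 / 4) *
    parabolicDNeg (ρ / lam1) (√(kappaParam lam1 nu0) * y)

/-- Decreasing fundamental solution `φ⁻_ρ` of the Ornstein-Uhlenbeck diffusion. -/
def ouMinus (lam0 lam1 nu0 ρ x : ℝ) : ℝ := ouBase lam1 nu0 ρ (x - lam0 / lam1)

/-- Increasing fundamental solution `φ⁺_ρ` of the Ornstein-Uhlenbeck diffusion. -/
def ouPlus (lam0 lam1 nu0 ρ x : ℝ) : ℝ := ouBase lam1 nu0 ρ (-(x - lam0 / lam1))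

end

noncomputable section

open MeasureTheory

/-! ### Monotonic limits -/

/-! Up to positive factors and an affine change of variable, every fundamental solution solves `α
f'' + β f' = r f`. The equations are `x f'' + (μ+1) f' = c f` with `c = 2ρ/ν₀²` (SQB), `x f'' +
(b-x) f' = a f` with `b = μ+1`, `a = ρ/λ₁` (CIR), and `f'' - x f' = r f` with `r = ρ/λ₁` (OU). The
decreasing solution is the Laplace transform of an explicit positive weight `w`, so that its
derivatives are, up to sign, the moments `M_k` (`expMoment w k`). The increasing solution `g` is an
entire series with positive coefficients for SQB and CIR, and the reflected decreasing solution for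
OU.

Like pairs. The derivative of `W[f, g]` is `f g'' - g f''`. When the parameter grows, the quotient
of the two weights is nondecreasing in `t`, and the quotient of the two coefficient sequences is
increasing in `n`. Chebyshev's inequality, proved by symmetrising a double integral or a double sum,
then gives the sign of `W` from first moments and the sign of `W'` from second moments
(`LaplaceWeight.chebyshev`, `EntireSeries.chebyshev`). If `p' = (β/α) p`, then `(p W)' = p (s - r) f
g / α`. For Laplace pairs this makes the sign strict and forces `W` to blow up where `p → 0`. For
series, the contribution of a single pair of indices already gives strict positivity and linear
growth.

Mixed pairs. `W[φ⁺, φ⁻]` is minus a sum of two positive products, hence negative. Near `0`, for SQB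
and CIR, it is compared with a Wronskian of two solutions of the same equation, for which Abel's
identity makes `p W` constant. At infinity, for CIR and OU, the exponential growth of `φ⁺` beats
`φ⁻`, which is bounded below by a multiple of `e^{-Tx}` for every `T > 0`. For SQB no such
exponential growth is available. If `r₁ ≤ r₂`, monotonicity of `p W` with `p = x^{μ+1}` forces
decay. If `r₁ > r₂`, both logarithmic derivatives tend to `0`, which gives `x W' ≤ W` eventually and
hence at least linear divergence to `-∞`. -/

lemma real_sign_pos_mul {K : ℝ} (hK : 0 < K) (y : ℝ) : Real.sign (K * y) = Real.sign y := by
  rcases lt_trichotomy y 0 with h | h | h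
  · rw [Real.sign_of_neg h, Real.sign_of_neg (mul_neg_of_pos_of_neg hK h)]
  · simp [h]
  · rw [Real.sign_of_pos h, Real.sign_of_pos (mul_pos hK h)]

lemma MonotonicLimit.neg {W : ℝ → ℝ} {l : Filter ℝ} {L : EReal} {σ : ℝ}
    (h : MonotonicLimit W l L σ) : MonotonicLimit (fun x => -W x) l (-L) (-σ) := by
  obtain ⟨h1, h2, S, hS, h3⟩ := h
  refine ⟨?_, ?_, S, hS, ?_⟩
  · simpa using h1.neg
  · filter_upwards [h2] with x hx
    rw [Real.sign_neg, hx]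
  · rcases h3 with h3 | h3
    · exact Or.inr h3.neg
    · exact Or.inl h3.neg

lemma monotonicLimit_zero {W : ℝ → ℝ} (l : Filter ℝ) (h : ∀ x, W x = 0) :
    MonotonicLimit W l 0 0 := by
  obtain rfl : W = fun _ => 0 := funext h
  refine ⟨by simpa using tendsto_const_nhds, by simp, univ, univ_mem, ?_⟩
  exact Or.inl monotoneOn_const

/-- Monotonic limits under a monotone change of variable and multiplication by a positive
constant. -/
lemma MonotonicLimit.comp_scale {W W' A : ℝ → ℝ} {l l' : Filter ℝ} {L : EReal} {σ K : ℝ}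
    (h : MonotonicLimit W l' L σ) (hK : 0 < K) (hA : Monotone A ∨ Antitone A)
    (hl : Tendsto A l l') (hW : ∀ᶠ x in l, W' x = K * W (A x)) :
    MonotonicLimit W' l (K * L) σ := by
  obtain ⟨h1, h2, S, hS, h3⟩ := h
  refine ⟨?_, ?_, A ⁻¹' S ∩ {x | W' x = K * W (A x)}, inter_mem (hl hS) hW, ?_⟩
  · have hK' : (K : EReal) ≠ 0 := by exact_mod_cast hK.ne'
    have hc : ContinuousAt (fun p : EReal × EReal => p.1 * p.2) ((K : EReal), L) :=
      EReal.continuousAt_mul (Or.inl hK') (Or.inl hK') (Or.inl (EReal.coe_ne_bot _))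
        (Or.inl (EReal.coe_ne_top _))
    have h4 := hc.tendsto.comp ((tendsto_const_nhds (x := (K : EReal))).prodMk_nhds (h1.comp hl))
    refine h4.congr' ?_
    filter_upwards [hW] with x hx
    simp [hx]
  · filter_upwards [hW, hl.eventually h2] with x hx hx2
    rw [hx, real_sign_pos_mul hK, hx2]
  · have key : MonotoneOn W' (A ⁻¹' S ∩ {x | W' x = K * W (A x)}) ∨
        AntitoneOn W' (A ⁻¹' S ∩ {x | W' x = K * W (A x)}) := by
      rcases hA with hA | hA <;> rcases h3 with h3 | h3
      · refine Or.inl fun x hx y hy hxy => ?_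
        rw [hx.2, hy.2]
        exact mul_le_mul_of_nonneg_left (h3 hx.1 hy.1 (hA hxy)) hK.le
      · refine Or.inr fun x hx y hy hxy => ?_
        rw [hx.2, hy.2]
        exact mul_le_mul_of_nonneg_left (h3 hx.1 hy.1 (hA hxy)) hK.le
      · refine Or.inr fun x hx y hy hxy => ?_
        rw [hx.2, hy.2]
        exact mul_le_mul_of_nonneg_left (h3 hy.1 hx.1 (hA hxy)) hK.le
      · refine Or.inl fun x hx y hy hxy => ?_
        rw [hx.2, hy.2]
        exact mul_le_mul_of_nonneg_left (h3 hy.1 hx.1 (hA hxy)) hK.le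
    exact key

/-- An antisymmetric family of functions: monotonic limits for `a < b` give those for all pairs. -/
lemma MonotonicLimit.sign_pair {W : ℝ → ℝ → ℝ → ℝ} {l : Filter ℝ} {L : EReal}
    (hanti : ∀ a b x, W b a x = -W a b x)
    (h : ∀ a b, 0 < a → a < b → MonotonicLimit (W a b) l L 1) {a b : ℝ} (ha : 0 < a)
    (hb : 0 < b) : MonotonicLimit (W a b) l ((Real.sign (b - a) : EReal) * L)
      (Real.sign (b - a)) := by
  rcases lt_trichotomy a b with hab | rfl | hab
  · rw [Real.sign_of_pos (sub_pos.2 hab)]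
    simpa using h a b ha hab
  -- For equal parameters antisymmetry makes `W` vanish; the limit is `0 * L`, which is `0` in
  -- `EReal` even for infinite `L`, matching the convention `0·∞ = 0`.
  · simpa using monotonicLimit_zero (W := W a a) l fun x => by have := hanti a a x; linarith
  · rw [Real.sign_of_neg (sub_neg.2 hab)]
    have h1 := (h b a hb hab).neg
    rw [← funext (hanti b a)] at h1
    simpa using h1

lemma MonotonicLimit.exists_sign_pair {W : ℝ → ℝ → ℝ → ℝ} {l : Filter ℝ}
    (hanti : ∀ a b x, W b a x = -W a b x)
    (h : ∀ a b, 0 < a → a < b → ∃ C : ℝ, 0 < C ∧ MonotonicLimit (W a b) l (C : EReal) 1)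
    {a b : ℝ} (ha : 0 < a) (hb : 0 < b) :
    ∃ C : ℝ, 0 < C ∧ MonotonicLimit (W a b) l ((Real.sign (b - a) * C : ℝ) : EReal)
      (Real.sign (b - a)) := by
  rcases lt_trichotomy a b with hab | rfl | hab
  · rw [Real.sign_of_pos (sub_pos.2 hab)]
    simpa using h a b ha hab
  -- The sign factor is `0` here, so any positive constant serves.
  · exact ⟨1, one_pos, by
      simpa using monotonicLimit_zero (W := W a a) l fun x => by have := hanti a a x; linarith⟩
  · rw [Real.sign_of_neg (sub_neg.2 hab)]
    obtain ⟨C, hC, h1⟩ := h b a hb hab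
    refine ⟨C, hC, ?_⟩
    have h1 := h1.neg
    rw [← funext (hanti b a)] at h1
    simpa using h1

lemma wronskianFn_swap (f g : ℝ → ℝ) (x : ℝ) : wronskianFn g f x = -wronskianFn f g x := by
  unfold wronskianFn; ring

/-! ### Second order linear equations and their Wronskians -/

/-- `f` solves `α f'' + β f' = r f` on `D`, with the given first and second derivatives. -/
structure SolvesOn (D : Set ℝ) (α β : ℝ → ℝ) (r : ℝ) (f f' f'' : ℝ → ℝ) : Prop where
  deriv_one : ∀ x ∈ D, HasDerivAt f (f' x) x
  deriv_two : ∀ x ∈ D, HasDerivAt f' (f'' x) x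
  ode : ∀ x ∈ D, α x * f'' x + β x * f' x = r * f x

section Solves

variable {D : Set ℝ} {α β p : ℝ → ℝ} {r s : ℝ} {f f' f'' g g' g'' : ℝ → ℝ}

lemma SolvesOn.wronskian_eq (hf : SolvesOn D α β r f f' f'') (hg : SolvesOn D α β s g g' g'')
    {x : ℝ} (hx : x ∈ D) : wronskianFn f g x = f x * g' x - g x * f' x := by
  rw [wronskianFn, (hf.deriv_one x hx).deriv, (hg.deriv_one x hx).deriv]

lemma SolvesOn.wronskian_hasDerivAt (hD : IsOpen D) (hf : SolvesOn D α β r f f' f'')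
    (hg : SolvesOn D α β s g g' g'') {x : ℝ} (hx : x ∈ D) :
    HasDerivAt (wronskianFn f g) (f x * g'' x - g x * f'' x) x := by
  have h := ((hf.deriv_one x hx).mul (hg.deriv_two x hx)).sub
    ((hg.deriv_one x hx).mul (hf.deriv_two x hx))
  refine (h.congr_of_eventuallyEq (f₁ := wronskianFn f g) ?_).congr_deriv (by ring)
  filter_upwards [hD.mem_nhds hx] with y hy
  simpa using hf.wronskian_eq hg hy

/-- The equation satisfied by the Wronskian, undivided. -/
lemma SolvesOn.mul_wronskian_deriv (hf : SolvesOn D α β r f f' f'')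
    (hg : SolvesOn D α β s g g' g'') {x : ℝ} (hx : x ∈ D) :
    α x * (f x * g'' x - g x * f'' x) = (s - r) * (f x * g x) - β x * wronskianFn f g x := by
  rw [hf.wronskian_eq hg hx]
  linear_combination f x * hg.ode x hx - g x * hf.ode x hx

/-- Lagrange's identity: the factor `p` absorbs the first-order term, leaving only the difference of
the two parameters times the product of the solutions. -/
lemma SolvesOn.weighted_wronskian_hasDerivAt (hD : IsOpen D) (hf : SolvesOn D α β r f f' f'')
    (hg : SolvesOn D α β s g g' g'') (hα : ∀ x ∈ D, 0 < α x)
    (hp : ∀ x ∈ D, HasDerivAt p (β x / α x * p x) x) {x : ℝ} (hx : x ∈ D) :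
    HasDerivAt (fun x => p x * wronskianFn f g x) (p x * ((s - r) * (f x * g x) / α x)) x := by
  refine ((hp x hx).mul (hf.wronskian_hasDerivAt hD hg hx)).congr_deriv ?_
  have h := hf.mul_wronskian_deriv hg hx
  have hα' := (hα x hx).ne'
  field_simp
  linear_combination p x * h

/-- The case `r = s` is admitted on purpose: it provides the half of Abel's identity used for mixed
Wronskians near `0`. -/
lemma SolvesOn.monotoneOn_weighted_wronskian (hD : IsOpen D) (hDc : Convex ℝ D)
    (hf : SolvesOn D α β r f f' f'')
    (hg : SolvesOn D α β s g g' g'') (hα : ∀ x ∈ D, 0 < α x) (hp0 : ∀ x ∈ D, 0 < p x)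
    (hp : ∀ x ∈ D, HasDerivAt p (β x / α x * p x) x) (hf0 : ∀ x ∈ D, 0 < f x)
    (hg0 : ∀ x ∈ D, 0 < g x) (hrs : r ≤ s) :
    MonotoneOn (fun x => p x * wronskianFn f g x) D := by
  have hd := fun x hx => hf.weighted_wronskian_hasDerivAt hD hg hα hp (x := x) hx
  refine monotoneOn_of_deriv_nonneg hDc (fun x hx => (hd x hx).continuousAt.continuousWithinAt)
    (fun x hx => (hd x (interior_subset hx)).differentiableAt.differentiableWithinAt)
    fun x hx => ?_
  have hx := interior_subset hx
  rw [(hd x hx).deriv]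
  have := hα x hx
  have := hf0 x hx
  have := hg0 x hx
  have := hp0 x hx
  have := sub_nonneg.2 hrs
  positivity

lemma SolvesOn.strictAntiOn_weighted_wronskian (hD : IsOpen D) (hDc : Convex ℝ D)
    (hf : SolvesOn D α β r f f' f'')
    (hg : SolvesOn D α β s g g' g'') (hα : ∀ x ∈ D, 0 < α x) (hp0 : ∀ x ∈ D, 0 < p x)
    (hp : ∀ x ∈ D, HasDerivAt p (β x / α x * p x) x) (hf0 : ∀ x ∈ D, 0 < f x)
    (hg0 : ∀ x ∈ D, 0 < g x) (hrs : s < r) :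
    StrictAntiOn (fun x => p x * wronskianFn f g x) D := by
  have hd := fun x hx => hf.weighted_wronskian_hasDerivAt hD hg hα hp (x := x) hx
  refine strictAntiOn_of_deriv_neg hDc (fun x hx => (hd x hx).continuousAt.continuousWithinAt)
    fun x hx => ?_
  have hx := interior_subset hx
  rw [(hd x hx).deriv]
  have h1 := hα x hx
  have h2 := hf0 x hx
  have h3 := hg0 x hx
  refine mul_neg_of_pos_of_neg (hp0 x hx) (div_neg_of_neg_of_pos ?_ h1)
  exact mul_neg_of_neg_of_pos (sub_neg.2 hrs) (by positivity)

lemma antitoneOn_of_hasDerivAt_nonpos {W W' : ℝ → ℝ} {S : Set ℝ} (hS : Convex ℝ S)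
    (h : ∀ x ∈ S, HasDerivAt W (W' x) x) (h0 : ∀ x ∈ S, W' x ≤ 0) : AntitoneOn W S :=
  antitoneOn_of_deriv_nonpos hS (fun x hx => (h x hx).continuousAt.continuousWithinAt)
    (fun x hx => (h x (interior_subset hx)).differentiableAt.differentiableWithinAt)
    fun x hx => by rw [(h x (interior_subset hx)).deriv]; exact h0 x (interior_subset hx)

lemma monotoneOn_of_hasDerivAt_nonneg {W W' : ℝ → ℝ} {S : Set ℝ} (hS : Convex ℝ S)
    (h : ∀ x ∈ S, HasDerivAt W (W' x) x) (h0 : ∀ x ∈ S, 0 ≤ W' x) : MonotoneOn W S :=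
  monotoneOn_of_deriv_nonneg hS (fun x hx => (h x hx).continuousAt.continuousWithinAt)
    (fun x hx => (h x (interior_subset hx)).differentiableAt.differentiableWithinAt)
    fun x hx => by rw [(h x (interior_subset hx)).deriv]; exact h0 x (interior_subset hx)

/-- Wronskian of affinely rescaled functions. -/
lemma wronskianFn_rescale {φ ψ F G : ℝ → ℝ} {K L a b x F' G' : ℝ}
    (hφ : φ =ᶠ[𝓝 x] fun y => K * F (a * y + b)) (hψ : ψ =ᶠ[𝓝 x] fun y => L * G (a * y + b))
    (hF : HasDerivAt F F' (a * x + b)) (hG : HasDerivAt G G' (a * x + b)) :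
    wronskianFn φ ψ x = K * L * a * wronskianFn F G (a * x + b) := by
  have hA : HasDerivAt (fun y => a * y + b) a x := by
    simpa using ((hasDerivAt_id x).const_mul a).add_const b
  have h1 := ((hF.comp x hA).const_mul K).congr_of_eventuallyEq hφ
  have h2 := ((hG.comp x hA).const_mul L).congr_of_eventuallyEq hψ
  rw [wronskianFn, wronskianFn, h1.deriv, h2.deriv, hF.deriv, hG.deriv, hφ.eq_of_nhds,
    hψ.eq_of_nhds]
  ring

end Solves

/-! ### Laplace transforms of positive weights -/

/-- The `k`-th moment `∫ t^k e^{-xt} w(t) dt` over `(0, ∞)`. -/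
def expMoment (w : ℝ → ℝ) (k : ℕ) (x : ℝ) : ℝ :=
  ∫ t in Ioi (0 : ℝ), Real.exp (-x * t) * (t ^ k * w t)

/-- A positive weight on `(0, ∞)` whose Laplace transform converges on the open right ray `D`. -/
structure LaplaceWeight (D : Set ℝ) (w : ℝ → ℝ) : Prop where
  isOpen : IsOpen D
  isUpperSet : IsUpperSet D
  pos : ∀ t, 0 < t → 0 < w t
  integrableOn : ∀ x ∈ D, IntegrableOn (fun t => Real.exp (-x * t) * w t) (Ioi 0)

lemma IsUpperSet.convex_real {D : Set ℝ} (h : IsUpperSet D) : Convex ℝ D :=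
  h.ordConnected.convex

/-- Fubini for one half of the symmetrised Chebyshev integrand; integrability is returned as well so
that two halves can be added. -/
lemma integral_prod_det {μ : Measure ℝ} [SFinite μ] {f g f' g' : ℝ → ℝ} (hf : Integrable f μ)
    (hg : Integrable g μ) (hf' : Integrable f' μ) (hg' : Integrable g' μ) :
    Integrable (fun z : ℝ × ℝ => f z.1 * g z.2 - f' z.1 * g' z.2) (μ.prod μ) ∧
      ∫ z : ℝ × ℝ, (f z.1 * g z.2 - f' z.1 * g' z.2) ∂(μ.prod μ) =
        (∫ x, f x ∂μ) * (∫ x, g x ∂μ) - (∫ x, f' x ∂μ) * ∫ x, g' x ∂μ := by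
  refine ⟨(hf.mul_prod hg).sub (hf'.mul_prod hg'), ?_⟩
  rw [integral_sub (hf.mul_prod hg) (hf'.mul_prod hg'), integral_prod_mul, integral_prod_mul]

namespace LaplaceWeight

variable {D : Set ℝ} {w w₁ w₂ : ℝ → ℝ}

lemma exists_sub_mem (h : LaplaceWeight D w) {x : ℝ} (hx : x ∈ D) : ∃ δ > 0, x - δ ∈ D := by
  obtain ⟨ε, hε, h1⟩ := Metric.isOpen_iff.1 h.isOpen x hx
  refine ⟨ε / 2, by positivity, h1 ?_⟩
  rw [Metric.mem_ball, Real.dist_eq]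
  simp only [sub_sub_cancel_left, abs_neg]
  rw [abs_of_pos (by positivity)]
  linarith

lemma pow_le_exp {δ t : ℝ} (hδ : 0 < δ) (ht : 0 ≤ t) (k : ℕ) :
    t ^ k ≤ k.factorial / δ ^ k * Real.exp (δ * t) := by
  have h := Real.pow_div_factorial_le_exp (δ * t) (by positivity) k
  have hk : (0 : ℝ) < k.factorial := by positivity
  rw [div_le_iff₀ hk, mul_pow] at h
  rw [div_mul_eq_mul_div, le_div_iff₀ (by positivity)]
  linarith

/-- Openness of `D` leaves room to move to `x - δ`, and the spare factor `e^{-δt}` absorbs `t^k`. -/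
lemma integrable_moment (h : LaplaceWeight D w) (k : ℕ) {x : ℝ} (hx : x ∈ D) :
    IntegrableOn (fun t => Real.exp (-x * t) * (t ^ k * w t)) (Ioi 0) := by
  obtain ⟨δ, hδ, hxδ⟩ := h.exists_sub_mem hx
  have h1 := h.integrableOn _ hxδ
  have hm : AEStronglyMeasurable (fun t => Real.exp (-x * t) * (t ^ k * w t))
      (volume.restrict (Ioi 0)) := by
    have h2 : AEStronglyMeasurable (fun t : ℝ => Real.exp (-δ * t) * t ^ k)
      (volume.restrict (Ioi 0)) := by fun_prop
    refine (h2.mul h1.aestronglyMeasurable).congr (ae_of_all _ fun t => ?_)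
    have : Real.exp (-x * t) = Real.exp (-δ * t) * Real.exp (-(x - δ) * t) := by
      rw [← Real.exp_add]; ring_nf
    simp only [Pi.mul_apply, this]
    ring
  refine (h1.const_mul (k.factorial / δ ^ k)).mono' hm ?_
  refine (ae_restrict_iff' measurableSet_Ioi).2 (ae_of_all _ fun t ht => ?_)
  have ht : 0 < t := ht
  have hw := h.pos t ht
  rw [Real.norm_of_nonneg (by positivity)]
  calc Real.exp (-x * t) * (t ^ k * w t)
      ≤ Real.exp (-x * t) * ((k.factorial / δ ^ k * Real.exp (δ * t)) * w t) := by
        gcongr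
        exact pow_le_exp hδ ht.le k
    _ = k.factorial / δ ^ k * (Real.exp (-(x - δ) * t) * w t) := by
        have : Real.exp (-(x - δ) * t) = Real.exp (-x * t) * Real.exp (δ * t) := by
          rw [← Real.exp_add]; ring_nf
        rw [this]; ring

lemma expMoment_pos (h : LaplaceWeight D w) (k : ℕ) {x : ℝ} (hx : x ∈ D) :
    0 < expMoment w k x := by
  rw [expMoment, setIntegral_pos_iff_support_of_nonneg_ae _ (h.integrable_moment k hx)]
  · refine lt_of_lt_of_le ?_ (measure_mono (s := Ioi 0) fun t ht => ⟨?_, ht⟩)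
    · simp
    · have ht : 0 < t := ht
      have hw := h.pos t ht
      rw [Function.mem_support]
      positivity
  · refine (ae_restrict_iff' measurableSet_Ioi).2 (ae_of_all _ fun t ht => ?_)
    have ht : 0 < t := ht
    have hw := h.pos t ht
    simp only [Pi.zero_apply]
    positivity

lemma hasDerivAt_expMoment (h : LaplaceWeight D w) (k : ℕ) {x : ℝ} (hx : x ∈ D) :
    HasDerivAt (expMoment w k) (-expMoment w (k + 1) x) x := by
  obtain ⟨δ, hδ, hxδ⟩ := h.exists_sub_mem hx
  have hmem : ∀ y, x - δ < y → y ∈ D := fun y hy => h.isUpperSet hy.le hxδ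
  have key := hasDerivAt_integral_of_dominated_loc_of_deriv_le
    (μ := volume.restrict (Ioi 0)) (F := fun y t => Real.exp (-y * t) * (t ^ k * w t))
    (F' := fun y t => -(Real.exp (-y * t) * (t ^ (k + 1) * w t))) (x₀ := x)
    (s := Ioi (x - δ)) (bound := fun t => Real.exp (-(x - δ) * t) * (t ^ (k + 1) * w t))
    (Ioi_mem_nhds (by linarith)) ?_ (h.integrable_moment k hx)
    (h.integrable_moment (k + 1) hx).aestronglyMeasurable.neg ?_
    (h.integrable_moment (k + 1) hxδ) ?_
  · refine key.2.congr_deriv ?_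
    rw [integral_neg]; rfl
  · filter_upwards [Ioi_mem_nhds (show x - δ < x by linarith)] with y hy
    exact (h.integrable_moment k (hmem y hy)).aestronglyMeasurable
  · refine (ae_restrict_iff' measurableSet_Ioi).2 (ae_of_all _ fun t ht y hy => ?_)
    have ht : 0 < t := ht
    have hy : x - δ < y := hy
    have hw := h.pos t ht
    rw [norm_neg, Real.norm_of_nonneg (by positivity)]
    gcongr
  · refine ae_of_all _ fun t y _ => ?_
    have h1 : HasDerivAt (fun y : ℝ => Real.exp (-y * t)) (Real.exp (-y * t) * (-1 * t)) y :=
      (((hasDerivAt_id y).neg).mul_const t).exp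
    refine (h1.mul_const (t ^ k * w t)).congr_deriv ?_
    ring

lemma tendsto_expMoment (h : LaplaceWeight D w) (hD : D.Nonempty) (k : ℕ) :
    Tendsto (expMoment w k) atTop (𝓝 0) := by
  obtain ⟨x₀, hx₀⟩ := hD
  have key := tendsto_integral_filter_of_dominated_convergence
    (μ := volume.restrict (Ioi 0)) (l := (atTop : Filter ℝ))
    (F := fun y t => Real.exp (-y * t) * (t ^ k * w t)) (f := fun _ => (0 : ℝ))
    (fun t => Real.exp (-x₀ * t) * (t ^ k * w t)) ?_ ?_ (h.integrable_moment k hx₀) ?_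
  · rwa [integral_zero] at key
  · filter_upwards [eventually_ge_atTop x₀] with y hy
    exact (h.integrable_moment k (h.isUpperSet hy hx₀)).aestronglyMeasurable
  · filter_upwards [eventually_ge_atTop x₀] with y hy
    refine (ae_restrict_iff' measurableSet_Ioi).2 (ae_of_all _ fun t ht => ?_)
    have ht : 0 < t := ht
    have hw := h.pos t ht
    rw [Real.norm_of_nonneg (by positivity)]
    gcongr
  · refine (ae_restrict_iff' measurableSet_Ioi).2 (ae_of_all _ fun t ht => ?_)
    have ht : 0 < t := ht
    have h1 : Tendsto (fun y : ℝ => Real.exp (-y * t)) atTop (𝓝 0) := by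
      refine Real.tendsto_exp_atBot.comp ?_
      simp only [neg_mul]
      exact tendsto_neg_atTop_atBot.comp (tendsto_id.atTop_mul_const ht)
    simpa using h1.mul_const (t ^ k * w t)

/-- A Laplace transform decays slower than any exponential. -/
lemma exists_exp_le_expMoment (h : LaplaceWeight D w) {x₀ T : ℝ} (hx₀ : x₀ ∈ D) (hT : 0 < T) :
    ∃ c > 0, ∀ x, x₀ ≤ x → c * Real.exp (-T * x) ≤ expMoment w 0 x := by
  have hi := h.integrable_moment 0 hx₀
  have hsub : Ioc 0 T ⊆ Ioi (0 : ℝ) := Ioc_subset_Ioi_self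
  have hpos : 0 < ∫ t in Ioc 0 T, Real.exp (-x₀ * t) * (t ^ 0 * w t) := by
    rw [setIntegral_pos_iff_support_of_nonneg_ae _ (hi.mono_set hsub)]
    · refine lt_of_lt_of_le ?_ (measure_mono (s := Ioc 0 T) fun t ht => ⟨?_, ht⟩)
      · simpa using hT
      · have hw := h.pos t ht.1
        rw [Function.mem_support]
        positivity
    · refine (ae_restrict_iff' measurableSet_Ioc).2 (ae_of_all _ fun t ht => ?_)
      have hw := h.pos t ht.1
      simp only [Pi.zero_apply]
      positivity
  -- Only the mass on `(0, T]` is kept: there `e^{-(x-x₀)t} ≥ e^{-T(x-x₀)}`, and the factor `e^{T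
  -- x₀}` removes the shift.
  refine ⟨(∫ t in Ioc 0 T, Real.exp (-x₀ * t) * (t ^ 0 * w t)) * Real.exp (T * x₀),
    by positivity, fun x hx => ?_⟩
  have hix := h.integrable_moment 0 (h.isUpperSet hx hx₀)
  calc (∫ t in Ioc 0 T, Real.exp (-x₀ * t) * (t ^ 0 * w t)) * Real.exp (T * x₀)
        * Real.exp (-T * x)
      = ∫ t in Ioc 0 T, Real.exp (-x₀ * t) * (t ^ 0 * w t) * Real.exp (-T * (x - x₀)) := by
        rw [integral_mul_const, mul_assoc, ← Real.exp_add]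
        ring_nf
    _ ≤ ∫ t in Ioc 0 T, Real.exp (-x * t) * (t ^ 0 * w t) := by
        refine setIntegral_mono_on ((hi.mono_set hsub).mul_const _) (hix.mono_set hsub)
          measurableSet_Ioc fun t ht => ?_
        have hw := h.pos t ht.1
        have : Real.exp (-x₀ * t) * Real.exp (-T * (x - x₀)) ≤ Real.exp (-x * t) := by
          rw [← Real.exp_add, Real.exp_le_exp]
          nlinarith [ht.2]
        calc _ = Real.exp (-x₀ * t) * Real.exp (-T * (x - x₀)) * (t ^ 0 * w t) := by ring
          _ ≤ _ := by gcongr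
    _ ≤ expMoment w 0 x := by
        refine setIntegral_mono_set hix ?_ hsub.eventuallyLE
        refine (ae_restrict_iff' measurableSet_Ioi).2 (ae_of_all _ fun t ht => ?_)
        have hw := h.pos t ht
        simp only [Pi.zero_apply]
        positivity

/-- The mean of a Laplace transform decreases. -/
lemma expMoment_one_ge (h : LaplaceWeight D w) {x x₀ m : ℝ} (hx : x ∈ D) (hxx : x ≤ x₀)
    (hm : m * expMoment w 0 x₀ ≤ expMoment w 1 x₀) :
    m * expMoment w 0 x ≤ expMoment w 1 x := by
  have hx₀ := h.isUpperSet hxx hx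
  have e : ∀ y, y ∈ D → expMoment w 1 y - m * expMoment w 0 y =
      ∫ t in Ioi (0 : ℝ), Real.exp (-y * t) * ((t - m) * w t) := fun y hy => by
    rw [expMoment, expMoment, ← integral_const_mul, ← integral_sub (h.integrable_moment 1 hy)
      ((h.integrable_moment 0 hy).const_mul m)]
    congr 1; ext t; ring
  have hint : ∀ y, y ∈ D → IntegrableOn (fun t => Real.exp (-y * t) * ((t - m) * w t)) (Ioi 0) :=
    fun y hy => by
      refine ((h.integrable_moment 1 hy).sub ((h.integrable_moment 0 hy).const_mul m)).congr
        (ae_of_all _ fun t => ?_)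
      simp only [Pi.sub_apply]; ring
  have h0 := e x₀ hx₀
  have h1 := e x hx
  have h2 : Real.exp ((x₀ - x) * m) *
      (∫ t in Ioi (0 : ℝ), Real.exp (-x₀ * t) * ((t - m) * w t)) ≤
      ∫ t in Ioi (0 : ℝ), Real.exp (-x * t) * ((t - m) * w t) := by
    rw [← integral_const_mul]
    refine setIntegral_mono_on ((hint _ hx₀).const_mul _) (hint _ hx) measurableSet_Ioi
      fun t ht => ?_
    have hw := h.pos t ht
    have e1 : Real.exp (-x * t) = Real.exp (-x₀ * t) * Real.exp ((x₀ - x) * t) := by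
      rw [← Real.exp_add]; ring_nf
    rw [e1]
    -- Exponential tilting: replacing `e^{(x₀-x)t}` by its value at `t = m` can only lower the
    -- product, since `t - m` changes sign exactly there.
    have : Real.exp ((x₀ - x) * m) * (t - m) ≤ Real.exp ((x₀ - x) * t) * (t - m) := by
      rcases le_total m t with htm | htm
      · refine mul_le_mul_of_nonneg_right ?_ (sub_nonneg.2 htm)
        exact Real.exp_le_exp.2 (mul_le_mul_of_nonneg_left htm (sub_nonneg.2 hxx))
      · refine mul_le_mul_of_nonpos_right ?_ (sub_nonpos.2 htm)
        exact Real.exp_le_exp.2 (mul_le_mul_of_nonneg_left htm (sub_nonneg.2 hxx))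
    calc _ = Real.exp (-x₀ * t) * w t * (Real.exp ((x₀ - x) * m) * (t - m)) := by ring
      _ ≤ Real.exp (-x₀ * t) * w t * (Real.exp ((x₀ - x) * t) * (t - m)) := by gcongr
      _ = _ := by ring
  have h3 : 0 ≤ ∫ t in Ioi (0 : ℝ), Real.exp (-x₀ * t) * ((t - m) * w t) := by
    rw [← h0]; linarith
  have h4 := mul_nonneg (Real.exp_pos ((x₀ - x) * m)).le h3
  linarith

/-- Nonnegativity of `∫ (t - m)² e^{-xt} w(t) dt`. -/
lemma expMoment_two_ge (h : LaplaceWeight D w) {x : ℝ} (hx : x ∈ D) (m : ℝ) :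
    2 * m * expMoment w 1 x - m ^ 2 * expMoment w 0 x ≤ expMoment w 2 x := by
  have h0 := (h.integrable_moment 0 hx).const_mul (m ^ 2)
  have h1 := (h.integrable_moment 1 hx).const_mul (2 * m)
  rw [expMoment, expMoment, ← integral_const_mul, ← integral_const_mul, ← integral_sub h1 h0]
  refine setIntegral_mono_on (h1.sub h0) (h.integrable_moment 2 hx) measurableSet_Ioi
    fun t ht => ?_
  have hw := h.pos t ht
  have : 0 ≤ Real.exp (-x * t) * ((t - m) ^ 2 * w t) := by positivity
  linarith

/-- Chebyshev's inequality for two weights with monotone ratio. -/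
lemma chebyshev (h₁ : LaplaceWeight D w₁) (h₂ : LaplaceWeight D w₂)
    (hR : ∀ s t, 0 < s → s < t → w₂ s * w₁ t ≤ w₁ s * w₂ t) (k : ℕ) {x : ℝ} (hx : x ∈ D) :
    0 ≤ expMoment w₁ 0 x * expMoment w₂ k x - expMoment w₂ 0 x * expMoment w₁ k x := by
  set μ := volume.restrict (Ioi (0 : ℝ))
  have a := h₁.integrable_moment 0 hx
  have b := h₂.integrable_moment k hx
  have c := h₂.integrable_moment 0 hx
  have d := h₁.integrable_moment k hx
  -- The integrand is `e^{-xs} e^{-xt} (t^k - s^k)(w₁(s) w₂(t) - w₂(s) w₁(t))` with `(s, t) = z`.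
  -- Both brackets have the sign of `t - s`, or vanish, and the integral is twice the desired
  -- difference.
  have key : 0 ≤ ∫ z : ℝ × ℝ,
      ((Real.exp (-x * z.1) * (z.1 ^ 0 * w₁ z.1)) * (Real.exp (-x * z.2) * (z.2 ^ k * w₂ z.2))
      - (Real.exp (-x * z.1) * (z.1 ^ 0 * w₂ z.1)) * (Real.exp (-x * z.2) * (z.2 ^ k * w₁ z.2)))
      + ((Real.exp (-x * z.1) * (z.1 ^ k * w₂ z.1)) * (Real.exp (-x * z.2) * (z.2 ^ 0 * w₁ z.2))
      - (Real.exp (-x * z.1) * (z.1 ^ k * w₁ z.1)) * (Real.exp (-x * z.2) * (z.2 ^ 0 * w₂ z.2)))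
      ∂(μ.prod μ) := by
    refine integral_nonneg_of_ae ?_
    have hae : ∀ᵐ z ∂(μ.prod μ), z ∈ (Ioi (0 : ℝ)) ×ˢ (Ioi (0 : ℝ)) := by
      rw [Measure.prod_restrict]
      exact ae_restrict_mem (measurableSet_Ioi.prod measurableSet_Ioi)
    filter_upwards [hae] with z hz
    obtain ⟨hs, ht⟩ := hz
    have hs : 0 < z.1 := hs
    have ht : 0 < z.2 := ht
    have e : 0 ≤ (z.2 ^ k - z.1 ^ k) * (w₁ z.1 * w₂ z.2 - w₂ z.1 * w₁ z.2) := by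
      rcases lt_trichotomy z.1 z.2 with hlt | heq | hlt
      · refine mul_nonneg ?_ (sub_nonneg.2 (hR _ _ hs hlt))
        exact sub_nonneg.2 (pow_le_pow_left₀ hs.le hlt.le k)
      · rw [heq]; simp
      · refine mul_nonneg_of_nonpos_of_nonpos ?_ ?_
        · exact sub_nonpos.2 (pow_le_pow_left₀ ht.le hlt.le k)
        · have := hR _ _ ht hlt
          linarith
    have e2 := mul_nonneg (mul_pos (Real.exp_pos (-x * z.1)) (Real.exp_pos (-x * z.2))).le e
    simp only [Pi.zero_apply]
    refine e2.trans (le_of_eq ?_)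
    ring
  have e1 := integral_prod_det a b c d
  have e2 := integral_prod_det b a d c
  rw [integral_add e1.1 e2.1, e1.2, e2.2] at key
  simp only [expMoment]
  linarith

end LaplaceWeight

/-! ### Entire power series with positive coefficients -/

/-- The sum of the power series with coefficients `c`. -/
def powSeries (c : ℕ → ℝ) (x : ℝ) : ℝ := ∑' n, c n * x ^ n

/-- The coefficients of the derivative of a power series. -/
def derivCoeff (c : ℕ → ℝ) (n : ℕ) : ℝ := (n + 1) * c (n + 1)

/-- Positive coefficients with `(n + 1) c (n + 1) = q n * c n`, where `q` is positive and bounded. -/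
structure EntireSeries (c q : ℕ → ℝ) (M : ℝ) : Prop where
  zero_pos : 0 < c 0
  ratio_pos : ∀ n, 0 < q n
  ratio_le : ∀ n, q n ≤ M
  ratio : ∀ n, derivCoeff c n = q n * c n

lemma HasSum.congr_terms {ι : Type*} {f g : ι → ℝ} {S : ℝ} (h : HasSum f S)
    (hfg : ∀ i, g i = f i) : HasSum g S :=
  (funext hfg : g = f) ▸ h

lemma hasSum_of_succ {F : ℕ → ℝ} {S : ℝ} (h0 : F 0 = 0) (h : HasSum (fun n => F (n + 1)) S) :
    HasSum F S := by
  have := (hasSum_nat_add_iff (f := F) (g := S) 1).1 h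
  simpa [h0] using this

/-- Chebyshev's inequality for sums, with the contribution of one pair of indices. -/
lemma chebyshev_hasSum {u v e : ℕ → ℝ} {U V U' V' : ℝ} (hu : HasSum u U) (hv : HasSum v V)
    (hu' : HasSum (fun n => e n * u n) U') (hv' : HasSum (fun n => e n * v n) V')
    (hH : ∀ i j, 0 ≤ (e j - e i) * (u i * v j - v i * u j)) {i j : ℕ} (hij : i ≠ j) :
    (e j - e i) * (u i * v j - v i * u j) ≤ U * V' - V * U' := by
  have mk : ∀ {f g : ℕ → ℝ} {A B : ℝ}, HasSum f A → HasSum g B →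
      HasSum (fun z : ℕ × ℕ => f z.1 * g z.2) (A * B) := fun {f g A B} hf hg =>
    hf.mul hg (summable_mul_of_summable_norm hf.summable.norm hg.summable.norm)
  have h : HasSum (fun z : ℕ × ℕ => (e z.2 - e z.1) * (u z.1 * v z.2 - v z.1 * u z.2))
      ((U * V' - V * U') + (V' * U - U' * V)) := by
    refine (((mk hu hv').sub (mk hv hu')).add ((mk hv' hu).sub (mk hu' hv))).congr_terms ?_
    intro z
    ring
  -- The two orderings of the pair contribute equally, which matches the factor `2` produced by
  -- symmetrisation.
  have h2 := sum_le_hasSum {(i, j), (j, i)} (fun z _ => hH z.1 z.2) h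
  rw [Finset.sum_pair (by simp [hij])] at h2
  linarith

namespace EntireSeries

variable {c q a b qa qb : ℕ → ℝ} {M Ma Mb : ℝ}

lemma pos (h : EntireSeries c q M) (n : ℕ) : 0 < c n := by
  induction n with
  | zero => exact h.zero_pos
  | succ n ih =>
    have h1 := h.ratio n
    have h2 := mul_pos (h.ratio_pos n) ih
    rw [← h1, derivCoeff] at h2
    exact pos_of_mul_pos_right h2 (by positivity)

/-- Iterating the bounded ratio compares the series with `c 0 * e^{Mx}`; this is why it is entire.
-/
lemma le_exp_coeff (h : EntireSeries c q M) (n : ℕ) : c n ≤ c 0 * (M ^ n / n.factorial) := by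
  have hM : 0 < M := (h.ratio_pos 0).trans_le (h.ratio_le 0)
  induction n with
  | zero => simp
  | succ n ih =>
    have h1 := h.ratio n
    rw [derivCoeff] at h1
    have h2 : (n + 1 : ℝ) * c (n + 1) ≤ M * (c 0 * (M ^ n / n.factorial)) := by
      rw [h1]
      exact mul_le_mul (h.ratio_le n) ih (h.pos n).le hM.le
    have h3 : c (n + 1) ≤ M * (c 0 * (M ^ n / n.factorial)) / (n + 1) := by
      rw [le_div_iff₀ (by positivity)]
      linarith
    refine h3.trans (le_of_eq ?_)
    rw [Nat.factorial_succ]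
    push_cast
    field_simp
    ring

lemma summable (h : EntireSeries c q M) (x : ℝ) : Summable fun n => c n * x ^ n := by
  refine Summable.of_norm_bounded
    (g := fun n => c 0 * ((M * |x|) ^ n / n.factorial)) ?_ fun n => ?_
  · exact (Real.summable_pow_div_factorial _).mul_left _
  · rw [norm_mul, norm_pow, Real.norm_of_nonneg (h.pos n).le, Real.norm_eq_abs, mul_pow,
      mul_div_right_comm, ← mul_assoc]
    exact mul_le_mul_of_nonneg_right (h.le_exp_coeff n) (by positivity)

lemma hasSum (h : EntireSeries c q M) (x : ℝ) : HasSum (fun n => c n * x ^ n) (powSeries c x) :=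
  (h.summable x).hasSum

/-- Differentiation merely shifts `q`, so every estimate for the series applies to its derivatives
as well. -/
lemma derivSeries (h : EntireSeries c q M) :
    EntireSeries (derivCoeff c) (fun n => q (n + 1)) M where
  zero_pos := by rw [h.ratio]; exact mul_pos (h.ratio_pos 0) h.zero_pos
  ratio_pos n := h.ratio_pos _
  ratio_le n := h.ratio_le _
  ratio n := by
    have h1 := h.ratio (n + 1)
    rw [derivCoeff, h1, derivCoeff]
    ring

lemma hasDerivAt (h : EntireSeries c q M) (x : ℝ) :
    HasDerivAt (powSeries c) (powSeries (derivCoeff c) x) x := by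
  set R := |x| + 1
  have hR : 0 < R := by positivity
  have hu : Summable fun n : ℕ => c n * (n * R ^ (n - 1)) := by
    rw [← summable_nat_add_iff 1]
    refine (h.derivSeries.summable R).congr fun n => ?_
    simp [derivCoeff]
    ring
  have key := hasDerivAt_tsum_of_isPreconnected (g := fun n y => c n * y ^ n)
    (g' := fun n y => c n * (n * y ^ (n - 1))) (t := Metric.ball 0 R) (y₀ := x) (y := x) hu
    Metric.isOpen_ball (convex_ball 0 R).isPreconnected
    (fun n y _ => (hasDerivAt_pow n y).const_mul (c n)) ?_ ?_ (h.summable x) ?_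
  · refine key.congr_deriv ?_
    have hs : Summable fun n : ℕ => c n * (n * x ^ (n - 1)) := by
      rw [← summable_nat_add_iff 1]
      refine (h.derivSeries.summable x).congr fun n => ?_
      simp [derivCoeff]
      ring
    rw [hs.tsum_eq_zero_add, powSeries]
    simp only [Nat.cast_zero, zero_mul, mul_zero, zero_add, derivCoeff]
    refine tsum_congr fun n => ?_
    simp
    ring
  · intro n y hy
    have hy' : |y| ≤ R := by
      have := Metric.mem_ball.1 hy
      rw [dist_zero_right, Real.norm_eq_abs] at this
      exact this.le
    rw [norm_mul, norm_mul, norm_pow, Real.norm_of_nonneg (h.pos n).le, Real.norm_natCast,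
      Real.norm_eq_abs]
    have := (h.pos n).le
    gcongr
  · simp [R]
  · simp [R]

lemma powSeries_zero (c : ℕ → ℝ) : powSeries c 0 = c 0 := by
  rw [powSeries, tsum_eq_single 0]
  · simp
  · intro n hn
    simp [hn]

/-- Weighting the terms by `n` represents `x f'`, and by `n(n-1)` represents `x² f''`. These are the
sequences `e` fed to Chebyshev's inequality, so Wronskians become sums over pairs of indices. -/
lemma hasSum_natCast_mul (h : EntireSeries c q M) (x : ℝ) :
    HasSum (fun n : ℕ => (n : ℝ) * (c n * x ^ n)) (x * powSeries (derivCoeff c) x) := by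
  refine hasSum_of_succ (by simp) (((h.derivSeries.hasSum x).mul_left x).congr_terms fun n => ?_)
  simp [derivCoeff]
  ring

lemma hasSum_natCast_mul_pred (h : EntireSeries c q M) (x : ℝ) :
    HasSum (fun n : ℕ => ((n : ℝ) * (n - 1)) * (c n * x ^ n))
      (x ^ 2 * powSeries (derivCoeff (derivCoeff c)) x) := by
  have h1 := (h.derivSeries.hasSum_natCast_mul x).mul_left x
  rw [← mul_assoc, ← sq] at h1
  refine hasSum_of_succ (by simp) (h1.congr_terms fun n => ?_)
  simp [derivCoeff]
  ring

lemma term_le (h : EntireSeries c q M) {x : ℝ} (hx : 0 ≤ x) (n : ℕ) :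
    c n * x ^ n ≤ powSeries c x :=
  le_hasSum (h.hasSum x) n fun m _ => mul_nonneg (h.pos m).le (by positivity)

lemma zero_le (h : EntireSeries c q M) {x : ℝ} (hx : 0 ≤ x) : c 0 ≤ powSeries c x := by
  simpa using h.term_le hx 0

lemma powSeries_pos (h : EntireSeries c q M) {x : ℝ} (hx : 0 ≤ x) : 0 < powSeries c x :=
  h.zero_pos.trans_le (h.zero_le hx)

lemma continuous (h : EntireSeries c q M) : Continuous (powSeries c) :=
  continuous_iff_continuousAt.2 fun x => (h.hasDerivAt x).continuousAt

lemma monotoneOn (h : EntireSeries c q M) : MonotoneOn (powSeries c) (Ici 0) :=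
  monotoneOn_of_hasDerivAt_nonneg (convex_Ici 0) (fun x _ => h.hasDerivAt x)
    fun _ hx => (h.derivSeries.powSeries_pos hx).le

lemma mul_le_deriv (h : EntireSeries c q M) {d : ℝ} (hd : ∀ n, d ≤ q n) {x : ℝ} (hx : 0 ≤ x) :
    d * powSeries c x ≤ powSeries (derivCoeff c) x := by
  refine hasSum_le (fun n => ?_) ((h.hasSum x).mul_left d) (h.derivSeries.hasSum x)
  rw [h.ratio, ← mul_assoc]
  have := (h.pos n).le
  have := hd n
  gcongr

/-- From `f' ≥ d f` the function `f e^{-dx}` is nondecreasing on `[0, ∞)`. -/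
lemma exp_le (h : EntireSeries c q M) {d : ℝ} (hd : ∀ n, d ≤ q n) {x : ℝ} (hx : 0 ≤ x) :
    c 0 * Real.exp (d * x) ≤ powSeries c x := by
  have hm : MonotoneOn (fun y => powSeries c y * Real.exp (-d * y)) (Ici 0) := by
    refine monotoneOn_of_hasDerivAt_nonneg (W' := fun y =>
      (powSeries (derivCoeff c) y - d * powSeries c y) * Real.exp (-d * y))
      (convex_Ici 0) (fun y _ => ?_) fun y hy => ?_
    · have h1 : HasDerivAt (fun y => Real.exp (-d * y)) (Real.exp (-d * y) * (-d * 1)) y :=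
        ((hasDerivAt_id y).const_mul (-d)).exp
      refine ((h.hasDerivAt y).mul h1).congr_deriv ?_
      ring
    · exact mul_nonneg (sub_nonneg.2 (h.mul_le_deriv hd hy)) (Real.exp_pos _).le
  have h1 := hm (mem_Ici.2 le_rfl) (mem_Ici.2 hx) hx
  simp only [powSeries_zero, mul_zero, Real.exp_zero, mul_one] at h1
  calc c 0 * Real.exp (d * x) ≤ powSeries c x * Real.exp (-d * x) * Real.exp (d * x) := by gcongr
    _ = powSeries c x := by rw [mul_assoc, ← Real.exp_add]; simp

/-- The quotient `b n / a n` is multiplied by `qb n / qa n ≥ 1` at each step, so it is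
nondecreasing. -/
lemma cross_le (ha : EntireSeries a qa Ma) (hb : EntireSeries b qb Mb) (hq : ∀ n, qa n ≤ qb n)
    {i j : ℕ} (hij : i ≤ j) : b i * a j ≤ a i * b j := by
  induction j, hij using Nat.le_induction with
  | base => rw [mul_comm]
  | succ j hij ih =>
    have h1 := ha.ratio j
    have h2 := hb.ratio j
    rw [derivCoeff] at h1 h2
    have h3 : (j + 1 : ℝ) * (b i * a (j + 1)) ≤ (j + 1 : ℝ) * (a i * b (j + 1)) := by
      calc (j + 1 : ℝ) * (b i * a (j + 1)) = qa j * (b i * a j) := by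
            linear_combination b i * h1
        _ ≤ qb j * (a i * b j) := mul_le_mul (hq j) ih
            (mul_pos (hb.pos _) (ha.pos _)).le (hb.ratio_pos j).le
        _ = (j + 1 : ℝ) * (a i * b (j + 1)) := by linear_combination -a i * h2
    exact le_of_mul_le_mul_left h3 (by positivity)

lemma cross_lt (ha : EntireSeries a qa Ma) (hb : EntireSeries b qb Mb) (hq : ∀ n, qa n < qb n)
    {i j : ℕ} (hij : i < j) : b i * a j < a i * b j := by
  obtain ⟨j, rfl⟩ : ∃ k, j = k + 1 := ⟨j - 1, by omega⟩
  have ih := cross_le ha hb (fun n => (hq n).le) (Nat.lt_succ_iff.1 hij)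
  have h1 := ha.ratio j
  have h2 := hb.ratio j
  rw [derivCoeff] at h1 h2
  have h3 : (j + 1 : ℝ) * (b i * a (j + 1)) < (j + 1 : ℝ) * (a i * b (j + 1)) := by
    calc (j + 1 : ℝ) * (b i * a (j + 1)) = qa j * (b i * a j) := by
          linear_combination b i * h1
      _ < qb j * (b i * a j) := mul_lt_mul_of_pos_right (hq j) (mul_pos (hb.pos _) (ha.pos _))
      _ ≤ qb j * (a i * b j) := mul_le_mul_of_nonneg_left ih (hb.ratio_pos j).le
      _ = (j + 1 : ℝ) * (a i * b (j + 1)) := by linear_combination -a i * h2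
  exact lt_of_mul_lt_mul_left h3 (by positivity)

/-- All pairs of indices contribute nonnegatively; retaining one of them makes the inequality
quantitative, and the choice of `(i, j)` decides between sign and growth rate. -/
lemma chebyshev (ha : EntireSeries a qa Ma) (hb : EntireSeries b qb Mb) (hq : ∀ n, qa n < qb n)
    {e : ℕ → ℝ} (he : Monotone e) {x A' B' : ℝ} (hx : 0 ≤ x)
    (hA : HasSum (fun n => e n * (a n * x ^ n)) A') (hB : HasSum (fun n => e n * (b n * x ^ n)) B')
    {i j : ℕ} (hij : i ≠ j) :
    (e j - e i) * (a i * b j - b i * a j) * x ^ (i + j) ≤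
      powSeries a x * B' - powSeries b x * A' := by
  refine le_trans (le_of_eq ?_)
    (chebyshev_hasSum (ha.hasSum x) (hb.hasSum x) hA hB (fun k l => ?_) hij)
  · ring
  · have h1 : 0 ≤ (e l - e k) * (a k * b l - b k * a l) := by
      rcases le_total k l with hkl | hkl
      · exact mul_nonneg (sub_nonneg.2 (he hkl))
          (sub_nonneg.2 (cross_le ha hb (fun n => (hq n).le) hkl))
      · have := cross_le ha hb (fun n => (hq n).le) hkl
        exact mul_nonneg_of_nonpos_of_nonpos (sub_nonpos.2 (he hkl)) (by linarith)
    calc 0 ≤ (e l - e k) * (a k * b l - b k * a l) * (x ^ k * x ^ l) := by positivity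
      _ = _ := by ring

end EntireSeries

/-! ### Wronskians of solutions of a common equation -/

/-- The integrating factor `p` of `α f'' + β f' = r f` on the open right ray `D`. -/
structure IntegratingFactor (D : Set ℝ) (α β p : ℝ → ℝ) : Prop where
  isOpen : IsOpen D
  isUpperSet : IsUpperSet D
  nonempty : D.Nonempty
  coeff_pos : ∀ x ∈ D, 0 < α x
  pos : ∀ x ∈ D, 0 < p x
  hasDerivAt : ∀ x ∈ D, HasDerivAt p (β x / α x * p x) x

/-! ### Pairs of decreasing solutions, as Laplace transforms -/

section Laplace

variable {D : Set ℝ} {α β p w w₁ w₂ : ℝ → ℝ} {r r₁ r₂ : ℝ}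

/-- `w` is a weight whose Laplace transform solves `α f'' + β f' = r f`. -/
abbrev LaplaceSolves (D : Set ℝ) (α β : ℝ → ℝ) (r : ℝ) (w : ℝ → ℝ) : Prop :=
  SolvesOn D α β r (expMoment w 0) (fun x => -expMoment w 1 x) (expMoment w 2)

lemma LaplaceWeight.solvesOn (h : LaplaceWeight D w)
    (hode : ∀ x ∈ D, α x * expMoment w 2 x - β x * expMoment w 1 x = r * expMoment w 0 x) :
    LaplaceSolves D α β r w where
  deriv_one x hx := h.hasDerivAt_expMoment 0 hx
  deriv_two x hx := (h.hasDerivAt_expMoment 1 hx).neg.congr_deriv (neg_neg _)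
  ode x hx := by rw [← hode x hx]; ring

/-- Integration by parts against `e^{-xt}`. -/
lemma LaplaceWeight.moment_relation (h : LaplaceWeight D w) {x : ℝ} (hx : x ∈ D)
    {A₁ A₂ B₀ B₁ B₂ : ℝ}
    (hd : ∀ t, 0 < t → HasDerivAt (fun t => (A₁ * t + A₂ * t ^ 2) * w t)
      ((B₀ + B₁ * t + B₂ * t ^ 2) * w t) t)
    (h0 : Tendsto (fun t => (A₁ * t + A₂ * t ^ 2) * w t) (𝓝[>] 0) (𝓝 0)) :
    B₀ * expMoment w 0 x + B₁ * expMoment w 1 x + B₂ * expMoment w 2 x =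
      x * (A₁ * expMoment w 1 x + A₂ * expMoment w 2 x) := by
  have i0 := h.integrable_moment 0 hx
  have i1 := h.integrable_moment 1 hx
  have i2 := h.integrable_moment 2 hx
  set F : ℝ → ℝ := fun t => Real.exp (-x * t) * ((A₁ * t + A₂ * t ^ 2) * w t)
  set F' : ℝ → ℝ := fun t => B₀ * (Real.exp (-x * t) * (t ^ 0 * w t)) +
    (B₁ - x * A₁) * (Real.exp (-x * t) * (t ^ 1 * w t)) +
    (B₂ - x * A₂) * (Real.exp (-x * t) * (t ^ 2 * w t))
  have hF' : IntegrableOn F' (Ioi 0) :=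
    ((i0.const_mul B₀).add (i1.const_mul (B₁ - x * A₁))).add (i2.const_mul (B₂ - x * A₂))
  have hF : IntegrableOn F (Ioi 0) := by
    refine ((i1.const_mul A₁).add (i2.const_mul A₂)).congr (ae_of_all _ fun t => ?_)
    simp only [Pi.add_apply, F]
    ring
  have hdF : ∀ t ∈ Ioi (0 : ℝ), HasDerivAt F (F' t) t := fun t ht => by
    have h1 : HasDerivAt (fun t => Real.exp (-x * t)) (Real.exp (-x * t) * (-x * 1)) t :=
      ((hasDerivAt_id t).const_mul (-x)).exp
    refine (h1.mul (hd t ht)).congr_deriv ?_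
    simp only [F']
    ring
  have hc : ContinuousWithinAt F (Ici 0) 0 := by
    rw [← continuousWithinAt_Ioi_iff_Ici]
    have h1 : Tendsto (fun t : ℝ => Real.exp (-x * t)) (𝓝[>] 0) (𝓝 (Real.exp (-x * 0))) :=
      (Continuous.tendsto (by fun_prop) 0).mono_left nhdsWithin_le_nhds
    have h2 := h1.mul h0
    simpa [ContinuousWithinAt, F] using h2
  -- The boundary term at infinity needs no separate estimate: it vanishes because `F` and `F'` are
  -- both integrable.
  have key := integral_Ioi_of_hasDerivAt_of_tendsto hc hdF hF'
    (tendsto_zero_of_hasDerivAt_of_integrableOn_Ioi hdF hF' hF)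
  have e : ∫ t in Ioi (0 : ℝ), F' t = B₀ * expMoment w 0 x + (B₁ - x * A₁) * expMoment w 1 x +
      (B₂ - x * A₂) * expMoment w 2 x := by
    simp only [F', expMoment]
    have i01 : IntegrableOn (fun t => B₀ * (Real.exp (-x * t) * (t ^ 0 * w t)) +
        (B₁ - x * A₁) * (Real.exp (-x * t) * (t ^ 1 * w t))) (Ioi 0) :=
      (i0.const_mul B₀).add (i1.const_mul (B₁ - x * A₁))
    rw [integral_add i01 (i2.const_mul (B₂ - x * A₂)), integral_add (i0.const_mul B₀) (i1.const_mul (B₁ - x * A₁)),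
      integral_const_mul, integral_const_mul, integral_const_mul]
  rw [e] at key
  simp only [F, mul_zero, ne_eq, OfNat.ofNat_ne_zero, not_false_eq_true, zero_pow, add_zero,
    zero_mul, sub_self] at key
  linarith

variable (hI : IntegratingFactor D α β p) (h₁ : LaplaceWeight D w₁) (h₂ : LaplaceWeight D w₂)
  (s₁ : LaplaceSolves D α β r₁ w₁) (s₂ : LaplaceSolves D α β r₂ w₂) (hr : r₁ < r₂)
  (hR : ∀ s t, 0 < s → s < t → w₂ s * w₁ t ≤ w₁ s * w₂ t)

include h₁ h₂ s₁ s₂ hR in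
lemma laplace_wronskian_nonneg {x : ℝ} (hx : x ∈ D) :
    0 ≤ wronskianFn (expMoment w₂ 0) (expMoment w₁ 0) x := by
  rw [s₂.wronskian_eq s₁ hx]
  have := h₁.chebyshev h₂ hR 1 hx
  linarith

include hI h₁ h₂ s₁ s₂ hR hr in
-- Chebyshev gives only `W ≥ 0`; but `p W` is strictly decreasing and still nonnegative at `x + 1`,
-- so it is positive at `x`.
lemma laplace_wronskian_pos {x : ℝ} (hx : x ∈ D) :
    0 < wronskianFn (expMoment w₂ 0) (expMoment w₁ 0) x := by
  have hy : x + 1 ∈ D := hI.isUpperSet (by linarith) hx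
  have h := s₂.strictAntiOn_weighted_wronskian hI.isOpen hI.isUpperSet.convex_real s₁ hI.coeff_pos
    hI.pos hI.hasDerivAt (fun _ h => h₂.expMoment_pos 0 h) (fun _ h => h₁.expMoment_pos 0 h) hr
    hx hy (by linarith)
  have h1 := mul_nonneg (hI.pos _ hy).le (laplace_wronskian_nonneg h₁ h₂ s₁ s₂ hR hy)
  exact pos_of_mul_pos_right (h1.trans_lt h) (hI.pos _ hx).le

include h₁ h₂ s₁ s₂ hR in
lemma laplace_wronskian_antitoneOn :
    AntitoneOn (wronskianFn (expMoment w₂ 0) (expMoment w₁ 0)) D := by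
  refine antitoneOn_of_hasDerivAt_nonpos h₁.isUpperSet.convex_real
    (fun x hx => s₂.wronskian_hasDerivAt h₁.isOpen s₁ hx) fun x hx => ?_
  have := h₁.chebyshev h₂ hR 2 hx
  linarith

include hI h₁ h₂ s₁ s₂ hR hr in
lemma laplace_wronskian_atTop :
    MonotonicLimit (wronskianFn (expMoment w₂ 0) (expMoment w₁ 0)) atTop 0 1 := by
  obtain ⟨x₀, hx₀⟩ := hI.nonempty
  have hev : D ∈ (atTop : Filter ℝ) :=
    mem_of_superset (Ici_mem_atTop x₀) fun x hx => hI.isUpperSet hx hx₀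
  refine ⟨?_, ?_, D, hev, Or.inr (laplace_wronskian_antitoneOn h₁ h₂ s₁ s₂ hR)⟩
  · rw [← EReal.coe_zero, EReal.tendsto_coe]
    have t := fun k => h₁.tendsto_expMoment hI.nonempty k
    have t' := fun k => h₂.tendsto_expMoment hI.nonempty k
    have := ((t' 0).mul (t 1).neg).sub ((t 0).mul (t' 1).neg)
    simp only [neg_zero, mul_zero, sub_self] at this
    refine this.congr' ?_
    filter_upwards [hev] with x hx
    rw [s₂.wronskian_eq s₁ hx]
  · filter_upwards [hev] with x hx
    exact Real.sign_of_pos (laplace_wronskian_pos hI h₁ h₂ s₁ s₂ hr hR hx)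

include hI h₁ h₂ s₁ s₂ hR hr in
-- To the left of `x₀` the decreasing function `p W` stays above its positive value at `x₀`, so `W`
-- is at least a positive constant over `p`, and `p → 0`.
lemma laplace_wronskian_left {l : Filter ℝ} (hl : ∀ x₀ ∈ D, ∀ᶠ x in l, x ∈ D ∧ x ≤ x₀)
    (hp : Tendsto p l (𝓝 0)) :
    MonotonicLimit (wronskianFn (expMoment w₂ 0) (expMoment w₁ 0)) l ⊤ 1 := by
  obtain ⟨x₀, hx₀⟩ := hI.nonempty
  have hev := hl x₀ hx₀
  refine ⟨?_, ?_, D, hev.mono fun x hx => hx.1,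
    Or.inr (laplace_wronskian_antitoneOn h₁ h₂ s₁ s₂ hR)⟩
  · rw [EReal.tendsto_coe_nhds_top_iff]
    set K := p x₀ * wronskianFn (expMoment w₂ 0) (expMoment w₁ 0) x₀
    have hK : 0 < K := mul_pos (hI.pos _ hx₀) (laplace_wronskian_pos hI h₁ h₂ s₁ s₂ hr hR hx₀)
    have hp' : Tendsto p l (𝓝[>] 0) :=
      tendsto_nhdsWithin_iff.2 ⟨hp, hev.mono fun x hx => hI.pos x hx.1⟩
    refine tendsto_atTop_mono' l ?_ ((tendsto_inv_nhdsGT_zero.comp hp').const_mul_atTop hK)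
    filter_upwards [hev] with x hx
    have h := (s₂.strictAntiOn_weighted_wronskian hI.isOpen hI.isUpperSet.convex_real s₁
      hI.coeff_pos hI.pos hI.hasDerivAt (fun _ h => h₂.expMoment_pos 0 h)
      (fun _ h => h₁.expMoment_pos 0 h) hr).antitoneOn hx.1 hx₀ hx.2
    have := hI.pos x hx.1
    rw [Function.comp_apply, ← div_eq_mul_inv, div_le_iff₀ this, mul_comm _ (p x)]
    exact h
  · filter_upwards [hev] with x hx
    exact Real.sign_of_pos (laplace_wronskian_pos hI h₁ h₂ s₁ s₂ hr hR hx.1)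

end Laplace

/-! ### Pairs of increasing solutions, as power series -/

section Series

variable {α β p w₂ : ℝ → ℝ} {a b qa qb : ℕ → ℝ} {Ma Mb r₁ r₂ : ℝ}

/-- The power series with coefficients `a` solves `α f'' + β f' = r f` on `(0, ∞)`. -/
abbrev SeriesSolves (α β : ℝ → ℝ) (r : ℝ) (a : ℕ → ℝ) : Prop :=
  SolvesOn (Ioi 0) α β r (powSeries a) (powSeries (derivCoeff a))
    (powSeries (derivCoeff (derivCoeff a)))

lemma EntireSeries.solvesOn (h : EntireSeries a qa Ma)
    (hode : ∀ x : ℝ, 0 < x → α x * powSeries (derivCoeff (derivCoeff a)) x +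
      β x * powSeries (derivCoeff a) x = r₁ * powSeries a x) : SeriesSolves α β r₁ a :=
  ⟨fun x _ => h.hasDerivAt x, fun x _ => h.derivSeries.hasDerivAt x, hode⟩

variable (ha : EntireSeries a qa Ma) (hb : EntireSeries b qb Mb) (hq : ∀ n, qa n < qb n)
  (sa : SeriesSolves α β r₁ a) (sb : SeriesSolves α β r₂ b)

include ha hb hq sa sb

lemma series_wronskian_monotoneOn :
    MonotoneOn (wronskianFn (powSeries a) (powSeries b)) (Ioi 0) := by
  refine monotoneOn_of_hasDerivAt_nonneg (convex_Ioi 0)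
    (fun x hx => sa.wronskian_hasDerivAt isOpen_Ioi sb hx) fun x hx => ?_
  have hx : 0 < x := hx
  have he : Monotone fun n : ℕ => (n : ℝ) * (n - 1) := by
    refine monotone_nat_of_le_succ fun n => ?_
    push_cast
    have : (0 : ℝ) ≤ n := by positivity
    nlinarith
  -- Since `n(n-1)` vanishes at both `0` and `1`, this pair contributes `0`; only nonnegativity is
  -- wanted here.
  have h := ha.chebyshev hb hq he hx.le (ha.hasSum_natCast_mul_pred x)
    (hb.hasSum_natCast_mul_pred x) (i := 0) (j := 1) (by norm_num)
  have h2 : 0 ≤ x ^ 2 * (powSeries a x * powSeries (derivCoeff (derivCoeff b)) x -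
      powSeries b x * powSeries (derivCoeff (derivCoeff a)) x) := by
    refine le_trans (le_of_eq ?_) (h.trans (le_of_eq ?_))
    · norm_num
    · ring
  exact nonneg_of_mul_nonneg_right h2 (by positivity)

lemma series_wronskian_ge {x : ℝ} (hx : 0 < x) {j : ℕ} (hj : 0 < j) :
    j * (a 0 * b j - b 0 * a j) * x ^ j ≤ x * wronskianFn (powSeries a) (powSeries b) x := by
  have h := ha.chebyshev hb hq (e := fun n : ℕ => (n : ℝ)) Nat.mono_cast hx.le
    (ha.hasSum_natCast_mul x) (hb.hasSum_natCast_mul x) (i := 0) (j := j) hj.ne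
  rw [sa.wronskian_eq sb hx]
  simp only [Nat.cast_zero, sub_zero, zero_add] at h
  linarith

lemma series_wronskian_pos {x : ℝ} (hx : 0 < x) :
    0 < wronskianFn (powSeries a) (powSeries b) x := by
  have h := series_wronskian_ge ha hb hq sa sb hx (j := 1) one_pos
  have h1 := ha.cross_lt hb hq (i := 0) (j := 1) one_pos
  have h2 : 0 < ((1 : ℕ) : ℝ) * (a 0 * b 1 - b 0 * a 1) * x ^ 1 :=
    mul_pos (mul_pos (by norm_num) (sub_pos.2 h1)) (by positivity)
  exact pos_of_mul_pos_right (h2.trans_le h) hx.le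

lemma series_wronskian_atTop :
    MonotonicLimit (wronskianFn (powSeries a) (powSeries b)) atTop ⊤ 1 := by
  refine ⟨?_, ?_, Ioi 0, Ioi_mem_atTop 0, Or.inl (series_wronskian_monotoneOn ha hb hq sa sb)⟩
  · rw [EReal.tendsto_coe_nhds_top_iff]
    -- The pair `(0, 2)` bounds `x W` below by a multiple of `x²`, hence `W` by a multiple of `x`.
    -- The pair `(0, 1)` would give only a constant.
    have h1 := sub_pos.2 (ha.cross_lt hb hq (i := 0) (j := 2) two_pos)
    refine tendsto_atTop_mono' atTop ?_ (tendsto_id.const_mul_atTop (mul_pos two_pos h1))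
    filter_upwards [eventually_gt_atTop 0] with x hx
    have h := series_wronskian_ge ha hb hq sa sb hx (j := 2) two_pos
    refine le_of_mul_le_mul_left (le_trans (le_of_eq ?_) h) hx
    simp only [id_eq]
    push_cast
    ring
  · filter_upwards [eventually_gt_atTop 0] with x hx
    exact Real.sign_of_pos (series_wronskian_pos ha hb hq sa sb hx)

lemma series_wronskian_zero : ∃ C : ℝ, 0 < C ∧
    MonotonicLimit (wronskianFn (powSeries a) (powSeries b)) (𝓝[>] 0) (C : EReal) 1 := by
  refine ⟨a 0 * b 1 - b 0 * a 1, sub_pos.2 (ha.cross_lt hb hq (i := 0) (j := 1) one_pos), ?_, ?_,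
    Ioi 0, self_mem_nhdsWithin, Or.inl (series_wronskian_monotoneOn ha hb hq sa sb)⟩
  · rw [EReal.tendsto_coe]
    have hc : Continuous fun x => powSeries a x * powSeries (derivCoeff b) x -
        powSeries b x * powSeries (derivCoeff a) x :=
      (ha.continuous.mul hb.derivSeries.continuous).sub
        (hb.continuous.mul ha.derivSeries.continuous)
    have h1 := (hc.tendsto 0).mono_left (nhdsWithin_le_nhds (s := Ioi 0))
    simp only [EntireSeries.powSeries_zero, derivCoeff, Nat.cast_zero, zero_add, one_mul] at h1
    refine h1.congr' ?_
    filter_upwards [self_mem_nhdsWithin] with x hx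
    rw [sa.wronskian_eq sb hx]
  · filter_upwards [self_mem_nhdsWithin] with x hx
    exact Real.sign_of_pos (series_wronskian_pos ha hb hq sa sb hx)

end Series

/-! ### One increasing series against one decreasing Laplace transform -/

section Mixed

variable {β p w w₂ : ℝ → ℝ} {a b qa qb : ℕ → ℝ} {Ma Mb r₁ r₂ : ℝ}

lemma mixed_wronskian_eq {α : ℝ → ℝ} (sa : SeriesSolves α β r₁ a)
    (sw : LaplaceSolves (Ioi 0) α β r₂ w) {x : ℝ} (hx : 0 < x) :
    wronskianFn (powSeries a) (expMoment w 0) x =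
      -(powSeries a x * expMoment w 1 x + expMoment w 0 x * powSeries (derivCoeff a) x) := by
  rw [sa.wronskian_eq sw hx]
  ring

lemma mixed_wronskian_neg {α : ℝ → ℝ} (ha : EntireSeries a qa Ma) (hw : LaplaceWeight (Ioi 0) w)
    (sa : SeriesSolves α β r₁ a) (sw : LaplaceSolves (Ioi 0) α β r₂ w) {x : ℝ} (hx : 0 < x) :
    wronskianFn (powSeries a) (expMoment w 0) x < 0 := by
  rw [mixed_wronskian_eq sa sw hx]
  have := ha.powSeries_pos hx.le
  have := ha.derivSeries.powSeries_pos hx.le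
  have := hw.expMoment_pos 0 hx
  have := hw.expMoment_pos 1 hx
  have : 0 < powSeries a x * expMoment w 1 x + expMoment w 0 x * powSeries (derivCoeff a) x := by
    positivity
  linarith

/-- The auxiliary series `b` solves the same equation as the Laplace transform, so its weighted
mixed Wronskian does not shrink in absolute value towards `0`. Near `0` the series `a` and its
derivative dominate a fixed multiple of those of `b`, which transfers the divergence. -/
lemma mixed_wronskian_zero (hI : IntegratingFactor (Ioi 0) (fun x => x) β p)
    (ha : EntireSeries a qa Ma) (hb : EntireSeries b qb Mb) (hw : LaplaceWeight (Ioi 0) w)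
    (sa : SeriesSolves (fun x => x) β r₁ a) (sb : SeriesSolves (fun x => x) β r₂ b)
    (sw : LaplaceSolves (Ioi 0) (fun x => x) β r₂ w) (hr₂ : 0 < r₂)
    (hβ : ∀ᶠ x in 𝓝[>] 0, 0 ≤ β x) (hp : Tendsto p (𝓝[>] 0) (𝓝 0)) :
    MonotonicLimit (wronskianFn (powSeries a) (expMoment w 0)) (𝓝[>] 0) ⊥ (-1) := by
  have h01 : ∀ᶠ x : ℝ in 𝓝[>] 0, 0 < x ∧ x ≤ 1 := by
    filter_upwards [Ioc_mem_nhdsGT (zero_lt_one (α := ℝ))] with x hx using hx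
  have a0 := ha.zero_pos
  refine ⟨?_, ?_, ?_⟩
  · rw [EReal.tendsto_coe_nhds_bot_iff]
    -- All these series are nondecreasing on `[0, 1]`; comparing those of `b` at `1` with those of
    -- `a` at `0` therefore covers the whole interval.
    obtain ⟨δ, hδ, hδ1, hδ2⟩ : ∃ δ > 0, δ * powSeries b 1 ≤ a 0 ∧
        δ * powSeries (derivCoeff b) 1 ≤ derivCoeff a 0 := by
      have hb1 := hb.powSeries_pos zero_le_one
      have hb2 := hb.derivSeries.powSeries_pos zero_le_one
      have a1 := ha.derivSeries.zero_pos
      refine ⟨min (a 0 / powSeries b 1) (derivCoeff a 0 / powSeries (derivCoeff b) 1),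
        lt_min (by positivity) (by positivity), ?_, ?_⟩
      · rw [← le_div_iff₀ hb1]; exact min_le_left _ _
      · rw [← le_div_iff₀ hb2]; exact min_le_right _ _
    set K := p 1 * -wronskianFn (powSeries b) (expMoment w 0) 1
    have hK : 0 < K := mul_pos (hI.pos 1 (mem_Ioi.2 one_pos))
      (neg_pos.2 (mixed_wronskian_neg hb hw sb sw one_pos))
    have hp' : Tendsto p (𝓝[>] 0) (𝓝[>] 0) := by
      refine tendsto_nhdsWithin_iff.2 ⟨hp, ?_⟩
      filter_upwards [self_mem_nhdsWithin] with x hx using hI.pos x hx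
    refine tendsto_atBot_mono' _ ?_ (tendsto_neg_atTop_atBot.comp
      ((tendsto_inv_nhdsGT_zero.comp hp').const_mul_atTop (mul_pos hδ hK)))
    filter_upwards [h01] with x hx
    have hb1 := hb.monotoneOn (mem_Ici.2 hx.1.le) (mem_Ici.2 zero_le_one) hx.2
    have hb2 := hb.derivSeries.monotoneOn (mem_Ici.2 hx.1.le) (mem_Ici.2 zero_le_one) hx.2
    have ha1 := ha.zero_le hx.1.le
    have ha2 := ha.derivSeries.zero_le hx.1.le
    have m0 := hw.expMoment_pos 0 hx.1
    have m1 := hw.expMoment_pos 1 hx.1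
    have hmono := sb.monotoneOn_weighted_wronskian isOpen_Ioi (convex_Ioi 0) sw hI.coeff_pos
      hI.pos hI.hasDerivAt (fun y hy => hb.powSeries_pos (le_of_lt hy))
      (fun y hy => hw.expMoment_pos 0 hy) le_rfl (mem_Ioi.2 hx.1) (mem_Ioi.2 one_pos) hx.2
    have hpx := hI.pos x hx.1
    have h1 : K * (p x)⁻¹ ≤ -wronskianFn (powSeries b) (expMoment w 0) x := by
      rw [← div_eq_mul_inv, div_le_iff₀ hpx]
      simp only [K]
      simp only at hmono
      linarith
    have h2 : δ * (-wronskianFn (powSeries b) (expMoment w 0) x) ≤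
        -wronskianFn (powSeries a) (expMoment w 0) x := by
      rw [mixed_wronskian_eq sa sw hx.1, mixed_wronskian_eq sb sw hx.1, neg_neg, neg_neg]
      have e1 : δ * powSeries b x ≤ powSeries a x :=
        ((mul_le_mul_of_nonneg_left hb1 hδ.le).trans hδ1).trans ha1
      have e2 : δ * powSeries (derivCoeff b) x ≤ powSeries (derivCoeff a) x :=
        ((mul_le_mul_of_nonneg_left hb2 hδ.le).trans hδ2).trans ha2
      nlinarith [mul_le_mul_of_nonneg_right e1 m1.le, mul_le_mul_of_nonneg_right e2 m0.le]
    have h3 := mul_le_mul_of_nonneg_left h1 hδ.le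
    simp only [Function.comp_apply]
    rw [mul_assoc]
    linarith
  · filter_upwards [self_mem_nhdsWithin] with x hx
    exact Real.sign_of_neg (mixed_wronskian_neg ha hw sa sw hx)
  · obtain ⟨ε, hε, hεβ⟩ := mem_nhdsGT_iff_exists_Ioo_subset.1 hβ
    have hε : 0 < ε := hε
    set G := powSeries (derivCoeff (derivCoeff a)) 1
    have hG : 0 < G := ha.derivSeries.derivSeries.powSeries_pos zero_le_one
    -- On this interval `x g'' ≤ x G ≤ r₂ a₀ ≤ r₂ g`, while `β ≥ 0` gives `x M₂ ≥ r₂ M₀`; together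
    -- they make `W' = g M₂ - M₀ g''` nonnegative.
    set ε' := min (min ε 1) (r₂ * a 0 / G)
    have hε' : 0 < ε' := lt_min (lt_min hε one_pos) (by positivity)
    refine ⟨Ioo 0 ε', Ioo_mem_nhdsGT hε', Or.inl ?_⟩
    refine monotoneOn_of_hasDerivAt_nonneg (convex_Ioo 0 ε')
      (fun x hx => sa.wronskian_hasDerivAt isOpen_Ioi sw hx.1) fun x hx => ?_
    have hx0 : 0 < x := hx.1
    have hx1 : x ≤ 1 := hx.2.le.trans ((min_le_left _ _).trans (min_le_right _ _))
    have hxε : x < ε := hx.2.trans_le ((min_le_left _ _).trans (min_le_left _ _))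
    have hxG : x * G ≤ r₂ * a 0 := by
      rw [← le_div_iff₀ hG]
      exact hx.2.le.trans (min_le_right _ _)
    have hβx : 0 ≤ β x := hεβ ⟨hx0, hxε⟩
    have hg2 := ha.derivSeries.derivSeries.monotoneOn (mem_Ici.2 hx0.le)
      (mem_Ici.2 zero_le_one) hx1
    have ha1 := ha.zero_le hx0.le
    have hgp := ha.powSeries_pos hx0.le
    have m0 := hw.expMoment_pos 0 hx0
    have m1 := hw.expMoment_pos 1 hx0
    have hode := sw.ode x hx0
    have h1 : r₂ * expMoment w 0 x ≤ x * expMoment w 2 x := by nlinarith [mul_nonneg hβx m1.le]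
    have h2 : 0 ≤ x * (powSeries a x * expMoment w 2 x -
        expMoment w 0 x * powSeries (derivCoeff (derivCoeff a)) x) := by
      have e1 : powSeries a x * (r₂ * expMoment w 0 x) ≤
          powSeries a x * (x * expMoment w 2 x) := by gcongr
      have e2 : x * powSeries (derivCoeff (derivCoeff a)) x ≤ r₂ * powSeries a x :=
        (mul_le_mul_of_nonneg_left hg2 hx0.le).trans
          (hxG.trans (mul_le_mul_of_nonneg_left ha1 hr₂.le))
      have e3 := mul_le_mul_of_nonneg_left e2 m0.le
      linarith
    exact nonneg_of_mul_nonneg_right h2 hx0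

lemma mixed_wronskian_atTop (ha : EntireSeries a qa Ma) (hw : LaplaceWeight (Ioi 0) w)
    (sa : SeriesSolves (fun x => x) β r₁ a)
    (sw : LaplaceSolves (Ioi 0) (fun x => x) β r₂ w) {d : ℝ} (hd : 0 < d)
    (hdq : ∀ n, d ≤ qa n) (hβ : ∀ᶠ x in atTop, β x ≤ 0) :
    MonotonicLimit (wronskianFn (powSeries a) (expMoment w 0)) atTop ⊥ (-1) := by
  have a0 := ha.zero_pos
  refine ⟨?_, ?_, ?_⟩
  · rw [EReal.tendsto_coe_nhds_bot_iff]
    -- Any rate strictly between `0` and `d` works: `M₀ ≥ c e^{-dx/2}` against `g' ≥ d a₀ e^{dx}`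
    -- leaves growth `e^{dx/2}`.
    obtain ⟨c, hc, hcx⟩ := hw.exists_exp_le_expMoment (x₀ := 1) (T := d / 2) (mem_Ioi.2 one_pos)
      (by positivity)
    have ht : Tendsto (fun x : ℝ => Real.exp (d / 2 * x)) atTop atTop :=
      Real.tendsto_exp_atTop.comp (tendsto_id.const_mul_atTop (by positivity))
    refine tendsto_atBot_mono' _ ?_ (tendsto_neg_atTop_atBot.comp
      (ht.const_mul_atTop (show 0 < c * (d * a 0) by positivity)))
    filter_upwards [eventually_ge_atTop 1] with x hx
    have hx0 : 0 < x := by linarith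
    rw [mixed_wronskian_eq sa sw hx0]
    have h1 := hcx x hx
    have h2 := ha.exp_le hdq hx0.le
    have h3 := ha.mul_le_deriv hdq hx0.le
    have hgp := ha.powSeries_pos hx0.le
    have m0 := hw.expMoment_pos 0 hx0
    have m1 := hw.expMoment_pos 1 hx0
    have h4 : d * (a 0 * Real.exp (d * x)) ≤ powSeries (derivCoeff a) x :=
      (mul_le_mul_of_nonneg_left h2 hd.le).trans h3
    have h5 : c * Real.exp (-(d / 2) * x) * (d * (a 0 * Real.exp (d * x))) ≤
        expMoment w 0 x * powSeries (derivCoeff a) x :=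
      mul_le_mul h1 h4 (by positivity) m0.le
    have h6 : Real.exp (-(d / 2) * x) * Real.exp (d * x) = Real.exp (d / 2 * x) := by
      rw [← Real.exp_add]; ring_nf
    have h7 : c * Real.exp (-(d / 2) * x) * (d * (a 0 * Real.exp (d * x))) =
        c * (d * a 0) * Real.exp (d / 2 * x) := by
      rw [← h6]; ring
    have h8 := mul_pos hgp m1
    simp only [Function.comp_apply]
    linarith
  · filter_upwards [eventually_gt_atTop 0] with x hx
    exact Real.sign_of_neg (mixed_wronskian_neg ha hw sa sw hx)
  · obtain ⟨B, hB⟩ := eventually_atTop.1 hβ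
    -- Past `B` the sign of `β` gives `x M₂ ≤ r₂ M₀`; past `r₂ / d²` the bound `g'' ≥ d² g` gives `x
    -- g'' ≥ r₂ g`. Hence `W' ≤ 0`.
    set B' := max (max B 1) (r₂ / d ^ 2)
    refine ⟨Ici B', Ici_mem_atTop B', Or.inr ?_⟩
    have hpos : ∀ x ∈ Ici B', 0 < x := fun x hx =>
      one_pos.trans_le (((le_max_right B 1).trans (le_max_left _ _)).trans hx)
    refine antitoneOn_of_hasDerivAt_nonpos (convex_Ici B')
      (fun x hx => sa.wronskian_hasDerivAt isOpen_Ioi sw (hpos x hx)) fun x hx => ?_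
    have hx0 := hpos x hx
    have hβx : β x ≤ 0 := hB x (((le_max_left B 1).trans (le_max_left _ _)).trans hx)
    have hxd : r₂ ≤ x * d ^ 2 := by
      rw [← div_le_iff₀ (by positivity)]
      exact (le_max_right _ _).trans hx
    have hgp := ha.powSeries_pos hx0.le
    have m0 := hw.expMoment_pos 0 hx0
    have m1 := hw.expMoment_pos 1 hx0
    have hode := sw.ode x hx0
    have h1 : x * expMoment w 2 x ≤ r₂ * expMoment w 0 x := by
      nlinarith [mul_nonneg (neg_nonneg.2 hβx) m1.le]
    have h3 := ha.mul_le_deriv hdq hx0.le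
    have h4 := ha.derivSeries.mul_le_deriv (fun n => hdq (n + 1)) hx0.le
    have h5 : d ^ 2 * powSeries a x ≤ powSeries (derivCoeff (derivCoeff a)) x := by
      refine le_trans (le_of_eq ?_) ((mul_le_mul_of_nonneg_left h3 hd.le).trans h4)
      ring
    have h2 : 0 ≤ x * (expMoment w 0 x * powSeries (derivCoeff (derivCoeff a)) x -
        powSeries a x * expMoment w 2 x) := by
      have e1 : powSeries a x * (x * expMoment w 2 x) ≤
          powSeries a x * (r₂ * expMoment w 0 x) := by gcongr
      have e2 : r₂ * powSeries a x ≤ x * powSeries (derivCoeff (derivCoeff a)) x := by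
        calc r₂ * powSeries a x ≤ x * d ^ 2 * powSeries a x := by gcongr
          _ = x * (d ^ 2 * powSeries a x) := by ring
          _ ≤ _ := by gcongr
      have e3 := mul_le_mul_of_nonneg_left e2 m0.le
      linarith
    have := nonneg_of_mul_nonneg_right h2 hx0
    linarith

end Mixed

/-! ### Construction of Laplace weights -/

/-- After multiplication by `e^{-xt}` the bound becomes a Gamma integrand with rate `x - δ > 0`. -/
lemma LaplaceWeight.of_bound {D : Set ℝ} {w : ℝ → ℝ} {s : ℝ} (hD : IsOpen D)
    (hU : IsUpperSet D) (hpos : ∀ t, 0 < t → 0 < w t) (hc : ContinuousOn w (Ioi 0)) (hs : 0 < s)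
    (hb : ∀ x ∈ D, ∃ δ < x, ∃ K, ∀ t, 0 < t → w t ≤ K * (Real.exp (δ * t) * t ^ (s - 1))) :
    LaplaceWeight D w := by
  refine ⟨hD, hU, hpos, fun x hx => ?_⟩
  obtain ⟨δ, hδ, K, hK⟩ := hb x hx
  have h1 : IntegrableOn (fun t : ℝ => t ^ (s - 1) * Real.exp (-(x - δ) * t ^ (1 : ℝ))) (Ioi 0) :=
    integrableOn_rpow_mul_exp_neg_mul_rpow (by linarith) one_pos (sub_pos.2 hδ)
  have hm : AEStronglyMeasurable (fun t => Real.exp (-x * t) * w t) (volume.restrict (Ioi 0)) :=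
    (ContinuousOn.mul (by fun_prop) hc).aestronglyMeasurable measurableSet_Ioi
  refine (h1.const_mul K).mono' hm ((ae_restrict_iff' measurableSet_Ioi).2
    (ae_of_all _ fun t ht => ?_))
  have ht : 0 < t := ht
  have hw := hpos t ht
  rw [Real.norm_of_nonneg (by positivity), Real.rpow_one]
  calc Real.exp (-x * t) * w t
      ≤ Real.exp (-x * t) * (K * (Real.exp (δ * t) * t ^ (s - 1))) := by
        gcongr
        exact hK t ht
    _ = K * (t ^ (s - 1) * Real.exp (-(x - δ) * t)) := by
        have : Real.exp (-(x - δ) * t) = Real.exp (-x * t) * Real.exp (δ * t) := by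
          rw [← Real.exp_add]; ring_nf
        rw [this]; ring

/-- Written as logarithmic derivative times value, the shape required of an integrating factor. -/
lemma hasDerivAt_rpow_div {t : ℝ} (ht : 0 < t) (s : ℝ) :
    HasDerivAt (fun t : ℝ => t ^ s) (s / t * t ^ s) t := by
  refine (Real.hasDerivAt_rpow_const (Or.inl ht.ne')).congr_deriv ?_
  rw [Real.rpow_sub_one ht.ne']
  ring

lemma hasDerivAt_one_add_rpow {t : ℝ} (ht : 0 < t) (s : ℝ) :
    HasDerivAt (fun t : ℝ => (1 + t) ^ s) (s / (1 + t) * (1 + t) ^ s) t := by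
  have h1 : (0 : ℝ) < 1 + t := by linarith
  exact ((hasDerivAt_rpow_div h1 s).comp t ((hasDerivAt_id' t).const_add 1)).congr_deriv (mul_one _)

lemma tendsto_rpow_nhdsGT_zero {s : ℝ} (hs : 0 < s) :
    Tendsto (fun t : ℝ => t ^ s) (𝓝[>] 0) (𝓝 0) := by
  have h := (Real.continuousAt_rpow_const 0 s (Or.inr hs.le)).tendsto
  rw [Real.zero_rpow hs.ne'] at h
  exact h.mono_left nhdsWithin_le_nhds

/-- The weight of the squared Bessel diffusion. -/
def besselWeight (μ c t : ℝ) : ℝ := Real.exp (-c / t) * t ^ (μ - 1)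

/-- The weight of Tricomi's function. -/
def tricomiWeight (b a t : ℝ) : ℝ := t ^ (a - 1) * (1 + t) ^ (b - a - 1)

/-- The weight of the parabolic cylinder function. -/
def cylinderWeight (r t : ℝ) : ℝ := Real.exp (-t ^ 2 / 2) * t ^ (r - 1)

lemma besselWeight_laplaceWeight {μ c : ℝ} (hμ : 0 < μ) (hc : 0 < c) :
    LaplaceWeight (Ioi 0) (besselWeight μ c) := by
  refine LaplaceWeight.of_bound (s := μ) isOpen_Ioi (isUpperSet_Ioi 0) (fun t ht => ?_) ?_ hμ
    fun x hx => ⟨0, hx, 1, fun t ht => ?_⟩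
  · rw [besselWeight]; positivity
  · refine ContinuousOn.mul ?_ ?_
    · exact (continuousOn_const.div continuousOn_id fun t ht => (ne_of_gt ht)).rexp
    · exact continuousOn_id.rpow_const fun t ht => Or.inl (ne_of_gt ht)
  · rw [besselWeight, one_mul, zero_mul, Real.exp_zero]
    gcongr
    rw [Real.exp_le_one_iff, neg_div, neg_nonpos]
    positivity

lemma tricomiWeight_laplaceWeight {a b : ℝ} (ha : 0 < a) :
    LaplaceWeight (Ioi 0) (tricomiWeight b a) := by
  refine LaplaceWeight.of_bound (s := a) isOpen_Ioi (isUpperSet_Ioi 0) (fun t ht => ?_) ?_ ha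
    fun x hx => ?_
  · rw [tricomiWeight]; positivity
  · refine ContinuousOn.mul ?_ ?_
    · exact continuousOn_id.rpow_const fun t ht => Or.inl (ne_of_gt ht)
    · refine ContinuousOn.rpow_const (by fun_prop) fun t ht => Or.inl (ne_of_gt ?_)
      have ht : 0 < t := ht
      linarith
  · have hx : 0 < x := hx
    set N := ⌈b - a - 1⌉₊
    -- Half of the exponential decay is spent on the factor `(1 + t)^(b-a-1)`, bounded first by a
    -- natural power of `1 + t ≥ 1`.
    refine ⟨x / 2, half_lt_self hx, N.factorial / (x / 2) ^ N * Real.exp (x / 2),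
      fun t ht => ?_⟩
    have h1 : (1 + t) ^ (b - a - 1) ≤ N.factorial / (x / 2) ^ N * Real.exp (x / 2 * (1 + t)) := by
      refine le_trans ?_ (LaplaceWeight.pow_le_exp (half_pos hx) (by linarith) N)
      rw [← Real.rpow_natCast]
      exact Real.rpow_le_rpow_of_exponent_le (by linarith) (Nat.le_ceil _)
    have h2 : Real.exp (x / 2 * (1 + t)) = Real.exp (x / 2) * Real.exp (x / 2 * t) := by
      rw [← Real.exp_add]; ring_nf
    rw [h2] at h1
    calc tricomiWeight b a t = (1 + t) ^ (b - a - 1) * t ^ (a - 1) := mul_comm _ _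
      _ ≤ N.factorial / (x / 2) ^ N * (Real.exp (x / 2) * Real.exp (x / 2 * t)) * t ^ (a - 1) := by
        gcongr
      _ = _ := by ring

lemma cylinderWeight_laplaceWeight {r : ℝ} (hr : 0 < r) :
    LaplaceWeight univ (cylinderWeight r) := by
  refine LaplaceWeight.of_bound (s := r) isOpen_univ isUpperSet_univ (fun t ht => ?_) ?_ hr
    fun x _ => ⟨x - 1, by linarith, Real.exp ((x - 1) ^ 2 / 2), fun t ht => ?_⟩
  · rw [cylinderWeight]; positivity
  · refine ContinuousOn.mul (by fun_prop) ?_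
    exact continuousOn_id.rpow_const fun t ht => Or.inl (ne_of_gt ht)
  · rw [cylinderWeight, ← mul_assoc, ← Real.exp_add]
    gcongr
    -- Completing the square: `-t²/2 ≤ (x-1)²/2 + (x-1)t`, which is where the constant comes from.
    nlinarith [sq_nonneg (t + (x - 1))]

/-! ### Monotone quotients of weights: `e^{-(c₂-c₁)/t}`, `(t/(1+t))^(a₂-a₁)`, `t^(r₂-r₁)` -/

lemma besselWeight_ratio {μ c₁ c₂ : ℝ} (hc : c₁ < c₂) (s t : ℝ) (hs : 0 < s) (hst : s < t) :
    besselWeight μ c₂ s * besselWeight μ c₁ t ≤ besselWeight μ c₁ s * besselWeight μ c₂ t := by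
  have ht : 0 < t := hs.trans hst
  have h1 : Real.exp (-c₂ / s) * Real.exp (-c₁ / t) ≤ Real.exp (-c₁ / s) * Real.exp (-c₂ / t) := by
    rw [← Real.exp_add, ← Real.exp_add, Real.exp_le_exp]
    have h2 : (c₂ - c₁) / t ≤ (c₂ - c₁) / s :=
      div_le_div_of_nonneg_left (sub_pos.2 hc).le hs hst.le
    rw [sub_div, sub_div] at h2
    simp only [neg_div]
    linarith
  simp only [besselWeight]
  calc _ = Real.exp (-c₂ / s) * Real.exp (-c₁ / t) * (s ^ (μ - 1) * t ^ (μ - 1)) := by ring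
    _ ≤ Real.exp (-c₁ / s) * Real.exp (-c₂ / t) * (s ^ (μ - 1) * t ^ (μ - 1)) := by gcongr
    _ = _ := by ring

lemma tricomiWeight_ratio {b a₁ a₂ : ℝ} (ha : a₁ < a₂) (s t : ℝ) (hs : 0 < s) (hst : s < t) :
    tricomiWeight b a₂ s * tricomiWeight b a₁ t ≤
      tricomiWeight b a₁ s * tricomiWeight b a₂ t := by
  have ht : 0 < t := hs.trans hst
  have hs1 : 0 < 1 + s := by linarith
  have ht1 : 0 < 1 + t := by linarith
  have key : s ^ (a₂ - a₁) * (1 + t) ^ (a₂ - a₁) ≤ (1 + s) ^ (a₂ - a₁) * t ^ (a₂ - a₁) := by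
    rw [← Real.mul_rpow hs.le ht1.le, ← Real.mul_rpow hs1.le ht.le]
    exact Real.rpow_le_rpow (by positivity) (by nlinarith) (sub_pos.2 ha).le
  have e1 : ∀ y : ℝ, 0 < y → y ^ (a₂ - 1) = y ^ (a₁ - 1) * y ^ (a₂ - a₁) := fun y hy => by
    rw [← Real.rpow_add hy]; ring_nf
  have e2 : ∀ y : ℝ, 0 < y → y ^ (b - a₁ - 1) = y ^ (b - a₂ - 1) * y ^ (a₂ - a₁) := fun y hy => by
    rw [← Real.rpow_add hy]; ring_nf
  simp only [tricomiWeight]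
  rw [e1 s hs, e1 t ht, e2 _ hs1, e2 _ ht1]
  calc _ = s ^ (a₁ - 1) * (1 + s) ^ (b - a₂ - 1) * t ^ (a₁ - 1) * (1 + t) ^ (b - a₂ - 1) *
        (s ^ (a₂ - a₁) * (1 + t) ^ (a₂ - a₁)) := by ring
    _ ≤ s ^ (a₁ - 1) * (1 + s) ^ (b - a₂ - 1) * t ^ (a₁ - 1) * (1 + t) ^ (b - a₂ - 1) *
        ((1 + s) ^ (a₂ - a₁) * t ^ (a₂ - a₁)) := by gcongr
    _ = _ := by ring

lemma cylinderWeight_ratio {r₁ r₂ : ℝ} (hr : r₁ < r₂) (s t : ℝ) (hs : 0 < s) (hst : s < t) :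
    cylinderWeight r₂ s * cylinderWeight r₁ t ≤ cylinderWeight r₁ s * cylinderWeight r₂ t := by
  have ht : 0 < t := hs.trans hst
  have e1 : ∀ y : ℝ, 0 < y → y ^ (r₂ - 1) = y ^ (r₁ - 1) * y ^ (r₂ - r₁) := fun y hy => by
    rw [← Real.rpow_add hy]; ring_nf
  have key : s ^ (r₂ - r₁) ≤ t ^ (r₂ - r₁) := Real.rpow_le_rpow hs.le hst.le (sub_pos.2 hr).le
  simp only [cylinderWeight]
  rw [e1 s hs, e1 t ht]
  calc _ = Real.exp (-s ^ 2 / 2) * s ^ (r₁ - 1) * (Real.exp (-t ^ 2 / 2) * t ^ (r₁ - 1)) *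
        s ^ (r₂ - r₁) := by ring
    _ ≤ Real.exp (-s ^ 2 / 2) * s ^ (r₁ - 1) * (Real.exp (-t ^ 2 / 2) * t ^ (r₁ - 1)) *
        t ^ (r₂ - r₁) := by gcongr
    _ = _ := by ring

/-! ### The three differential equations, by integration by parts -/

lemma besselWeight_solves {μ c : ℝ} (hμ : 0 < μ) (hc : 0 < c) :
    LaplaceSolves (Ioi 0) (fun x => x) (fun _ => μ + 1) c (besselWeight μ c) := by
  have hw := besselWeight_laplaceWeight hμ hc
  refine hw.solvesOn fun x hx => ?_
  -- The weight satisfies `(t² w)' = (c + (μ+1) t) w`.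
  have h := hw.moment_relation hx (A₁ := 0) (A₂ := 1) (B₀ := c) (B₁ := μ + 1) (B₂ := 0) ?_ ?_
  · linarith
  · intro t ht
    have h1 : HasDerivAt (fun t : ℝ => Real.exp (-c / t)) (Real.exp (-c / t) * (c / t ^ 2)) t := by
      refine HasDerivAt.exp ?_
      refine ((hasDerivAt_inv ht.ne').const_mul (-c)).congr_deriv ?_
      ring
    have h2 : HasDerivAt (fun t : ℝ => 0 * t + 1 * t ^ 2) (2 * t) t := by
      simpa using hasDerivAt_pow 2 t
    refine (h2.mul (h1.mul (hasDerivAt_rpow_div ht (μ - 1)))).congr_deriv ?_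
    simp only [besselWeight, Pi.mul_apply]
    field_simp
    ring
  · refine tendsto_of_tendsto_of_tendsto_of_le_of_le' tendsto_const_nhds
      (tendsto_rpow_nhdsGT_zero (s := μ + 1) (by linarith)) ?_ ?_
    · filter_upwards [self_mem_nhdsWithin] with t ht
      have ht : 0 < t := ht
      have := hw.pos t ht
      positivity
    · filter_upwards [self_mem_nhdsWithin] with t ht
      have ht : 0 < t := ht
      have e : t ^ (μ + 1) = t ^ 2 * t ^ (μ - 1) := by
        rw [← Real.rpow_natCast, ← Real.rpow_add ht]; norm_num; ring_nf
      have h1 : Real.exp (-c / t) ≤ 1 := by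
        rw [Real.exp_le_one_iff, neg_div, neg_nonpos]
        positivity
      rw [e, besselWeight]
      calc _ = t ^ 2 * t ^ (μ - 1) * Real.exp (-c / t) := by ring
        _ ≤ t ^ 2 * t ^ (μ - 1) * 1 := by gcongr
        _ = _ := mul_one _

lemma tricomiWeight_solves {a b : ℝ} (ha : 0 < a) :
    LaplaceSolves (Ioi 0) (fun x => x) (fun x => b - x) a (tricomiWeight b a) := by
  have hw := tricomiWeight_laplaceWeight (b := b) ha
  refine hw.solvesOn fun x hx => ?_
  -- The weight satisfies `((t + t²) w)' = (a + b t) w`.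
  have h := hw.moment_relation hx (A₁ := 1) (A₂ := 1) (B₀ := a) (B₁ := b) (B₂ := 0) ?_ ?_
  · linarith
  · intro t ht
    have ht1 : 0 < 1 + t := by linarith
    have h2 : HasDerivAt (fun t : ℝ => 1 * t + 1 * t ^ 2) (1 + 2 * t) t := by
      refine (((hasDerivAt_id' t).const_mul 1).add ((hasDerivAt_pow 2 t).const_mul 1)).congr_deriv ?_
      simp
    refine (h2.mul ((hasDerivAt_rpow_div ht (a - 1)).mul
      (hasDerivAt_one_add_rpow ht (b - a - 1)))).congr_deriv ?_
    simp only [tricomiWeight, Pi.mul_apply]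
    field_simp
    ring
  · have h1 : Tendsto (fun t : ℝ => t ^ a * (1 + t) ^ (b - a)) (𝓝[>] 0) (𝓝 0) := by
      have h2 : Tendsto (fun t : ℝ => (1 + t) ^ (b - a)) (𝓝[>] 0) (𝓝 ((1 + 0) ^ (b - a))) := by
        refine Tendsto.rpow_const ?_ (Or.inl (by norm_num))
        exact ((continuous_const.add continuous_id).tendsto 0).mono_left nhdsWithin_le_nhds
      simpa using (tendsto_rpow_nhdsGT_zero ha).mul h2
    refine h1.congr' ?_
    filter_upwards [self_mem_nhdsWithin] with t ht
    have ht : 0 < t := ht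
    have ht1 : 0 < 1 + t := by linarith
    have e1 : t ^ a = t * t ^ (a - 1) := by
      rw [Real.rpow_sub_one ht.ne']; field_simp
    have e2 : (1 + t) ^ (b - a) = (1 + t) * (1 + t) ^ (b - a - 1) := by
      rw [Real.rpow_sub_one ht1.ne']; field_simp
    rw [e1, e2, tricomiWeight]
    ring

lemma cylinderWeight_solves {r : ℝ} (hr : 0 < r) :
    LaplaceSolves univ (fun _ => 1) (fun x => -x) r (cylinderWeight r) := by
  have hw := cylinderWeight_laplaceWeight hr
  refine hw.solvesOn fun x hx => ?_
  -- The weight satisfies `(t w)' = (r - t²) w`.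
  have h := hw.moment_relation hx (A₁ := 1) (A₂ := 0) (B₀ := r) (B₁ := 0) (B₂ := -1) ?_ ?_
  · linarith
  · intro t ht
    have h1 : HasDerivAt (fun t : ℝ => Real.exp (-t ^ 2 / 2)) (Real.exp (-t ^ 2 / 2) * (-t)) t := by
      refine HasDerivAt.exp ?_
      refine ((hasDerivAt_pow 2 t).neg.div_const 2).congr_deriv ?_
      simp
      ring
    have h2 : HasDerivAt (fun t : ℝ => 1 * t + 0 * t ^ 2) 1 t := by
      simpa using hasDerivAt_id' t
    refine (h2.mul (h1.mul (hasDerivAt_rpow_div ht (r - 1)))).congr_deriv ?_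
    simp only [cylinderWeight, Pi.mul_apply]
    field_simp
    ring
  · have h2 : Tendsto (fun t : ℝ => Real.exp (-t ^ 2 / 2)) (𝓝[>] 0)
        (𝓝 (Real.exp (-0 ^ 2 / 2))) :=
      (Continuous.tendsto (by fun_prop) 0).mono_left nhdsWithin_le_nhds
    have h1 := (tendsto_rpow_nhdsGT_zero hr).mul h2
    rw [zero_mul] at h1
    refine h1.congr' ?_
    filter_upwards [self_mem_nhdsWithin] with t ht
    have ht : 0 < t := ht
    have e1 : t ^ r = t * t ^ (r - 1) := by
      rw [Real.rpow_sub_one ht.ne']; field_simp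
    rw [e1, cylinderWeight]
    ring

/-! ### Integrating factors of the three equations -/

lemma integratingFactor_bessel (ν : ℝ) :
    IntegratingFactor (Ioi 0) (fun x => x) (fun _ => ν) (fun x => x ^ ν) where
  isOpen := isOpen_Ioi
  isUpperSet := isUpperSet_Ioi 0
  nonempty := nonempty_Ioi
  coeff_pos _ hx := hx
  pos _ hx := Real.rpow_pos_of_pos hx ν
  hasDerivAt _ hx := hasDerivAt_rpow_div hx ν

lemma integratingFactor_kummer (b : ℝ) :
    IntegratingFactor (Ioi 0) (fun x => x) (fun x => b - x)
      (fun x => x ^ b * Real.exp (-x)) where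
  isOpen := isOpen_Ioi
  isUpperSet := isUpperSet_Ioi 0
  nonempty := nonempty_Ioi
  coeff_pos _ hx := hx
  pos _ hx := mul_pos (Real.rpow_pos_of_pos hx b) (Real.exp_pos _)
  hasDerivAt x hx := by
    have hx : 0 < x := hx
    refine ((hasDerivAt_rpow_div hx b).mul (hasDerivAt_neg x).exp).congr_deriv ?_
    field_simp
    ring

lemma integratingFactor_cylinder :
    IntegratingFactor univ (fun _ => 1) (fun x => -x) (fun x => Real.exp (-x ^ 2 / 2)) where
  isOpen := isOpen_univ
  isUpperSet := isUpperSet_univ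
  nonempty := univ_nonempty
  coeff_pos _ _ := one_pos
  pos _ _ := Real.exp_pos _
  hasDerivAt x _ := by
    refine ((hasDerivAt_pow 2 x).neg.div_const 2).exp.congr_deriv ?_
    simp
    ring

/-! ### The power series of the increasing solutions -/

/-- Coefficients of the increasing solution of the squared Bessel equation. -/
def besselCoeff (μ c : ℝ) (k : ℕ) : ℝ := c ^ k / (k.factorial * Real.Gamma (μ + k + 1))

/-- Coefficients of Kummer's function. -/
def kummerCoeff (b a : ℝ) (n : ℕ) : ℝ :=
  (ascPochhammer ℝ n).eval a / (ascPochhammer ℝ n).eval b / n.factorial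

lemma besselCoeff_entire {μ c : ℝ} (hμ : 0 < μ) (hc : 0 < c) :
    EntireSeries (besselCoeff μ c) (fun n => c / (μ + n + 1)) (c / (μ + 1)) where
  zero_pos := by
    have := Real.Gamma_pos_of_pos (show 0 < μ + 1 by linarith)
    simp only [besselCoeff, pow_zero, Nat.factorial_zero, Nat.cast_one, Nat.cast_zero, add_zero,
      one_mul]
    positivity
  ratio_pos n := by positivity
  ratio_le n := by
    have : (0 : ℝ) ≤ n := by positivity
    gcongr
    linarith
  ratio n := by
    have h1 : 0 < μ + n + 1 := by positivity
    have h2 := Real.Gamma_add_one h1.ne'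
    have h3 := (Real.Gamma_pos_of_pos h1).ne'
    simp only [derivCoeff, besselCoeff, Nat.factorial_succ]
    push_cast
    rw [show μ + ((n : ℝ) + 1) + 1 = μ + n + 1 + 1 by ring, h2]
    field_simp
    ring

lemma kummerCoeff_entire {a b : ℝ} (ha : 0 < a) (hb : 0 < b) :
    EntireSeries (kummerCoeff b a) (fun n => (a + n) / (b + n)) (1 + a / b) where
  zero_pos := by simp [kummerCoeff]
  ratio_pos n := by positivity
  ratio_le n := by
    rw [div_le_iff₀ (by positivity)]
    have h : (1 + a / b) * (b + n) = a + n + (b + a / b * n) := by field_simp; ring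
    rw [h]
    have : 0 ≤ b + a / b * n := by positivity
    linarith
  ratio n := by
    have h1 := ascPochhammer_pos n b hb
    simp only [derivCoeff, kummerCoeff, Nat.factorial_succ, ascPochhammer_succ_eval]
    push_cast
    field_simp

/-- Comparison of coefficients: `(n + μ + 1) q n = c`. -/
lemma besselCoeff_solves {μ c : ℝ} (hμ : 0 < μ) (hc : 0 < c) :
    SeriesSolves (fun x => x) (fun _ => μ + 1) c (besselCoeff μ c) := by
  have h := besselCoeff_entire hμ hc
  refine h.solvesOn fun x _ => ?_
  refine ((h.derivSeries.hasSum_natCast_mul x).add ((h.derivSeries.hasSum x).mul_left (μ + 1))).unique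
    (((h.hasSum x).mul_left c).congr_terms fun n => ?_)
  rw [h.ratio n]
  field_simp
  ring

/-- Comparison of coefficients: `(n + b) q n - n = a`. -/
lemma kummerCoeff_solves {a b : ℝ} (ha : 0 < a) (hb : 0 < b) :
    SeriesSolves (fun x => x) (fun x => b - x) a (kummerCoeff b a) := by
  have h := kummerCoeff_entire ha hb
  refine h.solvesOn fun x _ => ?_
  have h1 := (((h.derivSeries.hasSum_natCast_mul x).add
    ((h.derivSeries.hasSum x).mul_left b)).sub (h.hasSum_natCast_mul x)).unique
    (((h.hasSum x).mul_left a).congr_terms fun n => ?_)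
  · linarith
  · rw [h.ratio n]
    field_simp
    ring

/-! ### The squared Bessel equation at infinity -/

section Bessel

variable {w : ℝ → ℝ} {a qa : ℕ → ℝ} {Ma ν r₁ r₂ : ℝ}

/-- The equation reads `x M₂ = r₂ M₀ + ν M₁`, while `∫ (t-ε)² e^{-xt} w ≥ 0` bounds `M₂` below by
`2ε M₁ - ε² M₀`; for large `x` the terms `ν` and `r₂` are negligible, so `M₁ / M₀` falls below `ε`.
-/
lemma expMoment_one_le_of_bessel (hw : LaplaceWeight (Ioi 0) w)
    (sw : LaplaceSolves (Ioi 0) (fun x => x) (fun _ => ν) r₂ w) {ε : ℝ} (hε : 0 < ε) :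
    ∀ᶠ x in atTop, expMoment w 1 x ≤ ε * expMoment w 0 x := by
  filter_upwards [eventually_gt_atTop 0, eventually_ge_atTop (2 * (ν / ε)),
    eventually_ge_atTop (2 * r₂ / ε ^ 2)] with x hx h1 h2
  have m0 := hw.expMoment_pos 0 hx
  have m1 := hw.expMoment_pos 1 hx
  have h3 := hw.expMoment_two_ge hx ε
  have hode := sw.ode x hx
  have e1 : 2 * ν ≤ ε * x := by
    rw [← mul_div_assoc, div_le_iff₀ hε] at h1; linarith
  have e2 : 2 * r₂ ≤ ε ^ 2 * x := by
    rw [div_le_iff₀ (by positivity)] at h2; linarith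
  have e3 := mul_le_mul_of_nonneg_left h3 hx.le
  have e4 : 3 / 2 * (ε * x) * expMoment w 1 x ≤ 3 / 2 * (ε * x) * (ε * expMoment w 0 x) := by
    nlinarith [mul_le_mul_of_nonneg_right e1 m1.le, mul_le_mul_of_nonneg_right e2 m0.le]
  exact le_of_mul_le_mul_left e4 (by positivity)

/-- Discrete counterpart of the moment bound: `∑ (n - εx)² a n x^n ≥ 0`, expanded via `n² = n(n-1) +
n`. The assumption `ν ≥ 1` lets the equation bound `x² g'' + x g'` by `x r₁ g`. -/
lemma powSeries_deriv_le_of_bessel (hν : 1 ≤ ν) (ha : EntireSeries a qa Ma)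
    (sa : SeriesSolves (fun x => x) (fun _ => ν) r₁ a) {ε : ℝ} (hε : 0 < ε) :
    ∀ᶠ x in atTop, powSeries (derivCoeff a) x ≤ ε * powSeries a x := by
  filter_upwards [eventually_gt_atTop 0, eventually_ge_atTop (r₁ / ε ^ 2)] with x hx h1
  have e1 : r₁ ≤ ε ^ 2 * x := by
    rw [div_le_iff₀ (by positivity)] at h1; linarith
  have g0 := ha.powSeries_pos hx.le
  have g1 := ha.derivSeries.powSeries_pos hx.le
  have hode := sa.ode x hx
  have h2 : 0 ≤ x ^ 2 * powSeries (derivCoeff (derivCoeff a)) x +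
      (1 - 2 * (ε * x)) * (x * powSeries (derivCoeff a) x) + (ε * x) ^ 2 * powSeries a x := by
    refine ((ha.hasSum_natCast_mul_pred x).add ((ha.hasSum_natCast_mul x).mul_left
      (1 - 2 * (ε * x))) |>.add ((ha.hasSum x).mul_left ((ε * x) ^ 2))).nonneg fun n => ?_
    have : 0 ≤ ((n : ℝ) - ε * x) ^ 2 * (a n * x ^ n) := by
      have := (ha.pos n).le
      positivity
    linarith
  have h3 : 2 * (ε * x ^ 2) * powSeries (derivCoeff a) x ≤
      2 * (ε * x ^ 2) * (ε * powSeries a x) := by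
    have e2 : x ^ 2 * powSeries (derivCoeff (derivCoeff a)) x + x * powSeries (derivCoeff a) x ≤
        x * (r₁ * powSeries a x) := by
      rw [← hode]
      nlinarith [mul_le_mul_of_nonneg_right hν (mul_pos hx g1).le]
    have e3 : x * (r₁ * powSeries a x) ≤ x * (ε ^ 2 * x * powSeries a x) := by gcongr
    linarith
  exact le_of_mul_le_mul_left h3 (by positivity)

/-- Since `x^ν W` is nondecreasing, `W` is squeezed between `W(1) x^{-ν}` and `0`; and `x W' = (r₂ -
r₁) g M₀ - ν W` is nonnegative because `W < 0`. -/
lemma bessel_mixed_wronskian_atTop_of_le (hν : 0 < ν) (ha : EntireSeries a qa Ma)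
    (hw : LaplaceWeight (Ioi 0) w) (sa : SeriesSolves (fun x => x) (fun _ => ν) r₁ a)
    (sw : LaplaceSolves (Ioi 0) (fun x => x) (fun _ => ν) r₂ w) (hr : r₁ ≤ r₂) :
    MonotonicLimit (wronskianFn (powSeries a) (expMoment w 0)) atTop 0 (-1) := by
  have hI := integratingFactor_bessel ν
  refine ⟨?_, ?_, Ioi 0, Ioi_mem_atTop 0, Or.inl ?_⟩
  · rw [← EReal.coe_zero, EReal.tendsto_coe]
    have ht : Tendsto (fun x : ℝ => wronskianFn (powSeries a) (expMoment w 0) 1 * (x ^ ν)⁻¹) atTop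
        (𝓝 0) := by
      simpa using (tendsto_inv_atTop_zero.comp (tendsto_rpow_atTop hν)).const_mul
        (wronskianFn (powSeries a) (expMoment w 0) 1)
    refine tendsto_of_tendsto_of_tendsto_of_le_of_le' ht tendsto_const_nhds ?_ ?_
    · filter_upwards [eventually_ge_atTop 1] with x hx
      have hx0 : 0 < x := by linarith
      have h := sa.monotoneOn_weighted_wronskian isOpen_Ioi (convex_Ioi 0) sw hI.coeff_pos
        hI.pos hI.hasDerivAt (fun y hy => ha.powSeries_pos (le_of_lt hy))
        (fun y hy => hw.expMoment_pos 0 hy) hr (mem_Ioi.2 one_pos) (mem_Ioi.2 hx0) hx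
      simp only [Real.one_rpow, one_mul] at h
      rw [← div_eq_mul_inv, div_le_iff₀ (Real.rpow_pos_of_pos hx0 ν)]
      linarith
    · filter_upwards [eventually_gt_atTop 0] with x hx
      exact (mixed_wronskian_neg ha hw sa sw hx).le
  · filter_upwards [eventually_gt_atTop 0] with x hx
    exact Real.sign_of_neg (mixed_wronskian_neg ha hw sa sw hx)
  · refine monotoneOn_of_hasDerivAt_nonneg (convex_Ioi 0)
      (fun x hx => sa.wronskian_hasDerivAt isOpen_Ioi sw hx) fun x hx => ?_
    have hx : 0 < x := hx
    have h := sa.mul_wronskian_deriv sw hx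
    have h1 := mixed_wronskian_neg ha hw sa sw hx
    have h2 := mul_pos (ha.powSeries_pos hx.le) (hw.expMoment_pos 0 hx)
    refine nonneg_of_mul_nonneg_right (a := x) ?_ hx
    nlinarith [mul_nonneg (sub_nonneg.2 hr) h2.le]

lemma bessel_mixed_wronskian_atTop_of_lt (hν : 1 ≤ ν) (ha : EntireSeries a qa Ma)
    (hw : LaplaceWeight (Ioi 0) w) (sa : SeriesSolves (fun x => x) (fun _ => ν) r₁ a)
    (sw : LaplaceSolves (Ioi 0) (fun x => x) (fun _ => ν) r₂ w) (hr : r₂ < r₁) :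
    MonotonicLimit (wronskianFn (powSeries a) (expMoment w 0)) atTop ⊥ (-1) := by
  set W := wronskianFn (powSeries a) (expMoment w 0)
  set W' : ℝ → ℝ := fun x => powSeries a x * expMoment w 2 x -
    expMoment w 0 x * powSeries (derivCoeff (derivCoeff a)) x
  have hdW : ∀ x, 0 < x → HasDerivAt W (W' x) x := fun x hx =>
    sa.wronskian_hasDerivAt isOpen_Ioi sw hx
  have hneg : ∀ x, 0 < x → W x < 0 := fun x hx => mixed_wronskian_neg ha hw sa sw hx
  -- Tuned so that `-W ≤ 2ε g M₀` turns `x W' = (r₂ - r₁) g M₀ - ν W` into `x W' ≤ W`. Then `W / x`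
  -- is nonincreasing, so `W` lies below a line of negative slope.
  set ε := (r₁ - r₂) / (2 * (ν + 1))
  have hε : 0 < ε := div_pos (sub_pos.2 hr) (by linarith)
  have hε2 : 2 * ε * (ν + 1) = r₁ - r₂ := by
    have : ν + 1 ≠ 0 := by linarith
    simp only [ε]
    field_simp
  obtain ⟨X, hX⟩ := eventually_atTop.1 ((expMoment_one_le_of_bessel hw sw hε).and
    ((powSeries_deriv_le_of_bessel hν ha sa hε).and (eventually_gt_atTop 0)))
  have hX0 : 0 < X := (hX X le_rfl).2.2
  have hkey : ∀ x ∈ Ici X, x * W' x ≤ W x := fun x hx => by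
    obtain ⟨h1, h2, hx0⟩ := hX x hx
    have g0 := ha.powSeries_pos hx0.le
    have m0 := hw.expMoment_pos 0 hx0
    have h := sa.mul_wronskian_deriv sw (x := x) hx0
    have h3 : -W x ≤ 2 * ε * (powSeries a x * expMoment w 0 x) := by
      simp only [W]
      rw [mixed_wronskian_eq sa sw hx0]
      nlinarith [mul_le_mul_of_nonneg_left h1 g0.le, mul_le_mul_of_nonneg_left h2 m0.le]
    have h4 : x * W' x = (r₂ - r₁) * (powSeries a x * expMoment w 0 x) - ν * W x := h
    have h5 := mul_le_mul_of_nonneg_left h3 (show 0 ≤ ν + 1 by linarith)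
    have h6 : (ν + 1) * (2 * ε * (powSeries a x * expMoment w 0 x)) =
        (r₁ - r₂) * (powSeries a x * expMoment w 0 x) := by rw [← hε2]; ring
    rw [h4]
    linarith
  refine ⟨?_, ?_, Ici X, Ici_mem_atTop X, Or.inr ?_⟩
  · rw [EReal.tendsto_coe_nhds_bot_iff]
    have hanti : AntitoneOn (fun x => W x / x) (Ici X) := by
      refine antitoneOn_of_hasDerivAt_nonpos (convex_Ici X) (fun x hx =>
        (hdW x (hX x hx).2.2).div (hasDerivAt_id' x) (hX x hx).2.2.ne') fun x hx => ?_
      have := hkey x hx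
      refine div_nonpos_of_nonpos_of_nonneg ?_ (by positivity)
      linarith
    have hc : W X / X < 0 := div_neg_of_neg_of_pos (hneg X hX0) hX0
    refine tendsto_atBot_mono' _ ?_ (tendsto_id.const_mul_atTop_of_neg hc)
    filter_upwards [eventually_ge_atTop X] with x hx
    have hx0 : 0 < x := hX0.trans_le hx
    have h := hanti (mem_Ici.2 le_rfl) (mem_Ici.2 hx) hx
    simp only at h
    rwa [div_le_iff₀ hx0] at h
  · filter_upwards [eventually_gt_atTop 0] with x hx
    exact Real.sign_of_neg (hneg x hx)
  · refine antitoneOn_of_hasDerivAt_nonpos (convex_Ici X)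
      (fun x hx => hdW x (hX x hx).2.2) fun x hx => ?_
    have hx0 := (hX x hx).2.2
    have h1 := hkey x hx
    have h2 := hneg x hx0
    by_contra! h3
    have := mul_pos hx0 h3
    linarith

end Bessel

/-! ### The Ornstein-Uhlenbeck equation -/

section Cylinder

variable {r₁ r₂ : ℝ}

/-- The decreasing canonical solution of `f'' - x f' = r f`. -/
abbrev cylinderSol (r : ℝ) : ℝ → ℝ := expMoment (cylinderWeight r) 0

lemma cylinderSol_neg_solves {r : ℝ} (hr : 0 < r) :
    SolvesOn univ (fun _ => 1) (fun x => -x) r (fun x => cylinderSol r (-x))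
      (fun x => expMoment (cylinderWeight r) 1 (-x))
      (fun x => expMoment (cylinderWeight r) 2 (-x)) where
  deriv_one x _ := by
    have h := ((cylinderWeight_solves hr).deriv_one (-x) (mem_univ _)).comp x (hasDerivAt_neg x)
    exact h.congr_deriv (by ring)
  deriv_two x _ := by
    have h := ((cylinderWeight_solves hr).deriv_two (-x) (mem_univ _)).neg.comp x
      (hasDerivAt_neg x)
    refine (h.congr_deriv (g' := expMoment (cylinderWeight r) 2 (-x)) (by ring)).congr_of_eventuallyEq
      (Eventually.of_forall fun y => ?_)
    simp
  ode x _ := by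
    have h := (cylinderWeight_solves hr).ode (-x) (mem_univ _)
    linarith

lemma cylinder_wronskian_neg_neg (hr₁ : 0 < r₁) (hr₂ : 0 < r₂) (x : ℝ) :
    wronskianFn (fun x => cylinderSol r₁ (-x)) (fun x => cylinderSol r₂ (-x)) x =
      wronskianFn (cylinderSol r₂) (cylinderSol r₁) (-x) := by
  rw [(cylinderSol_neg_solves hr₁).wronskian_eq (cylinderSol_neg_solves hr₂) (mem_univ x),
    (cylinderWeight_solves hr₂).wronskian_eq (cylinderWeight_solves hr₁) (mem_univ (-x))]
  ring

lemma cylinder_mixed_wronskian_eq (hr₁ : 0 < r₁) (hr₂ : 0 < r₂) (x : ℝ) :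
    wronskianFn (fun x => cylinderSol r₁ (-x)) (cylinderSol r₂) x =
      -(cylinderSol r₁ (-x) * expMoment (cylinderWeight r₂) 1 x +
        cylinderSol r₂ x * expMoment (cylinderWeight r₁) 1 (-x)) := by
  rw [(cylinderSol_neg_solves hr₁).wronskian_eq (cylinderWeight_solves hr₂) (mem_univ x)]
  ring

/-- Reflection exchanges the two parameters, so the behaviour at `-∞` follows from that at `+∞`. -/
lemma cylinder_mixed_wronskian_neg_arg (hr₁ : 0 < r₁) (hr₂ : 0 < r₂) (x : ℝ) :
    wronskianFn (fun x => cylinderSol r₁ (-x)) (cylinderSol r₂) x =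
      wronskianFn (fun x => cylinderSol r₂ (-x)) (cylinderSol r₁) (-x) := by
  rw [cylinder_mixed_wronskian_eq hr₁ hr₂, cylinder_mixed_wronskian_eq hr₂ hr₁, neg_neg]
  ring

lemma cylinder_mixed_wronskian_atTop (hr₁ : 0 < r₁) (hr₂ : 0 < r₂) :
    MonotonicLimit (wronskianFn (fun x => cylinderSol r₁ (-x)) (cylinderSol r₂)) atTop ⊥ (-1) := by
  have h₁ := cylinderWeight_laplaceWeight hr₁
  have h₂ := cylinderWeight_laplaceWeight hr₂
  have p₁ : ∀ k x, 0 < expMoment (cylinderWeight r₁) k x := fun k x =>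
    h₁.expMoment_pos k (mem_univ x)
  have p₂ : ∀ k x, 0 < expMoment (cylinderWeight r₂) k x := fun k x =>
    h₂.expMoment_pos k (mem_univ x)
  -- The mean `M₁ / M₀` decreases in its argument, so at `-x ≤ 0` it is at least its value `m` at
  -- `0`. Thus `φ⁺` has logarithmic derivative at least `m` on `[0, ∞)`, the analogue of `d` for
  -- series.
  set m := expMoment (cylinderWeight r₁) 1 0 / expMoment (cylinderWeight r₁) 0 0
  have hm : 0 < m := div_pos (p₁ 1 0) (p₁ 0 0)
  have hm1 : ∀ x, 0 ≤ x → m * expMoment (cylinderWeight r₁) 0 (-x) ≤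
      expMoment (cylinderWeight r₁) 1 (-x) := fun x hx =>
    h₁.expMoment_one_ge (mem_univ _) (show -x ≤ 0 by linarith)
      (div_mul_cancel₀ _ (p₁ 0 0).ne').le
  have hneg : ∀ x, wronskianFn (fun x => cylinderSol r₁ (-x)) (cylinderSol r₂) x < 0 := fun x => by
    rw [cylinder_mixed_wronskian_eq hr₁ hr₂, neg_neg_iff_pos]
    exact add_pos (mul_pos (p₁ 0 _) (p₂ 1 _)) (mul_pos (p₂ 0 _) (p₁ 1 _))
  refine ⟨?_, Eventually.of_forall fun x => Real.sign_of_neg (hneg x), Ici (r₂ / m),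
    Ici_mem_atTop _, Or.inr ?_⟩
  · rw [EReal.tendsto_coe_nhds_bot_iff]
    obtain ⟨c, hc, hcx⟩ := h₂.exists_exp_le_expMoment (mem_univ 0) (half_pos hm)
    have hgrow : ∀ x, 0 ≤ x → expMoment (cylinderWeight r₁) 0 0 * Real.exp (m * x) ≤
        expMoment (cylinderWeight r₁) 0 (-x) := fun x hx => by
      have hmono : MonotoneOn (fun y => cylinderSol r₁ (-y) * Real.exp (-m * y)) (Ici 0) := by
        refine monotoneOn_of_hasDerivAt_nonneg (convex_Ici 0) (W' := fun y =>
          (expMoment (cylinderWeight r₁) 1 (-y) - m * cylinderSol r₁ (-y)) * Real.exp (-m * y))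
          (fun y _ => ?_) fun y hy =>
            mul_nonneg (sub_nonneg.2 (hm1 y hy)) (Real.exp_pos _).le
        have e : HasDerivAt (fun y => Real.exp (-m * y)) (Real.exp (-m * y) * (-m * 1)) y :=
          ((hasDerivAt_id y).const_mul (-m)).exp
        refine (((cylinderSol_neg_solves hr₁).deriv_one y (mem_univ _)).mul e).congr_deriv ?_
        ring
      have h := hmono (mem_Ici.2 le_rfl) (mem_Ici.2 hx) hx
      simp only [neg_zero, mul_zero, Real.exp_zero, mul_one] at h
      calc _ ≤ cylinderSol r₁ (-x) * Real.exp (-m * x) * Real.exp (m * x) := by gcongr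
        _ = _ := by rw [mul_assoc, ← Real.exp_add]; simp
    have ht : Tendsto (fun x : ℝ => Real.exp (m / 2 * x)) atTop atTop :=
      Real.tendsto_exp_atTop.comp (tendsto_id.const_mul_atTop (by positivity))
    have hF := p₁ 0 0
    refine tendsto_atBot_mono' _ ?_ (tendsto_neg_atTop_atBot.comp
      (ht.const_mul_atTop (show 0 < c * (m * expMoment (cylinderWeight r₁) 0 0) by positivity)))
    filter_upwards [eventually_ge_atTop 0] with x hx
    rw [cylinder_mixed_wronskian_eq hr₁ hr₂]
    have h4 := (mul_le_mul_of_nonneg_left (hgrow x hx) hm.le).trans (hm1 x hx)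
    have h5 := mul_le_mul (hcx x hx) h4 (by positivity) (p₂ 0 x).le
    have h6 : Real.exp (-(m / 2) * x) * Real.exp (m * x) = Real.exp (m / 2 * x) := by
      rw [← Real.exp_add]; ring_nf
    have h7 : c * Real.exp (-(m / 2) * x) * (m * (expMoment (cylinderWeight r₁) 0 0 *
        Real.exp (m * x))) =
        c * (m * expMoment (cylinderWeight r₁) 0 0) * Real.exp (m / 2 * x) := by
      rw [← h6]; ring
    have h8 := mul_pos (p₁ 0 (-x)) (p₂ 1 x)
    simp only [Function.comp_apply]
    linarith
  · refine antitoneOn_of_hasDerivAt_nonpos (convex_Ici _) (fun x _ =>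
      (cylinderSol_neg_solves hr₁).wronskian_hasDerivAt isOpen_univ (cylinderWeight_solves hr₂)
        (mem_univ x)) fun x hx => ?_
    have hx0 : 0 ≤ x := (div_pos hr₂ hm).le.trans hx
    have hxm : r₂ ≤ x * m := by rw [← div_le_iff₀ hm]; exact hx
    have o1 := (cylinderSol_neg_solves hr₁).ode x (mem_univ x)
    have o2 := (cylinderWeight_solves hr₂).ode x (mem_univ x)
    have e1 : expMoment (cylinderWeight r₂) 2 x ≤ r₂ * expMoment (cylinderWeight r₂) 0 x := by
      nlinarith [mul_nonneg hx0 (p₂ 1 x).le]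
    have e2 : r₂ * expMoment (cylinderWeight r₁) 0 (-x) ≤
        expMoment (cylinderWeight r₁) 2 (-x) := by
      calc r₂ * expMoment (cylinderWeight r₁) 0 (-x)
          ≤ x * m * expMoment (cylinderWeight r₁) 0 (-x) := by
            have := (p₁ 0 (-x)).le
            gcongr
        _ = x * (m * expMoment (cylinderWeight r₁) 0 (-x)) := by ring
        _ ≤ x * expMoment (cylinderWeight r₁) 1 (-x) := by
            have := hm1 x hx0
            gcongr
        _ ≤ _ := by
            have := mul_pos hr₁ (p₁ 0 (-x))
            linarith
    have e3 := mul_le_mul_of_nonneg_left e1 (p₁ 0 (-x)).le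
    have e4 := mul_le_mul_of_nonneg_left e2 (p₂ 0 x).le
    linarith

end Cylinder

/-! ### The fundamental solutions in canonical form -/

/-- The Macdonald function as a Laplace transform. -/
lemma expMoment_besselWeight {μ c x : ℝ} (hμ : 0 < μ) (hc : 0 < c) (hx : 0 < x) :
    expMoment (besselWeight μ c) 0 x = 2 * (c / x) ^ (μ / 2) * besselK μ (2 * √(c * x)) := by
  have hcx : 0 < c / x := by positivity
  -- The shift in `t = e^{s+τ}` balances the two exponents: `x t` and `c / t` become `√(cx) e^s` and
  -- `√(cx) e^{-s}`, with sum `z cosh s`.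
  set τ := Real.log (c / x) / 2
  have hτ2 : Real.exp τ * Real.exp τ = c / x := by
    rw [← Real.exp_add, show τ + τ = Real.log (c / x) by simp only [τ]; ring, Real.exp_log hcx]
  have hy : √(c * x) = x * Real.exp τ := by
    rw [Real.sqrt_eq_iff_mul_self_eq (by positivity) (by positivity),
      show x * Real.exp τ * (x * Real.exp τ) = x ^ 2 * (Real.exp τ * Real.exp τ) by ring, hτ2]
    field_simp
  have hy' : √(c * x) * Real.exp τ = c := by
    rw [hy, mul_assoc, hτ2]
    field_simp
  set z := 2 * √(c * x)
  set G : ℝ → ℝ := fun t => Real.exp (-x * t) * (t ^ 0 * besselWeight μ c t)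
  set f : ℝ → ℝ := fun t => Real.exp (t + τ)
  set h : ℝ → ℝ := fun t => Real.exp (-z * Real.cosh t) * Real.exp (μ * t)
  have himg : f '' univ = Ioi 0 := by
    rw [image_univ, ← Real.range_exp]
    exact (Equiv.addRight τ).surjective.range_comp Real.exp
  have hd : ∀ t ∈ (univ : Set ℝ), HasDerivWithinAt f (f t) univ t := fun t _ => by
    have := ((hasDerivAt_id' t).add_const τ).exp
    simp only [mul_one] at this
    exact this.hasDerivWithinAt
  have hinj : InjOn f univ := fun s _ t _ hst => by
    have := Real.exp_injective hst
    linarith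
  have hpt : ∀ t, |f t| • G (f t) = Real.exp (τ * μ) * h t := fun t => by
    have hf : 0 < f t := Real.exp_pos _
    have e0 : f t ^ (μ - 1) = Real.exp ((t + τ) * μ) / f t := by
      rw [Real.rpow_sub_one hf.ne', ← Real.exp_mul]
    have e1 : x * f t = √(c * x) * Real.exp t := by
      simp only [f]
      rw [hy, Real.exp_add]; ring
    have e2 : c / f t = √(c * x) * Real.exp (-t) := by
      rw [div_eq_iff hf.ne']
      calc c = √(c * x) * Real.exp τ := hy'.symm
        _ = √(c * x) * (Real.exp (-t) * f t) := by
          simp only [f]; rw [← Real.exp_add]; ring_nf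
        _ = _ := by ring
    simp only [G, besselWeight, smul_eq_mul, pow_zero, one_mul, abs_of_pos hf, h]
    rw [e0, neg_mul, e1, neg_div, e2, ← Real.exp_add (-z * Real.cosh t), ← Real.exp_add (τ * μ)]
    rw [show f t * (Real.exp (-(√(c * x) * Real.exp t)) * (Real.exp (-(√(c * x) * Real.exp (-t))) *
      (Real.exp ((t + τ) * μ) / f t))) = Real.exp (-(√(c * x) * Real.exp t)) *
      (Real.exp (-(√(c * x) * Real.exp (-t))) * Real.exp ((t + τ) * μ)) by field_simp,
      ← Real.exp_add, ← Real.exp_add, Real.cosh_eq]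
    congr 1
    simp only [z]
    ring
  have hGint : IntegrableOn G (Ioi 0) :=
    (besselWeight_laplaceWeight hμ hc).integrable_moment 0 hx
  have hhint : Integrable h := by
    rw [← himg, integrableOn_image_iff_integrableOn_abs_deriv_smul MeasurableSet.univ hd hinj,
      integrableOn_univ] at hGint
    simp only [hpt] at hGint
    have := hGint.const_mul (Real.exp (τ * μ))⁻¹
    simpa only [inv_mul_cancel_left₀ (Real.exp_pos (τ * μ)).ne'] using this
  have e3 : expMoment (besselWeight μ c) 0 x = Real.exp (τ * μ) * ∫ t, h t := by
    have : expMoment (besselWeight μ c) 0 x = ∫ t in f '' univ, G t := by rw [himg]; rfl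
    rw [this, integral_image_eq_integral_abs_deriv_smul MeasurableSet.univ hd hinj,
      setIntegral_univ]
    simp only [hpt]
    rw [integral_const_mul]
  have e4 : ∫ t, h t = 2 * besselK μ z := by
    -- Adding the reflected integral turns `e^{μt}` into `2 cosh(μt)`; evenness then folds the line
    -- onto the half-line defining `besselK`.
    have hsum : (∫ t, h t) + ∫ t, h (-t) =
        ∫ t, 2 * (Real.exp (-z * Real.cosh |t|) * Real.cosh (μ * |t|)) := by
      rw [← integral_add hhint hhint.comp_neg]
      congr 1
      ext t
      have : Real.cosh (μ * |t|) = Real.cosh (μ * t) := by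
        rw [← Real.cosh_abs (μ * t), abs_mul, abs_of_pos hμ]
      rw [this, Real.cosh_abs, Real.cosh_eq (μ * t)]
      simp only [h, Real.cosh_neg, mul_neg]
      ring
    rw [integral_neg_eq_self h, integral_const_mul,
      integral_comp_abs (f := fun t => Real.exp (-z * Real.cosh t) * Real.cosh (μ * t))] at hsum
    rw [besselK]
    linarith
  rw [e3, e4, Real.rpow_def_of_pos hcx]
  have : Real.log (c / x) * (μ / 2) = τ * μ := by simp only [τ]; ring
  rw [this]
  ring

lemma two_mul_sqrt_div {nu0 ρ x : ℝ} (hnu : 0 < nu0) :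
    2 * √(2 * ρ * x) / nu0 = 2 * √(2 * ρ / nu0 ^ 2 * x) := by
  rw [show 2 * ρ / nu0 ^ 2 * x = 2 * ρ * x / nu0 ^ 2 by ring, Real.sqrt_div' _ (by positivity),
    Real.sqrt_sq hnu.le]
  ring

lemma sqbMinus_eq {lam0 nu0 ρ x : ℝ} (hnu : 0 < nu0) (hμ : 0 < indexMu lam0 nu0) (hρ : 0 < ρ)
    (hx : 0 < x) : sqbMinus lam0 nu0 ρ x = (2 * ρ / nu0 ^ 2) ^ (-indexMu lam0 nu0 / 2) / 2 *
      expMoment (besselWeight (indexMu lam0 nu0) (2 * ρ / nu0 ^ 2)) 0 x := by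
  have hc : 0 < 2 * ρ / nu0 ^ 2 := by positivity
  rw [expMoment_besselWeight hμ hc hx, sqbMinus, two_mul_sqrt_div hnu]
  generalize besselK _ _ = B
  generalize indexMu lam0 nu0 = μ
  set c := 2 * ρ / nu0 ^ 2
  have hcp : 0 < c ^ (μ / 2) := by positivity
  have hxp : 0 < x ^ (μ / 2) := by positivity
  rw [neg_div, Real.rpow_neg hx.le, Real.rpow_neg hc.le, Real.div_rpow hc.le hx.le]
  field_simp

lemma sqbPlus_eq {lam0 nu0 ρ x : ℝ} (hnu : 0 < nu0) (hρ : 0 < ρ)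
    (hx : 0 < x) : sqbPlus lam0 nu0 ρ x = (2 * ρ / nu0 ^ 2) ^ (indexMu lam0 nu0 / 2) *
      powSeries (besselCoeff (indexMu lam0 nu0) (2 * ρ / nu0 ^ 2)) x := by
  set μ := indexMu lam0 nu0
  have hc : 0 < 2 * ρ / nu0 ^ 2 := by positivity
  rw [sqbPlus, two_mul_sqrt_div hnu, besselI]
  set c := 2 * ρ / nu0 ^ 2
  have h1 : 2 * √(c * x) / 2 = (c * x) ^ (1 / 2 : ℝ) := by
    rw [← Real.sqrt_eq_rpow]; ring
  have h2 : (2 * √(c * x)) ^ 2 / 4 = c * x := by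
    rw [mul_pow, Real.sq_sqrt (by positivity)]; ring
  have hcx : 0 < c * x := by positivity
  have h3 : x ^ (-μ / 2) * (c * x) ^ (μ / 2) = c ^ (μ / 2) := by
    have hxp : 0 < x ^ (μ / 2) := by positivity
    rw [Real.mul_rpow hc.le hx.le, neg_div, Real.rpow_neg hx.le]
    field_simp
  rw [h1, h2, ← Real.rpow_mul hcx.le, show 1 / 2 * indexMu lam0 nu0 = μ / 2 by simp only [μ]; ring,
    ← mul_assoc, h3]
  congr 1
  refine tsum_congr fun k => ?_
  rw [besselCoeff, mul_pow]
  ring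

lemma cirPlus_eq (lam0 lam1 nu0 ρ x : ℝ) : cirPlus lam0 lam1 nu0 ρ x =
    powSeries (kummerCoeff (indexMu lam0 nu0 + 1) (ρ / lam1)) (kappaParam lam1 nu0 * x) := by
  refine tsum_congr fun n => ?_
  rw [kummerCoeff]
  ring

lemma cirMinus_eq (lam0 lam1 nu0 ρ x : ℝ) : cirMinus lam0 lam1 nu0 ρ x =
    1 / Real.Gamma (ρ / lam1) * expMoment (tricomiWeight (indexMu lam0 nu0 + 1) (ρ / lam1)) 0
      (kappaParam lam1 nu0 * x) := by
  simp only [cirMinus, kummerU, expMoment, tricomiWeight, pow_zero, one_mul, mul_assoc]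

lemma ouBase_eq {lam1 nu0 : ℝ} (hlam1 : 0 < lam1) (ρ y : ℝ) : ouBase lam1 nu0 ρ y =
    1 / Real.Gamma (ρ / lam1) * cylinderSol (ρ / lam1) (√(kappaParam lam1 nu0) * y) := by
  have hκ : 0 ≤ kappaParam lam1 nu0 := by rw [kappaParam]; positivity
  rw [ouBase, parabolicDNeg, mul_pow, Real.sq_sqrt hκ, ← mul_assoc, ← mul_div_assoc,
    ← Real.exp_add, show kappaParam lam1 nu0 * y ^ 2 / 4 + -(kappaParam lam1 nu0 * y ^ 2) / 4 = 0 by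
      ring, Real.exp_zero]
  congr 1
  refine integral_congr_ae (ae_of_all _ fun t => ?_)
  simp only [cylinderWeight, pow_zero, one_mul]
  rw [← mul_assoc, ← Real.exp_add]
  ring_nf

/-! ### Transport to the original variables -/

/-- The Wronskian acquires only the positive factor `K * L * a`, so signs and monotonicity pass to
the original variable. -/
lemma MonotonicLimit.rescale {D : Set ℝ} {φ ψ F G : ℝ → ℝ} {K L a b : ℝ} {l l' : Filter ℝ}
    {E : EReal} {σ : ℝ} (h : MonotonicLimit (wronskianFn F G) l' E σ) (hD : IsOpen D)
    (hK : 0 < K) (hL : 0 < L) (ha : 0 < a) (hφ : ∀ y ∈ D, φ y = K * F (a * y + b))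
    (hψ : ∀ y ∈ D, ψ y = L * G (a * y + b)) (hF : ∀ y ∈ D, DifferentiableAt ℝ F (a * y + b))
    (hG : ∀ y ∈ D, DifferentiableAt ℝ G (a * y + b)) (hDl : D ∈ l)
    (hl : Tendsto (fun y => a * y + b) l l') :
    MonotonicLimit (wronskianFn φ ψ) l ((K * L * a : ℝ) * E) σ := by
  refine h.comp_scale (A := fun y => a * y + b) (by positivity) (Or.inl fun x y hxy => ?_) hl ?_
  · simp only
    gcongr
  · filter_upwards [hDl] with x hx
    exact wronskianFn_rescale (eventually_of_mem (hD.mem_nhds hx) hφ)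
      (eventually_of_mem (hD.mem_nhds hx) hψ) (hF x hx).hasDerivAt (hG x hx).hasDerivAt

lemma MonotonicLimit.exists_rescale {D : Set ℝ} {φ ψ F G : ℝ → ℝ} {K L a b : ℝ}
    {l l' : Filter ℝ} {σ : ℝ}
    (h : ∃ C : ℝ, 0 < C ∧ MonotonicLimit (wronskianFn F G) l' (C : EReal) σ) (hD : IsOpen D)
    (hK : 0 < K) (hL : 0 < L) (ha : 0 < a) (hφ : ∀ y ∈ D, φ y = K * F (a * y + b))
    (hψ : ∀ y ∈ D, ψ y = L * G (a * y + b)) (hF : ∀ y ∈ D, DifferentiableAt ℝ F (a * y + b))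
    (hG : ∀ y ∈ D, DifferentiableAt ℝ G (a * y + b)) (hDl : D ∈ l)
    (hl : Tendsto (fun y => a * y + b) l l') :
    ∃ C : ℝ, 0 < C ∧ MonotonicLimit (wronskianFn φ ψ) l (C : EReal) σ := by
  obtain ⟨C, hC, h⟩ := h
  refine ⟨K * L * a * C, by positivity, ?_⟩
  rw [EReal.coe_mul (K * L * a) C]
  exact h.rescale hD hK hL ha hφ hψ hF hG hDl hl

lemma differentiableOn_rescale {D : Set ℝ} {φ F : ℝ → ℝ} {K a b : ℝ}
    (hφ : ∀ y ∈ D, φ y = K * F (a * y + b)) (hF : ∀ y ∈ D, DifferentiableAt ℝ F (a * y + b)) :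
    DifferentiableOn ℝ φ D := by
  refine DifferentiableOn.congr (f := fun y => K * F (a * y + b)) (fun y hy => ?_) hφ
  have h1 : DifferentiableAt ℝ (fun y => a * y + b) y := by fun_prop
  exact (((hF y hy).comp y h1).const_mul K).differentiableWithinAt

lemma LaplaceWeight.differentiableAt {D : Set ℝ} {w : ℝ → ℝ} (h : LaplaceWeight D w) {x : ℝ}
    (hx : x ∈ D) : DifferentiableAt ℝ (expMoment w 0) x :=
  (h.hasDerivAt_expMoment 0 hx).differentiableAt

lemma eventually_mem_Ioi_and_le (x₀ : ℝ) (hx₀ : x₀ ∈ Ioi (0 : ℝ)) :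
    ∀ᶠ x in 𝓝[>] (0 : ℝ), x ∈ Ioi (0 : ℝ) ∧ x ≤ x₀ := by
  filter_upwards [Ioc_mem_nhdsGT hx₀] with x hx using hx

lemma tendsto_rescale_nhdsGT {k : ℝ} (hk : 0 < k) :
    Tendsto (fun y : ℝ => k * y + 0) (𝓝[>] 0) (𝓝[>] 0) := by
  refine tendsto_nhdsWithin_iff.2 ⟨?_, ?_⟩
  · have : Tendsto (fun y : ℝ => k * y + 0) (𝓝 0) (𝓝 (k * 0 + 0)) :=
      Continuous.tendsto (by fun_prop) 0
    simp only [mul_zero, add_zero] at this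
    simpa using this.mono_left nhdsWithin_le_nhds
  · filter_upwards [self_mem_nhdsWithin] with y hy
    have hy : 0 < y := hy
    simp only [mem_Ioi, add_zero]
    positivity

lemma tendsto_rescale_atTop {k : ℝ} (hk : 0 < k) (b : ℝ) :
    Tendsto (fun y : ℝ => k * y + b) atTop atTop :=
  tendsto_atTop_add_const_right _ b (tendsto_id.const_mul_atTop hk)

lemma tendsto_rescale_atBot {k : ℝ} (hk : 0 < k) (b : ℝ) :
    Tendsto (fun y : ℝ => k * y + b) atBot atBot :=
  tendsto_atBot_add_const_right _ b (tendsto_id.const_mul_atBot hk)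

lemma indexMu_pos {lam0 nu0 : ℝ} (hnu : 0 < nu0) (hlam : nu0 ^ 2 / 2 < lam0) :
    0 < indexMu lam0 nu0 := by
  rw [indexMu, sub_pos, lt_div_iff₀ (by positivity)]
  linarith

lemma pos_real_mul_top {k : ℝ} (hk : 0 < k) : (k : EReal) * ⊤ = ⊤ := EReal.coe_mul_top_of_pos hk

lemma pos_real_mul_bot {k : ℝ} (hk : 0 < k) : (k : EReal) * ⊥ = ⊥ := EReal.coe_mul_bot_of_pos hk

/-! ### Squared Bessel diffusion -/

theorem sqb_wronskians {ρ₁ ρ₂ : ℝ} (hρ₁ : 0 < ρ₁) (hρ₂ : 0 < ρ₂) {lam0 nu0 : ℝ} (hnu : 0 < nu0)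
    (hlam : nu0 ^ 2 / 2 < lam0) :
    (∀ ρ : ℝ, 0 < ρ → DifferentiableOn ℝ (sqbPlus lam0 nu0 ρ) (Ioi 0) ∧
        DifferentiableOn ℝ (sqbMinus lam0 nu0 ρ) (Ioi 0)) ∧
      (∃ C : ℝ, 0 < C ∧ MonotonicLimit (wronskianFn (sqbPlus lam0 nu0 ρ₁) (sqbPlus lam0 nu0 ρ₂))
        (𝓝[>] 0) ((Real.sign (ρ₂ - ρ₁) * C : ℝ) : EReal) (Real.sign (ρ₂ - ρ₁))) ∧
      MonotonicLimit (wronskianFn (sqbPlus lam0 nu0 ρ₁) (sqbPlus lam0 nu0 ρ₂)) atTop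
        ((Real.sign (ρ₂ - ρ₁) : EReal) * ⊤) (Real.sign (ρ₂ - ρ₁)) ∧
      MonotonicLimit (wronskianFn (sqbMinus lam0 nu0 ρ₁) (sqbMinus lam0 nu0 ρ₂)) (𝓝[>] 0)
        ((Real.sign (ρ₁ - ρ₂) : EReal) * ⊤) (Real.sign (ρ₁ - ρ₂)) ∧
      MonotonicLimit (wronskianFn (sqbMinus lam0 nu0 ρ₁) (sqbMinus lam0 nu0 ρ₂)) atTop 0
        (Real.sign (ρ₁ - ρ₂)) ∧
      MonotonicLimit (wronskianFn (sqbPlus lam0 nu0 ρ₁) (sqbMinus lam0 nu0 ρ₂)) (𝓝[>] 0) ⊥ (-1) ∧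
      (ρ₁ ≤ ρ₂ → MonotonicLimit (wronskianFn (sqbPlus lam0 nu0 ρ₁) (sqbMinus lam0 nu0 ρ₂)) atTop
        0 (-1)) ∧
      (ρ₂ < ρ₁ → MonotonicLimit (wronskianFn (sqbPlus lam0 nu0 ρ₁) (sqbMinus lam0 nu0 ρ₂)) atTop
        ⊥ (-1)) := by
  have hμ := indexMu_pos hnu hlam
  set μ := indexMu lam0 nu0
  set c : ℝ → ℝ := fun ρ => 2 * ρ / nu0 ^ 2
  have hc : ∀ {ρ}, 0 < ρ → 0 < c ρ := fun h => by simp only [c]; positivity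
  have hcc : ∀ {ρ ρ'}, ρ < ρ' → c ρ < c ρ' := fun h => by simp only [c]; gcongr
  have hcc' : ∀ {ρ ρ'}, ρ ≤ ρ' → c ρ ≤ c ρ' := fun h => by simp only [c]; gcongr
  have hI := integratingFactor_bessel (μ + 1)
  have hp : Tendsto (fun x : ℝ => x ^ (μ + 1)) (𝓝[>] 0) (𝓝 0) :=
    tendsto_rpow_nhdsGT_zero (by linarith)
  have eP : ∀ {ρ}, 0 < ρ → ∀ y ∈ Ioi (0 : ℝ), sqbPlus lam0 nu0 ρ y =
      (c ρ) ^ (μ / 2) * powSeries (besselCoeff μ (c ρ)) (1 * y + 0) := fun h y hy => by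
    rw [one_mul, add_zero]; exact sqbPlus_eq hnu h hy
  have eM : ∀ {ρ}, 0 < ρ → ∀ y ∈ Ioi (0 : ℝ), sqbMinus lam0 nu0 ρ y =
      (c ρ) ^ (-μ / 2) / 2 * expMoment (besselWeight μ (c ρ)) 0 (1 * y + 0) := fun h y hy => by
    rw [one_mul, add_zero]; exact sqbMinus_eq hnu hμ h hy
  have kP : ∀ {ρ}, 0 < ρ → 0 < (c ρ) ^ (μ / 2) := fun h => Real.rpow_pos_of_pos (hc h) _
  have kM : ∀ {ρ}, 0 < ρ → 0 < (c ρ) ^ (-μ / 2) / 2 := fun h =>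
    half_pos (Real.rpow_pos_of_pos (hc h) _)
  have iP : ∀ {ρ}, 0 < ρ → EntireSeries (besselCoeff μ (c ρ)) _ _ := fun h =>
    besselCoeff_entire hμ (hc h)
  have iM : ∀ {ρ}, 0 < ρ → LaplaceWeight (Ioi 0) (besselWeight μ (c ρ)) := fun h =>
    besselWeight_laplaceWeight hμ (hc h)
  have sP : ∀ {ρ}, 0 < ρ → SeriesSolves (fun x => x) (fun _ => μ + 1) (c ρ)
    (besselCoeff μ (c ρ)) := fun h => besselCoeff_solves hμ (hc h)
  have sM : ∀ {ρ}, 0 < ρ → LaplaceSolves (Ioi 0) (fun x => x) (fun _ => μ + 1) (c ρ)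
    (besselWeight μ (c ρ)) := fun h => besselWeight_solves hμ (hc h)
  have dP : ∀ {ρ}, 0 < ρ → ∀ y ∈ Ioi (0 : ℝ),
      DifferentiableAt ℝ (powSeries (besselCoeff μ (c ρ))) (1 * y + 0) := fun h y _ =>
    ((iP h).hasDerivAt _).differentiableAt
  have dM : ∀ {ρ}, 0 < ρ → ∀ y ∈ Ioi (0 : ℝ),
      DifferentiableAt ℝ (expMoment (besselWeight μ (c ρ)) 0) (1 * y + 0) := fun h y hy =>
    (iM h).differentiableAt (by simpa using hy)
  have hq : ∀ {ρ ρ'}, ρ < ρ' → ∀ n : ℕ, c ρ / (μ + n + 1) < c ρ' / (μ + n + 1) := fun h n => by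
    have := hcc h
    gcongr
  have t0 := tendsto_rescale_nhdsGT one_pos
  have tt := tendsto_rescale_atTop one_pos 0
  have D0 : Ioi (0 : ℝ) ∈ 𝓝[>] (0 : ℝ) := self_mem_nhdsWithin
  have Dt : Ioi (0 : ℝ) ∈ atTop := Ioi_mem_atTop 0
  -- The limits `0`, `⊤`, `⊥` are fixed by positive factors; only the finite nonzero limit at `0`
  -- needs its constant adjusted.
  have tr : ∀ {φ ψ F G : ℝ → ℝ} {K L : ℝ} {l : Filter ℝ} {E : EReal} {σ : ℝ},
      MonotonicLimit (wronskianFn F G) l E σ → 0 < K → 0 < L →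
      (∀ y ∈ Ioi (0 : ℝ), φ y = K * F (1 * y + 0)) → (∀ y ∈ Ioi (0 : ℝ), ψ y = L * G (1 * y + 0)) →
      (∀ y ∈ Ioi (0 : ℝ), DifferentiableAt ℝ F (1 * y + 0)) →
      (∀ y ∈ Ioi (0 : ℝ), DifferentiableAt ℝ G (1 * y + 0)) → Ioi (0 : ℝ) ∈ l →
      Tendsto (fun y : ℝ => 1 * y + 0) l l → (∀ k : ℝ, 0 < k → (k : EReal) * E = E) →
      MonotonicLimit (wronskianFn φ ψ) l E σ :=
    fun {φ ψ F G K L l E σ} h hK hL h1 h2 h3 h4 h5 h6 hE => by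
      have := h.rescale isOpen_Ioi hK hL one_pos h1 h2 h3 h4 h5 h6
      rwa [hE _ (by positivity)] at this
  refine ⟨fun ρ h => ⟨differentiableOn_rescale (eP h) (dP h), differentiableOn_rescale (eM h) (dM h)⟩,
    ?_, ?_, ?_, ?_, ?_, ?_, ?_⟩
  · refine MonotonicLimit.exists_sign_pair
      (W := fun a b => wronskianFn (sqbPlus lam0 nu0 a) (sqbPlus lam0 nu0 b))
      (fun a b x => wronskianFn_swap _ _ x) (fun a b ha hab => ?_) hρ₁ hρ₂
    have hb := ha.trans hab
    exact MonotonicLimit.exists_rescale (series_wronskian_zero (iP ha) (iP hb) (hq hab) (sP ha)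
      (sP hb)) isOpen_Ioi (kP ha) (kP hb) one_pos (eP ha) (eP hb) (dP ha) (dP hb) D0 t0
  · refine MonotonicLimit.sign_pair
      (W := fun a b => wronskianFn (sqbPlus lam0 nu0 a) (sqbPlus lam0 nu0 b))
      (fun a b x => wronskianFn_swap _ _ x) (fun a b ha hab => ?_) hρ₁ hρ₂
    have hb := ha.trans hab
    exact tr (series_wronskian_atTop (iP ha) (iP hb) (hq hab) (sP ha) (sP hb)) (kP ha) (kP hb)
      (eP ha) (eP hb) (dP ha) (dP hb) Dt tt fun _ => pos_real_mul_top
  -- For decreasing solutions the sign is that of `ρ₁ - ρ₂`, so both the Wronskian arguments and the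
  -- parameters are swapped.
  · refine MonotonicLimit.sign_pair
      (W := fun a b => wronskianFn (sqbMinus lam0 nu0 b) (sqbMinus lam0 nu0 a))
      (fun a b x => wronskianFn_swap _ _ x) (fun a b ha hab => ?_) hρ₂ hρ₁
    have hb := ha.trans hab
    exact tr (laplace_wronskian_left hI (iM ha) (iM hb) (sM ha) (sM hb) (hcc hab)
      (besselWeight_ratio (hcc hab)) eventually_mem_Ioi_and_le hp) (kM hb) (kM ha)
      (eM hb) (eM ha) (dM hb) (dM ha) D0 t0 fun _ => pos_real_mul_top
  · rw [← mul_zero (Real.sign (ρ₁ - ρ₂) : EReal)]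
    refine MonotonicLimit.sign_pair
      (W := fun a b => wronskianFn (sqbMinus lam0 nu0 b) (sqbMinus lam0 nu0 a))
      (fun a b x => wronskianFn_swap _ _ x) (fun a b ha hab => ?_) hρ₂ hρ₁
    have hb := ha.trans hab
    exact tr (laplace_wronskian_atTop hI (iM ha) (iM hb) (sM ha) (sM hb) (hcc hab)
      (besselWeight_ratio (hcc hab))) (kM hb) (kM ha)
      (eM hb) (eM ha) (dM hb) (dM ha) Dt tt fun _ _ => mul_zero _
  · exact tr (mixed_wronskian_zero hI (iP hρ₁) (iP hρ₂) (iM hρ₂) (sP hρ₁) (sP hρ₂) (sM hρ₂)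
      (hc hρ₂) (Eventually.of_forall fun _ => by linarith) hp) (kP hρ₁) (kM hρ₂) (eP hρ₁) (eM hρ₂)
      (dP hρ₁) (dM hρ₂) D0 t0 fun _ => pos_real_mul_bot
  · exact fun h => tr (bessel_mixed_wronskian_atTop_of_le (by linarith) (iP hρ₁) (iM hρ₂) (sP hρ₁)
      (sM hρ₂) (hcc' h)) (kP hρ₁) (kM hρ₂) (eP hρ₁) (eM hρ₂) (dP hρ₁) (dM hρ₂) Dt tt
      fun _ _ => mul_zero _
  · exact fun h => tr (bessel_mixed_wronskian_atTop_of_lt (by linarith) (iP hρ₁) (iM hρ₂) (sP hρ₁)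
      (sM hρ₂) (hcc h)) (kP hρ₁) (kM hρ₂) (eP hρ₁) (eM hρ₂) (dP hρ₁) (dM hρ₂) Dt tt
      fun _ => pos_real_mul_bot

/-! ### Cox-Ingersoll-Ross diffusion -/

theorem cir_wronskians {ρ₁ ρ₂ : ℝ} (hρ₁ : 0 < ρ₁) (hρ₂ : 0 < ρ₂) {lam0 lam1 nu0 : ℝ}
    (hnu : 0 < nu0) (hlam1 : 0 < lam1) (hlam : nu0 ^ 2 / 2 < lam0) :
    (∀ ρ : ℝ, 0 < ρ → DifferentiableOn ℝ (cirPlus lam0 lam1 nu0 ρ) (Ioi 0) ∧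
        DifferentiableOn ℝ (cirMinus lam0 lam1 nu0 ρ) (Ioi 0)) ∧
      (∃ C : ℝ, 0 < C ∧ MonotonicLimit
        (wronskianFn (cirPlus lam0 lam1 nu0 ρ₁) (cirPlus lam0 lam1 nu0 ρ₂)) (𝓝[>] 0)
        ((Real.sign (ρ₂ - ρ₁) * C : ℝ) : EReal) (Real.sign (ρ₂ - ρ₁))) ∧
      MonotonicLimit (wronskianFn (cirPlus lam0 lam1 nu0 ρ₁) (cirPlus lam0 lam1 nu0 ρ₂)) atTop
        ((Real.sign (ρ₂ - ρ₁) : EReal) * ⊤) (Real.sign (ρ₂ - ρ₁)) ∧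
      MonotonicLimit (wronskianFn (cirMinus lam0 lam1 nu0 ρ₁) (cirMinus lam0 lam1 nu0 ρ₂))
        (𝓝[>] 0) ((Real.sign (ρ₁ - ρ₂) : EReal) * ⊤) (Real.sign (ρ₁ - ρ₂)) ∧
      MonotonicLimit (wronskianFn (cirMinus lam0 lam1 nu0 ρ₁) (cirMinus lam0 lam1 nu0 ρ₂)) atTop 0
        (Real.sign (ρ₁ - ρ₂)) ∧
      MonotonicLimit (wronskianFn (cirPlus lam0 lam1 nu0 ρ₁) (cirMinus lam0 lam1 nu0 ρ₂))
        (𝓝[>] 0) ⊥ (-1) ∧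
      MonotonicLimit (wronskianFn (cirPlus lam0 lam1 nu0 ρ₁) (cirMinus lam0 lam1 nu0 ρ₂)) atTop
        ⊥ (-1) := by
  have hb : 0 < indexMu lam0 nu0 + 1 := by have := indexMu_pos hnu hlam; linarith
  set b := indexMu lam0 nu0 + 1
  set κ := kappaParam lam1 nu0
  have hκ : 0 < κ := by simp only [κ, kappaParam]; positivity
  set α : ℝ → ℝ := fun ρ => ρ / lam1
  have hα : ∀ {ρ}, 0 < ρ → 0 < α ρ := fun h => by simp only [α]; positivity
  have hαα : ∀ {ρ ρ'}, ρ < ρ' → α ρ < α ρ' := fun h => by simp only [α]; gcongr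
  have hI := integratingFactor_kummer b
  have hp : Tendsto (fun x : ℝ => x ^ b * Real.exp (-x)) (𝓝[>] 0) (𝓝 0) := by
    have h2 : Tendsto (fun t : ℝ => Real.exp (-t)) (𝓝[>] 0) (𝓝 (Real.exp (-0))) :=
      (Continuous.tendsto (by fun_prop) 0).mono_left nhdsWithin_le_nhds
    simpa using (tendsto_rpow_nhdsGT_zero hb).mul h2
  have eP : ∀ ρ, ∀ y ∈ Ioi (0 : ℝ), cirPlus lam0 lam1 nu0 ρ y =
      1 * powSeries (kummerCoeff b (α ρ)) (κ * y + 0) := fun ρ y _ => by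
    rw [one_mul, add_zero]; exact cirPlus_eq lam0 lam1 nu0 ρ y
  have eM : ∀ ρ, ∀ y ∈ Ioi (0 : ℝ), cirMinus lam0 lam1 nu0 ρ y =
      1 / Real.Gamma (α ρ) * expMoment (tricomiWeight b (α ρ)) 0 (κ * y + 0) := fun ρ y _ => by
    rw [add_zero]; exact cirMinus_eq lam0 lam1 nu0 ρ y
  have kM : ∀ {ρ}, 0 < ρ → 0 < 1 / Real.Gamma (α ρ) := fun h =>
    one_div_pos.2 (Real.Gamma_pos_of_pos (hα h))
  have iP : ∀ {ρ}, 0 < ρ → EntireSeries (kummerCoeff b (α ρ)) _ _ := fun h =>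
    kummerCoeff_entire (hα h) hb
  have iM : ∀ {ρ}, 0 < ρ → LaplaceWeight (Ioi 0) (tricomiWeight b (α ρ)) := fun h =>
    tricomiWeight_laplaceWeight (hα h)
  have sP : ∀ {ρ}, 0 < ρ → SeriesSolves (fun x => x) (fun x => b - x) (α ρ)
    (kummerCoeff b (α ρ)) := fun h => kummerCoeff_solves (hα h) hb
  have sM : ∀ {ρ}, 0 < ρ → LaplaceSolves (Ioi 0) (fun x => x) (fun x => b - x) (α ρ)
    (tricomiWeight b (α ρ)) := fun h => tricomiWeight_solves (hα h)
  have dP : ∀ {ρ}, 0 < ρ → ∀ y ∈ Ioi (0 : ℝ),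
      DifferentiableAt ℝ (powSeries (kummerCoeff b (α ρ))) (κ * y + 0) := fun h y _ =>
    ((iP h).hasDerivAt _).differentiableAt
  have dM : ∀ {ρ}, 0 < ρ → ∀ y ∈ Ioi (0 : ℝ),
      DifferentiableAt ℝ (expMoment (tricomiWeight b (α ρ)) 0) (κ * y + 0) := fun h y hy =>
    (iM h).differentiableAt (by
      have hy : 0 < y := hy
      simp only [add_zero, mem_Ioi]
      positivity)
  have hq : ∀ {ρ ρ'}, ρ < ρ' → ∀ n : ℕ, (α ρ + n) / (b + n) < (α ρ' + n) / (b + n) :=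
    fun h n => by
      have := hαα h
      gcongr
  have t0 := tendsto_rescale_nhdsGT hκ
  have tt := tendsto_rescale_atTop hκ 0
  have D0 : Ioi (0 : ℝ) ∈ 𝓝[>] (0 : ℝ) := self_mem_nhdsWithin
  have Dt : Ioi (0 : ℝ) ∈ atTop := Ioi_mem_atTop 0
  have tr : ∀ {φ ψ F G : ℝ → ℝ} {K L : ℝ} {l : Filter ℝ} {E : EReal} {σ : ℝ},
      MonotonicLimit (wronskianFn F G) l E σ → 0 < K → 0 < L →
      (∀ y ∈ Ioi (0 : ℝ), φ y = K * F (κ * y + 0)) → (∀ y ∈ Ioi (0 : ℝ), ψ y = L * G (κ * y + 0)) →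
      (∀ y ∈ Ioi (0 : ℝ), DifferentiableAt ℝ F (κ * y + 0)) →
      (∀ y ∈ Ioi (0 : ℝ), DifferentiableAt ℝ G (κ * y + 0)) → Ioi (0 : ℝ) ∈ l →
      Tendsto (fun y : ℝ => κ * y + 0) l l → (∀ k : ℝ, 0 < k → (k : EReal) * E = E) →
      MonotonicLimit (wronskianFn φ ψ) l E σ :=
    fun {φ ψ F G K L l E σ} h hK hL h1 h2 h3 h4 h5 h6 hE => by
      have := h.rescale isOpen_Ioi hK hL hκ h1 h2 h3 h4 h5 h6
      rwa [hE _ (by positivity)] at this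
  refine ⟨fun ρ h => ⟨differentiableOn_rescale (eP ρ) (dP h),
    differentiableOn_rescale (eM ρ) (dM h)⟩, ?_, ?_, ?_, ?_, ?_, ?_⟩
  · refine MonotonicLimit.exists_sign_pair
      (W := fun a b => wronskianFn (cirPlus lam0 lam1 nu0 a) (cirPlus lam0 lam1 nu0 b))
      (fun a b x => wronskianFn_swap _ _ x) (fun r s hr hrs => ?_) hρ₁ hρ₂
    have hs := hr.trans hrs
    exact MonotonicLimit.exists_rescale (series_wronskian_zero (iP hr) (iP hs) (hq hrs) (sP hr)
      (sP hs)) isOpen_Ioi one_pos one_pos hκ (eP r) (eP s) (dP hr) (dP hs) D0 t0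
  · refine MonotonicLimit.sign_pair
      (W := fun a b => wronskianFn (cirPlus lam0 lam1 nu0 a) (cirPlus lam0 lam1 nu0 b))
      (fun a b x => wronskianFn_swap _ _ x) (fun r s hr hrs => ?_) hρ₁ hρ₂
    have hs := hr.trans hrs
    exact tr (series_wronskian_atTop (iP hr) (iP hs) (hq hrs) (sP hr) (sP hs)) one_pos one_pos
      (eP r) (eP s) (dP hr) (dP hs) Dt tt fun _ => pos_real_mul_top
  · refine MonotonicLimit.sign_pair
      (W := fun a b => wronskianFn (cirMinus lam0 lam1 nu0 b) (cirMinus lam0 lam1 nu0 a))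
      (fun a b x => wronskianFn_swap _ _ x) (fun r s hr hrs => ?_) hρ₂ hρ₁
    have hs := hr.trans hrs
    exact tr (laplace_wronskian_left hI (iM hr) (iM hs) (sM hr) (sM hs) (hαα hrs)
      (tricomiWeight_ratio (hαα hrs)) eventually_mem_Ioi_and_le hp) (kM hs) (kM hr)
      (eM s) (eM r) (dM hs) (dM hr) D0 t0 fun _ => pos_real_mul_top
  · rw [← mul_zero (Real.sign (ρ₁ - ρ₂) : EReal)]
    refine MonotonicLimit.sign_pair
      (W := fun a b => wronskianFn (cirMinus lam0 lam1 nu0 b) (cirMinus lam0 lam1 nu0 a))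
      (fun a b x => wronskianFn_swap _ _ x) (fun r s hr hrs => ?_) hρ₂ hρ₁
    have hs := hr.trans hrs
    exact tr (laplace_wronskian_atTop hI (iM hr) (iM hs) (sM hr) (sM hs) (hαα hrs)
      (tricomiWeight_ratio (hαα hrs))) (kM hs) (kM hr)
      (eM s) (eM r) (dM hs) (dM hr) Dt tt fun _ _ => mul_zero _
  · refine tr (mixed_wronskian_zero hI (iP hρ₁) (iP hρ₂) (iM hρ₂) (sP hρ₁) (sP hρ₂) (sM hρ₂)
      (hα hρ₂) ?_ hp) one_pos (kM hρ₂) (eP ρ₁) (eM ρ₂)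
      (dP hρ₁) (dM hρ₂) D0 t0 fun _ => pos_real_mul_bot
    filter_upwards [Ioc_mem_nhdsGT hb] with x hx using sub_nonneg.2 hx.2
  -- With `a = ρ₁/λ₁`, the number `a / (a + b)` is a positive lower bound for all ratios `(a + n) /
  -- (b + n)`, whether or not `a < b`.
  · refine tr (mixed_wronskian_atTop (iP hρ₁) (iM hρ₂) (sP hρ₁) (sM hρ₂)
      (d := α ρ₁ / (α ρ₁ + b)) (div_pos (hα hρ₁) (add_pos (hα hρ₁) hb)) (fun n => ?_) ?_) one_pos
      (kM hρ₂) (eP ρ₁) (eM ρ₂) (dP hρ₁) (dM hρ₂) Dt tt fun _ => pos_real_mul_bot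
    · have h1 := hα hρ₁
      have h2 : (0 : ℝ) ≤ n := by positivity
      rw [div_le_div_iff₀ (by positivity) (by positivity)]
      nlinarith [mul_nonneg h2 hb.le, mul_pos h1 h1]
    · filter_upwards [eventually_ge_atTop b] with x hx using sub_nonpos.2 hx

/-! ### Ornstein-Uhlenbeck diffusion -/

theorem ou_wronskians {ρ₁ ρ₂ : ℝ} (hρ₁ : 0 < ρ₁) (hρ₂ : 0 < ρ₂) {lam0 lam1 nu0 : ℝ}
    (hnu : 0 < nu0) (hlam1 : 0 < lam1) :
    (∀ ρ : ℝ, 0 < ρ → DifferentiableOn ℝ (ouPlus lam0 lam1 nu0 ρ) univ ∧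
        DifferentiableOn ℝ (ouMinus lam0 lam1 nu0 ρ) univ) ∧
      MonotonicLimit (wronskianFn (ouPlus lam0 lam1 nu0 ρ₁) (ouPlus lam0 lam1 nu0 ρ₂)) atBot 0
        (Real.sign (ρ₂ - ρ₁)) ∧
      MonotonicLimit (wronskianFn (ouPlus lam0 lam1 nu0 ρ₁) (ouPlus lam0 lam1 nu0 ρ₂)) atTop
        ((Real.sign (ρ₂ - ρ₁) : EReal) * ⊤) (Real.sign (ρ₂ - ρ₁)) ∧
      MonotonicLimit (wronskianFn (ouMinus lam0 lam1 nu0 ρ₁) (ouMinus lam0 lam1 nu0 ρ₂)) atBot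
        ((Real.sign (ρ₁ - ρ₂) : EReal) * ⊤) (Real.sign (ρ₁ - ρ₂)) ∧
      MonotonicLimit (wronskianFn (ouMinus lam0 lam1 nu0 ρ₁) (ouMinus lam0 lam1 nu0 ρ₂)) atTop 0
        (Real.sign (ρ₁ - ρ₂)) ∧
      MonotonicLimit (wronskianFn (ouPlus lam0 lam1 nu0 ρ₁) (ouMinus lam0 lam1 nu0 ρ₂)) atBot
        ⊥ (-1) ∧
      MonotonicLimit (wronskianFn (ouPlus lam0 lam1 nu0 ρ₁) (ouMinus lam0 lam1 nu0 ρ₂)) atTop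
        ⊥ (-1) := by
  set k := √(kappaParam lam1 nu0)
  have hk : 0 < k := Real.sqrt_pos.2 (by simp only [kappaParam]; positivity)
  set e := -(k * (lam0 / lam1))
  set α : ℝ → ℝ := fun ρ => ρ / lam1
  have hα : ∀ {ρ}, 0 < ρ → 0 < α ρ := fun h => by simp only [α]; positivity
  have hαα : ∀ {ρ ρ'}, ρ < ρ' → α ρ < α ρ' := fun h => by simp only [α]; gcongr
  have hI := integratingFactor_cylinder
  have hp : Tendsto (fun x : ℝ => Real.exp (-x ^ 2 / 2)) atBot (𝓝 0) := by
    refine Real.tendsto_exp_atBot.comp ?_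
    have h1 : Tendsto (fun x : ℝ => x ^ 2) atBot atTop := by
      refine (tendsto_pow_atTop two_ne_zero).comp tendsto_abs_atBot_atTop |>.congr fun x => ?_
      simp
    exact (tendsto_neg_atTop_atBot.comp h1).atBot_div_const two_pos
  have hl : ∀ x₀ ∈ (univ : Set ℝ), ∀ᶠ x : ℝ in atBot, x ∈ (univ : Set ℝ) ∧ x ≤ x₀ := fun x₀ _ => by
    filter_upwards [eventually_le_atBot x₀] with x hx using ⟨mem_univ x, hx⟩
  have eM : ∀ ρ, ∀ y ∈ (univ : Set ℝ), ouMinus lam0 lam1 nu0 ρ y =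
      1 / Real.Gamma (α ρ) * cylinderSol (α ρ) (k * y + e) := fun ρ y _ => by
    rw [ouMinus, ouBase_eq hlam1]
    simp only [e, α, k]
    ring_nf
  have eP : ∀ ρ, ∀ y ∈ (univ : Set ℝ), ouPlus lam0 lam1 nu0 ρ y =
      1 / Real.Gamma (α ρ) * (fun z => cylinderSol (α ρ) (-z)) (k * y + e) := fun ρ y _ => by
    rw [ouPlus, ouBase_eq hlam1]
    simp only [e, α, k]
    ring_nf
  have kM : ∀ {ρ}, 0 < ρ → 0 < 1 / Real.Gamma (α ρ) := fun h =>
    one_div_pos.2 (Real.Gamma_pos_of_pos (hα h))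
  have iM : ∀ {ρ}, 0 < ρ → LaplaceWeight univ (cylinderWeight (α ρ)) := fun h =>
    cylinderWeight_laplaceWeight (hα h)
  have sM : ∀ {ρ}, 0 < ρ → LaplaceSolves univ (fun _ => 1) (fun x => -x) (α ρ)
    (cylinderWeight (α ρ)) := fun h => cylinderWeight_solves (hα h)
  have dM : ∀ {ρ}, 0 < ρ → ∀ y ∈ (univ : Set ℝ),
      DifferentiableAt ℝ (cylinderSol (α ρ)) (k * y + e) := fun h y hy =>
    (iM h).differentiableAt (mem_univ _)
  have dP : ∀ {ρ}, 0 < ρ → ∀ y ∈ (univ : Set ℝ),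
      DifferentiableAt ℝ (fun z => cylinderSol (α ρ) (-z)) (k * y + e) := fun h y hy =>
    ((cylinderSol_neg_solves (hα h)).deriv_one _ (mem_univ _)).differentiableAt
  have tb := tendsto_rescale_atBot hk e
  have tt := tendsto_rescale_atTop hk e
  have tr : ∀ {φ ψ F G : ℝ → ℝ} {K L : ℝ} {l : Filter ℝ} {E : EReal} {σ : ℝ},
      MonotonicLimit (wronskianFn F G) l E σ → 0 < K → 0 < L →
      (∀ y ∈ (univ : Set ℝ), φ y = K * F (k * y + e)) →
      (∀ y ∈ (univ : Set ℝ), ψ y = L * G (k * y + e)) →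
      (∀ y ∈ (univ : Set ℝ), DifferentiableAt ℝ F (k * y + e)) →
      (∀ y ∈ (univ : Set ℝ), DifferentiableAt ℝ G (k * y + e)) →
      Tendsto (fun y : ℝ => k * y + e) l l → (∀ k : ℝ, 0 < k → (k : EReal) * E = E) →
      MonotonicLimit (wronskianFn φ ψ) l E σ :=
    fun {φ ψ F G K L l E σ} h hK hL h1 h2 h3 h4 h6 hE => by
      have := h.rescale isOpen_univ hK hL hk h1 h2 h3 h4 univ_mem h6
      rwa [hE _ (by positivity)] at this
  -- The increasing solutions are reflections, so their limits are read off at the opposite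
  -- endpoint.
  have refl : ∀ {W W' : ℝ → ℝ} {l l' : Filter ℝ} {E : EReal} {σ : ℝ}, MonotonicLimit W l' E σ →
      Tendsto (fun x : ℝ => -x) l l' → (∀ x, W' x = W (-x)) → MonotonicLimit W' l E σ :=
    fun {W W' l l' E σ} h h1 h2 => by
      have := h.comp_scale (W' := W') one_pos (Or.inr fun x y hxy => neg_le_neg hxy) h1
        (Eventually.of_forall fun x => by rw [h2, one_mul])
      simpa using this
  refine ⟨fun ρ h => ⟨differentiableOn_rescale (eP ρ) (dP h),
    differentiableOn_rescale (eM ρ) (dM h)⟩, ?_, ?_, ?_, ?_, ?_, ?_⟩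
  · rw [← mul_zero (Real.sign (ρ₂ - ρ₁) : EReal)]
    refine MonotonicLimit.sign_pair
      (W := fun a b => wronskianFn (ouPlus lam0 lam1 nu0 a) (ouPlus lam0 lam1 nu0 b))
      (fun a b x => wronskianFn_swap _ _ x) (fun r s hr hrs => ?_) hρ₁ hρ₂
    have hs := hr.trans hrs
    exact tr (refl (laplace_wronskian_atTop hI (iM hr) (iM hs) (sM hr) (sM hs) (hαα hrs)
      (cylinderWeight_ratio (hαα hrs))) tendsto_neg_atBot_atTop
      (cylinder_wronskian_neg_neg (hα hr) (hα hs))) (kM hr) (kM hs) (eP r) (eP s) (dP hr) (dP hs)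
      tb fun _ _ => mul_zero _
  · refine MonotonicLimit.sign_pair
      (W := fun a b => wronskianFn (ouPlus lam0 lam1 nu0 a) (ouPlus lam0 lam1 nu0 b))
      (fun a b x => wronskianFn_swap _ _ x) (fun r s hr hrs => ?_) hρ₁ hρ₂
    have hs := hr.trans hrs
    exact tr (refl (laplace_wronskian_left hI (iM hr) (iM hs) (sM hr) (sM hs) (hαα hrs)
      (cylinderWeight_ratio (hαα hrs)) hl hp) tendsto_neg_atTop_atBot
      (cylinder_wronskian_neg_neg (hα hr) (hα hs))) (kM hr) (kM hs) (eP r) (eP s) (dP hr) (dP hs)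
      tt fun _ => pos_real_mul_top
  · refine MonotonicLimit.sign_pair
      (W := fun a b => wronskianFn (ouMinus lam0 lam1 nu0 b) (ouMinus lam0 lam1 nu0 a))
      (fun a b x => wronskianFn_swap _ _ x) (fun r s hr hrs => ?_) hρ₂ hρ₁
    have hs := hr.trans hrs
    exact tr (laplace_wronskian_left hI (iM hr) (iM hs) (sM hr) (sM hs) (hαα hrs)
      (cylinderWeight_ratio (hαα hrs)) hl hp) (kM hs) (kM hr)
      (eM s) (eM r) (dM hs) (dM hr) tb fun _ => pos_real_mul_top
  · rw [← mul_zero (Real.sign (ρ₁ - ρ₂) : EReal)]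
    refine MonotonicLimit.sign_pair
      (W := fun a b => wronskianFn (ouMinus lam0 lam1 nu0 b) (ouMinus lam0 lam1 nu0 a))
      (fun a b x => wronskianFn_swap _ _ x) (fun r s hr hrs => ?_) hρ₂ hρ₁
    have hs := hr.trans hrs
    exact tr (laplace_wronskian_atTop hI (iM hr) (iM hs) (sM hr) (sM hs) (hαα hrs)
      (cylinderWeight_ratio (hαα hrs))) (kM hs) (kM hr)
      (eM s) (eM r) (dM hs) (dM hr) tt fun _ _ => mul_zero _
  · exact tr (refl (cylinder_mixed_wronskian_atTop (hα hρ₂) (hα hρ₁)) tendsto_neg_atBot_atTop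
      (cylinder_mixed_wronskian_neg_arg (hα hρ₁) (hα hρ₂))) (kM hρ₁) (kM hρ₂) (eP ρ₁) (eM ρ₂)
      (dP hρ₁) (dM hρ₂) tb fun _ => pos_real_mul_bot
  · exact tr (cylinder_mixed_wronskian_atTop (hα hρ₁) (hα hρ₂)) (kM hρ₁) (kM hρ₂) (eP ρ₁) (eM ρ₂)
      (dP hρ₁) (dM hρ₂) tt fun _ => pos_real_mul_bot

end

theorem proposition4 (ρ₁ ρ₂ : ℝ) (hρ₁ : 0 < ρ₁) (hρ₂ : 0 < ρ₂) :
    -- squared Bessel diffusion, state space (0, ∞)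
    (∀ lam0 nu0 : ℝ, 0 < nu0 → nu0 ^ 2 / 2 < lam0 →
      (∀ ρ : ℝ, 0 < ρ → DifferentiableOn ℝ (sqbPlus lam0 nu0 ρ) (Ioi 0) ∧
        DifferentiableOn ℝ (sqbMinus lam0 nu0 ρ) (Ioi 0)) ∧
      (∃ C : ℝ, 0 < C ∧ MonotonicLimit (wronskianFn (sqbPlus lam0 nu0 ρ₁) (sqbPlus lam0 nu0 ρ₂)) (𝓝[>] 0)
        ((Real.sign (ρ₂ - ρ₁) * C : ℝ) : EReal) (Real.sign (ρ₂ - ρ₁))) ∧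
      MonotonicLimit (wronskianFn (sqbPlus lam0 nu0 ρ₁) (sqbPlus lam0 nu0 ρ₂)) atTop
        ((Real.sign (ρ₂ - ρ₁) : EReal) * ⊤) (Real.sign (ρ₂ - ρ₁)) ∧
      MonotonicLimit (wronskianFn (sqbMinus lam0 nu0 ρ₁) (sqbMinus lam0 nu0 ρ₂)) (𝓝[>] 0)
        ((Real.sign (ρ₁ - ρ₂) : EReal) * ⊤) (Real.sign (ρ₁ - ρ₂)) ∧
      MonotonicLimit (wronskianFn (sqbMinus lam0 nu0 ρ₁) (sqbMinus lam0 nu0 ρ₂)) atTop 0 (Real.sign (ρ₁ - ρ₂)) ∧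
      MonotonicLimit (wronskianFn (sqbPlus lam0 nu0 ρ₁) (sqbMinus lam0 nu0 ρ₂)) (𝓝[>] 0) ⊥ (-1) ∧
      (ρ₁ ≤ ρ₂ → MonotonicLimit (wronskianFn (sqbPlus lam0 nu0 ρ₁) (sqbMinus lam0 nu0 ρ₂)) atTop 0 (-1)) ∧
      (ρ₂ < ρ₁ → MonotonicLimit (wronskianFn (sqbPlus lam0 nu0 ρ₁) (sqbMinus lam0 nu0 ρ₂)) atTop ⊥ (-1))) ∧
    -- CIR diffusion, state space (0, ∞)
    (∀ lam0 lam1 nu0 : ℝ, 0 < nu0 → 0 < lam1 → nu0 ^ 2 / 2 < lam0 →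
      (∀ ρ : ℝ, 0 < ρ → DifferentiableOn ℝ (cirPlus lam0 lam1 nu0 ρ) (Ioi 0) ∧
        DifferentiableOn ℝ (cirMinus lam0 lam1 nu0 ρ) (Ioi 0)) ∧
      (∃ C : ℝ, 0 < C ∧ MonotonicLimit (wronskianFn (cirPlus lam0 lam1 nu0 ρ₁) (cirPlus lam0 lam1 nu0 ρ₂)) (𝓝[>] 0)
        ((Real.sign (ρ₂ - ρ₁) * C : ℝ) : EReal) (Real.sign (ρ₂ - ρ₁))) ∧
      MonotonicLimit (wronskianFn (cirPlus lam0 lam1 nu0 ρ₁) (cirPlus lam0 lam1 nu0 ρ₂)) atTop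
        ((Real.sign (ρ₂ - ρ₁) : EReal) * ⊤) (Real.sign (ρ₂ - ρ₁)) ∧
      MonotonicLimit (wronskianFn (cirMinus lam0 lam1 nu0 ρ₁) (cirMinus lam0 lam1 nu0 ρ₂)) (𝓝[>] 0)
        ((Real.sign (ρ₁ - ρ₂) : EReal) * ⊤) (Real.sign (ρ₁ - ρ₂)) ∧
      MonotonicLimit (wronskianFn (cirMinus lam0 lam1 nu0 ρ₁) (cirMinus lam0 lam1 nu0 ρ₂)) atTop 0 (Real.sign (ρ₁ - ρ₂)) ∧
      MonotonicLimit (wronskianFn (cirPlus lam0 lam1 nu0 ρ₁) (cirMinus lam0 lam1 nu0 ρ₂)) (𝓝[>] 0) ⊥ (-1) ∧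
      MonotonicLimit (wronskianFn (cirPlus lam0 lam1 nu0 ρ₁) (cirMinus lam0 lam1 nu0 ρ₂)) atTop ⊥ (-1)) ∧
    -- Ornstein-Uhlenbeck diffusion, state space (-∞, ∞)
    (∀ lam0 lam1 nu0 : ℝ, 0 < nu0 → 0 < lam1 →
      (∀ ρ : ℝ, 0 < ρ → DifferentiableOn ℝ (ouPlus lam0 lam1 nu0 ρ) univ ∧
        DifferentiableOn ℝ (ouMinus lam0 lam1 nu0 ρ) univ) ∧
      MonotonicLimit (wronskianFn (ouPlus lam0 lam1 nu0 ρ₁) (ouPlus lam0 lam1 nu0 ρ₂)) atBot 0 (Real.sign (ρ₂ - ρ₁)) ∧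
      MonotonicLimit (wronskianFn (ouPlus lam0 lam1 nu0 ρ₁) (ouPlus lam0 lam1 nu0 ρ₂)) atTop
        ((Real.sign (ρ₂ - ρ₁) : EReal) * ⊤) (Real.sign (ρ₂ - ρ₁)) ∧
      MonotonicLimit (wronskianFn (ouMinus lam0 lam1 nu0 ρ₁) (ouMinus lam0 lam1 nu0 ρ₂)) atBot
        ((Real.sign (ρ₁ - ρ₂) : EReal) * ⊤) (Real.sign (ρ₁ - ρ₂)) ∧
      MonotonicLimit (wronskianFn (ouMinus lam0 lam1 nu0 ρ₁) (ouMinus lam0 lam1 nu0 ρ₂)) atTop 0 (Real.sign (ρ₁ - ρ₂)) ∧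
      MonotonicLimit (wronskianFn (ouPlus lam0 lam1 nu0 ρ₁) (ouMinus lam0 lam1 nu0 ρ₂)) atBot ⊥ (-1) ∧
      MonotonicLimit (wronskianFn (ouPlus lam0 lam1 nu0 ρ₁) (ouMinus lam0 lam1 nu0 ρ₂)) atTop ⊥ (-1)) :=
  ⟨fun _ _ hnu hlam => sqb_wronskians hρ₁ hρ₂ hnu hlam,
    fun _ _ _ hnu hlam1 hlam => cir_wronskians hρ₁ hρ₂ hnu hlam1 hlam,
    fun _ _ _ hnu hlam1 => ou_wronskians hρ₁ hρ₂ hnu hlam1⟩
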